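/- **Conventions.** All vector spaces are complex. A *bornological vector space* is a complete convex bornological vector space: a vector space $V$ with a family of bounded subsets (closed under subsets and finite unions, containing the singletons, stable under scalar multiples) in which every bounded set is contained in a bounded completant disk, i.e. a bounded absolutely convex set $T$ whose gauge is a complete norm on its linear span $\langle T\rangle$. A linear map is *bounded* if it maps bounded sets to bounded sets; $\mathrm{Hom}(V,W)$, the space of bounded linear maps, carries the equibounded bornology. A *bornological isomorphism* is a bijective linear map which is bounded together with its inverse. $V\hat\otimes W$ is the completed bornological tensor product (bounded linear maps $V\hat\otimes W\to X$ correspond to bounded bilinear maps $V\times W\to X$), and $\tau$ is the flip map. $V$ has the *approximation property* if for every disk $S\subseteq V$ that is compact in some Banach space $\langle T\rangle$, $T$ a bounded completant disk, there are bounded finite rank operators $f_n:V\to V$ converging to the identity in $\mathrm{Hom}(\langle S\rangle,V)$. A *bornological algebra* $H$ is a bornological vector space with a bounded associative multiplication $\mu:H\hat\otimes H\to H$ (no unit is assumed). It is *essential* if $H\neq 0$ and $\mu$ induces a bornological isomorphism $H\hat\otimes_H H\cong H$, where $V\hat\otimes_H W$ is the quotient of $V\hat\otimes W$ by the closed linear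 span of the elements $vh\otimes w-v\otimes hw$. The *multiplier algebra* $M(H)$ consists of the pairs $(L,R)$ of bounded linear maps $H\to H$ with $L(fg)=L(f)g$, $R(fg)=fR(g)$ and $fL(g)=R(f)g$, with the bornology inherited from $\mathrm{Hom}(H,H)\oplus\mathrm{Hom}(H,H)$; we write $m\cdot f=L(f)$ and $f\cdot m=R(f)$ for $m=(L,R)$. A bounded homomorphism $H\to M(K)$ is *essential* if it induces bornological isomorphisms $H\hat\otimes_H K\cong K$ and $K\hat\otimes_H H\cong K$; it then extends uniquely to a bounded unital homomorphism $M(H)\to M(K)$. A functional $\omega$ is *faithful* if $\omega(fg)=0$ for all $g$ implies $f=0$, and $\omega(fg)=0$ for all $f$ implies $g=0$. A *bornological quantum group* is an essential bornological algebra $H$ with the approximation property, together with a *comultiplication*, i.e. an essential homomorphism $\Delta:H\to M(H\hat\otimes H)$ with $(\Delta\hat\otimes\mathrm{id})\Delta=(\mathrm{id}\hat\otimes\Delta)\Delta$, such that the Galois maps $$\gamma_l(f\otimes g)=\Delta(f)(g\otimes 1),\quad \gamma_r(f\otimes g)=\Delta(f)(1\otimes g),\quad \rho_l(f\otimes g)=(f\otimes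 1)\Delta(g),\quad \rho_r(f\otimes g)=(1\otimes f)\Delta(g)$$ are bornological isomorphisms of $H\hat\otimes H$ onto itself, and a faithful bounded linear functional $\phi:H\to\mathbb C$ which is left invariant, $(\mathrm{id}\hat\otimes\phi)\Delta(f)=\phi(f)1$ for all $f\in H$. Here, for a bounded functional $\omega$, the slices $(\mathrm{id}\hat\otimes\omega)\Delta(f),(\omega\hat\otimes\mathrm{id})\Delta(f)\in M(H)$ are the multipliers acting on $g\in H$ from the left by $(\mathrm{id}\hat\otimes\omega)\gamma_l(f\otimes g)$, respectively $(\omega\hat\otimes\mathrm{id})\gamma_r(f\otimes g)$, and from the right by $(\mathrm{id}\hat\otimes\omega)\rho_l(g\otimes f)$, respectively $(\omega\hat\otimes\mathrm{id})\rho_r(g\otimes f)$. A *counit* $\epsilon$ and an *antipode* $S$ of $H$ are an essential bounded algebra homomorphism $\epsilon:H\to\mathbb C$ and a bornological isomorphism $S:H\to H$ which is an algebra antihomomorphism and a coalgebra antihomomorphism ($\Delta S=(S\hat\otimes S)\tau\Delta$), such that $(\epsilon\hat\otimes\mathrm{id})\Delta=\mathrm{id}=(\mathrm{id}\hat\otimes\epsilon)\Delta$,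 $\mu(S\hat\otimes\mathrm{id})\gamma_r=\epsilon\hat\otimes\mathrm{id}$ and $\mu(\mathrm{id}\hat\otimes S)\rho_l=\mathrm{id}\hat\otimes\epsilon$. **Proposition.** Let $H$ be a bornological quantum group with left invariant functional $\phi$. There is a unique algebra homomorphism $\sigma:H\to H$ with $$\phi(fg)=\phi(g\,\sigma(f))\qquad\text{for all } f,g\in H,$$ and $\sigma$ is a bornological isomorphism; so $\sigma$ is the unique bounded algebra automorphism of $H$ with this property. Moreover $\phi$ is invariant under $\sigma$, that is, $\phi(\sigma(f))=\phi(f)$ for all $f\in H$. Furthermore, $H$ has a counit $\epsilon$ and an antipode $S$, which are uniquely determined, and as a consequence $S^2\sigma=\sigma S^2$. -/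

import Mathlib

open Set Filter Topology Bornology Pointwise

noncomputable section

set_option linter.unusedSectionVars false

namespace BornQG

universe u v w

/-! ## Convex bornologies, completant disks, complete bornological vector spaces -/

section Disks

variable {V : Type*} [AddCommGroup V] [Module ℂ V]

/-- A disk is a circled convex subset of a complex vector space. -/
def IsDisk (D : Set V) : Prop := Balanced ℂ D ∧ Convex ℝ D

/-- A disk `D` is completant if its linear span, with the Minkowski functional `gauge D`,
is a Banach space. -/
structure IsCompletant (D : Set V) : Prop where
  disk : IsDisk D
  separated : ∀ x ∈ Submodule.span ℂ D, gauge D x = 0 → x = 0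
  complete : ∀ u : ℕ → V, (∀ n, u n ∈ Submodule.span ℂ D) →
    (∀ ε : ℝ, 0 < ε → ∃ N, ∀ m ≥ N, ∀ n ≥ N, gauge D (u m - u n) < ε) →
    ∃ x ∈ Submodule.span ℂ D, Tendsto (fun n => gauge D (u n - x)) atTop (𝓝 0)

/-- The sequence `u` lies in the span `⟨D⟩` of the disk `D` and converges there to `x`. -/
def ConvergesIn (D : Set V) (u : ℕ → V) (x : V) : Prop :=
  (∀ n, u n ∈ Submodule.span ℂ D) ∧ x ∈ Submodule.span ℂ D ∧
    Tendsto (fun n => gauge D (u n - x)) atTop (𝓝 0)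

variable {D : Set V}

theorem IsDisk.zero_mem (hD : IsDisk D) (hn : D.Nonempty) : (0 : V) ∈ D := by
  obtain ⟨x, hx⟩ := hn
  simpa using hD.1.smul_mem (a := (0 : ℂ)) (by simp) hx

theorem IsDisk.smul_subset (hD : IsDisk D) {r s : ℝ} (hr : 0 ≤ r) (hrs : r ≤ s) :
    r • D ⊆ s • D := by
  rintro _ ⟨d, hd, rfl⟩
  rcases hr.eq_or_lt with rfl | hr0
  · exact ⟨0, hD.zero_mem ⟨d, hd⟩, by simp⟩
  · have hs : 0 < s := hr0.trans_le hrs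
    refine ⟨((r / s : ℝ) : ℂ) • d, hD.1.smul_mem ?_ hd, ?_⟩
    · rw [Complex.norm_real, Real.norm_eq_abs, abs_of_nonneg (by positivity)]
      exact (div_le_one hs).2 hrs
    · simp only [Complex.coe_smul, smul_smul]
      congr 1
      field_simp

theorem IsDisk.add_mem (hD : IsDisk D) {r s : ℝ} (hr : 0 ≤ r) (hs : 0 ≤ s) {x y : V}
    (hx : x ∈ r • D) (hy : y ∈ s • D) : x + y ∈ (r + s) • D := by
  rw [hD.2.add_smul hr hs]
  exact Set.add_mem_add hx hy

theorem IsDisk.csmul_mem (hD : IsDisk D) {r : ℝ} {x : V} (z : ℂ)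
    (hx : x ∈ r • D) : z • x ∈ (‖z‖ * r) • D := by
  obtain ⟨d, hd, rfl⟩ := hx
  rcases eq_or_ne z 0 with rfl | hz
  · exact ⟨0, hD.zero_mem ⟨d, hd⟩, by simp⟩
  · have hz' : ‖z‖ ≠ 0 := norm_ne_zero_iff.2 hz
    refine ⟨(z / (‖z‖ : ℂ)) • d, hD.1.smul_mem ?_ hd, ?_⟩
    · simp [hz']
    · simp only [← Complex.coe_smul, smul_smul]
      congr 1
      have : (‖z‖ : ℂ) ≠ 0 := by exact_mod_cast hz'
      push_cast
      field_simp

theorem IsDisk.neg_mem (hD : IsDisk D) {r : ℝ} {x : V} (hx : x ∈ r • D) : -x ∈ r • D := by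
  simpa using hD.csmul_mem (-1) hx

theorem IsDisk.sub_mem (hD : IsDisk D) {r s : ℝ} (hr : 0 ≤ r) (hs : 0 ≤ s) {x y : V}
    (hx : x ∈ r • D) (hy : y ∈ s • D) : x - y ∈ (r + s) • D := by
  rw [sub_eq_add_neg]; exact hD.add_mem hr hs hx (hD.neg_mem hy)

theorem smul_subset_span (r : ℝ) : r • D ⊆ (Submodule.span ℂ D : Set V) := by
  rintro _ ⟨d, hd, rfl⟩
  have := (Submodule.span ℂ D).smul_mem (r : ℂ) (Submodule.subset_span hd)
  simpa using this

theorem IsDisk.exists_mem_smul (hD : IsDisk D) (hn : D.Nonempty) {x : V}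
    (hx : x ∈ Submodule.span ℂ D) : ∃ r : ℝ, 0 < r ∧ x ∈ r • D := by
  induction hx using Submodule.span_induction with
  | mem x h => exact ⟨1, one_pos, by simpa⟩
  | zero => exact ⟨1, one_pos, by simpa using hD.zero_mem hn⟩
  | add x y _ _ hx hy =>
    obtain ⟨r, hr, hx⟩ := hx
    obtain ⟨s, hs, hy⟩ := hy
    exact ⟨r + s, by positivity, hD.add_mem hr.le hs.le hx hy⟩
  | smul a x _ hx =>
    obtain ⟨r, hr, hx⟩ := hx
    exact ⟨‖a‖ * r + 1, by positivity,
      hD.smul_subset (by positivity) (by linarith) (hD.csmul_mem a hx)⟩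

theorem IsDisk.mem_smul_of_gauge_lt (hD : IsDisk D) (hn : D.Nonempty) {x : V} {r : ℝ}
    (hx : x ∈ Submodule.span ℂ D) (h : gauge D x < r) : x ∈ r • D := by
  obtain ⟨r0, hr0, hx0⟩ := hD.exists_mem_smul hn hx
  obtain ⟨s, ⟨hs, hxs⟩, hsr⟩ := exists_lt_of_csInf_lt
    (s := {r ∈ Set.Ioi (0 : ℝ) | x ∈ r • D}) ⟨r0, hr0, hx0⟩ h
  exact hD.smul_subset (le_of_lt hs) hsr.le hxs

/-- Convergence of the series `∑ 2⁻ⁿ dₙ` with terms in a disk. -/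
def HasDyadicSums (D : Set V) : Prop :=
  ∀ d : ℕ → V, (∀ n, d n ∈ D) → ∃ x, ∀ N : ℕ,
    x - ∑ n ∈ Finset.range N, ((1 / 2 : ℝ) ^ n) • d n ∈ (4 * (1 / 2 : ℝ) ^ N) • D

theorem IsDisk.dyadic_mem (hD : IsDisk D) (hn : D.Nonempty) (d : ℕ → V) (hd : ∀ n, d n ∈ D)
    (N k : ℕ) :
    ∑ n ∈ Finset.range (N + k), ((1 / 2 : ℝ) ^ n) • d n
      - ∑ n ∈ Finset.range N, ((1 / 2 : ℝ) ^ n) • d n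
      ∈ (2 * (1 / 2 : ℝ) ^ N - 2 * (1 / 2 : ℝ) ^ (N + k)) • D := by
  induction k with
  | zero => simpa using ⟨0, hD.zero_mem hn, by simp⟩
  | succ k ih =>
    have h1 : ((1 / 2 : ℝ) ^ (N + k)) • d (N + k) ∈ ((1 / 2 : ℝ) ^ (N + k)) • D :=
      Set.smul_mem_smul_set (hd _)
    have h0 : (0 : ℝ) ≤ 2 * (1 / 2 : ℝ) ^ N - 2 * (1 / 2 : ℝ) ^ (N + k) := by
      have : (1 / 2 : ℝ) ^ (N + k) ≤ (1 / 2 : ℝ) ^ N :=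
        pow_le_pow_of_le_one (by norm_num) (by norm_num) (by omega)
      linarith
    have h2 := hD.add_mem h0 (by positivity) ih h1
    have e : 2 * (1 / 2 : ℝ) ^ N - 2 * (1 / 2 : ℝ) ^ (N + (k + 1))
        = 2 * (1 / 2 : ℝ) ^ N - 2 * (1 / 2 : ℝ) ^ (N + k) + (1 / 2 : ℝ) ^ (N + k) := by
      rw [← add_assoc, pow_succ]; ring
    rw [e, ← add_assoc, Finset.sum_range_succ]
    convert h2 using 1
    abel

theorem IsCompletant.eq_zero (hD : IsCompletant D) {x : V}
    (h : ∀ ε : ℝ, 0 < ε → x ∈ ε • D) : x = 0 := by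
  refine hD.separated x (smul_subset_span 1 (h 1 one_pos)) ?_
  refine le_antisymm (le_of_forall_pos_le_add fun ε hε => ?_) (gauge_nonneg x)
  simpa using gauge_le_of_mem hε.le (h ε hε)

theorem IsCompletant.hasDyadicSums (hD : IsCompletant D) : HasDyadicSums D := by
  intro d hd
  have hn : D.Nonempty := ⟨_, hd 0⟩
  set s : ℕ → V := fun N => ∑ n ∈ Finset.range N, ((1 / 2 : ℝ) ^ n) • d n with hs
  have hspan : ∀ N, s N ∈ Submodule.span ℂ D := fun N =>
    Submodule.sum_mem _ fun n _ => smul_subset_span _ (Set.smul_mem_smul_set (hd n))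
  have key : ∀ N M, N ≤ M → s M - s N ∈ (2 * (1 / 2 : ℝ) ^ N) • D := by
    intro N M hNM
    obtain ⟨k, rfl⟩ := Nat.exists_eq_add_of_le hNM
    refine hD.disk.smul_subset ?_ ?_ (hD.disk.dyadic_mem hn d hd N k)
    · have : (1 / 2 : ℝ) ^ (N + k) ≤ (1 / 2 : ℝ) ^ N :=
        pow_le_pow_of_le_one (by norm_num) (by norm_num) (by omega)
      linarith
    · have : (0 : ℝ) ≤ (1 / 2 : ℝ) ^ (N + k) := by positivity
      linarith
  obtain ⟨x, hx, hlim⟩ := hD.complete s hspan (by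
    intro ε hε
    obtain ⟨N, hN⟩ := exists_pow_lt_of_lt_one (show 0 < ε / 4 by positivity)
      (show (1 / 2 : ℝ) < 1 by norm_num)
    refine ⟨N, fun m hm n hn' => ?_⟩
    have h := hD.disk.sub_mem (by positivity) (by positivity) (key N m hm) (key N n hn')
    rw [sub_sub_sub_cancel_right] at h
    exact (gauge_le_of_mem (by positivity) h).trans_lt (by linarith))
  refine ⟨x, fun N => ?_⟩
  have hev := hlim.eventually_lt_const (show (0 : ℝ) < (1 / 2 : ℝ) ^ N by positivity)
  obtain ⟨M, hM, hMN⟩ := (hev.and (eventually_ge_atTop N)).exists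
  have h1 := hD.disk.mem_smul_of_gauge_lt hn (Submodule.sub_mem _ (hspan M) hx) hM
  have h2 := hD.disk.sub_mem (by positivity) (by positivity) (key N M hMN) h1
  rw [show s M - s N - (s M - x) = x - s N by abel] at h2
  refine hD.disk.smul_subset (by positivity) ?_ h2
  have : (0 : ℝ) ≤ (1 / 2 : ℝ) ^ N := by positivity
  linarith

theorem IsCompletant.of_hasDyadicSums (hD : IsDisk D) (hn : D.Nonempty)
    (h0 : ∀ x, (∀ ε : ℝ, 0 < ε → x ∈ ε • D) → x = 0) (hs : HasDyadicSums D) :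
    IsCompletant D := by
  refine ⟨hD, fun x hx hg => h0 x fun ε hε =>
    hD.mem_smul_of_gauge_lt hn hx (by rw [hg]; exact hε), fun u hu hc => ?_⟩
  have hpos : ∀ k : ℕ, (0 : ℝ) < (1 / 2 : ℝ) ^ k := fun k => by positivity
  choose M hM using fun k => hc _ (hpos k)
  let P : ℕ → ℕ := fun k => (Finset.range (k + 1)).sup M
  have hP : ∀ k, M k ≤ P k := fun k => Finset.le_sup (f := M) (by simp)
  have hPm : Monotone P := fun a b hab => Finset.sup_mono (by simpa using hab)
  have hstep : ∀ k, ∀ m ≥ P k, ∀ n ≥ P k, u m - u n ∈ ((1 / 2 : ℝ) ^ k) • D :=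
    fun k m hm n hn' => hD.mem_smul_of_gauge_lt hn (Submodule.sub_mem _ (hu m) (hu n))
      (hM k m ((hP k).trans hm) n ((hP k).trans hn'))
  have hd : ∀ k, ∃ d ∈ D, ((1 / 2 : ℝ) ^ k) • d = u (P (k + 1)) - u (P k) := fun k =>
    hstep k _ (hPm (Nat.le_succ k)) _ le_rfl
  choose d hdD hde using hd
  obtain ⟨x, hx⟩ := hs d hdD
  have hsum : ∀ N, ∑ n ∈ Finset.range N, ((1 / 2 : ℝ) ^ n) • d n = u (P N) - u (P 0) := by
    intro N
    simp_rw [hde]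
    exact Finset.sum_range_sub (fun k => u (P k)) N
  have hx' : x ∈ Submodule.span ℂ D := by
    have := smul_subset_span _ (hx 0)
    simpa using this
  have hlim : ∀ k, ∀ n ≥ P k, u n - (x + u (P 0)) ∈ (5 * (1 / 2 : ℝ) ^ k) • D := by
    intro k n hn'
    have h1 := hx k
    rw [hsum] at h1
    have h2 := hD.sub_mem (by positivity) (by positivity) (hstep k n hn' _ le_rfl) h1
    rw [show u n - u (P k) - (x - (u (P k) - u (P 0))) = u n - (x + u (P 0)) by abel] at h2
    convert h2 using 2
    ring
  refine ⟨x + u (P 0), Submodule.add_mem _ hx' (hu _), ?_⟩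
  rw [Metric.tendsto_atTop]
  intro ε hε
  obtain ⟨k, hk⟩ := exists_pow_lt_of_lt_one (show 0 < ε / 5 by positivity)
      (show (1 / 2 : ℝ) < 1 by norm_num)
  refine ⟨P k, fun n hn' => ?_⟩
  rw [Real.dist_eq, sub_zero, abs_of_nonneg (gauge_nonneg _)]
  exact (gauge_le_of_mem (by positivity) (hlim k n hn')).trans_lt (by linarith)

end Disks

/-- A complete convex bornological vector space (over `ℂ`): scalar multiples of bounded ("small")
sets are bounded, and every bounded set is contained in a bounded completant disk. -/
class CompleteBornology (V : Type*) [AddCommGroup V] [Module ℂ V] [Bornology V] : Prop where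
  smul_bounded : ∀ (c : ℂ) (s : Set V), IsBounded s → IsBounded (c • s)
  exists_completant : ∀ s : Set V, IsBounded s → ∃ D, s ⊆ D ∧ IsBounded D ∧ IsCompletant D

section Basic

variable {V : Type*} [AddCommGroup V] [Module ℂ V] [Bornology V] [CompleteBornology V]

theorem isBounded_csmul (c : ℂ) {s : Set V} (h : IsBounded s) : IsBounded (c • s) :=
  CompleteBornology.smul_bounded c s h

theorem isBounded_rsmul (c : ℝ) {s : Set V} (h : IsBounded s) : IsBounded (c • s) := by
  convert isBounded_csmul (c : ℂ) h using 1
  ext x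
  simp [Set.mem_smul_set]

theorem exists_disk {s : Set V} (h : IsBounded s) :
    ∃ D, s ⊆ D ∧ D.Nonempty ∧ IsBounded D ∧ IsCompletant D := by
  obtain ⟨D, h1, h2, h3⟩ := CompleteBornology.exists_completant (s ∪ {0})
    (h.union isBounded_singleton)
  exact ⟨D, fun x hx => h1 (Or.inl hx), ⟨0, h1 (Or.inr rfl)⟩, h2, h3⟩

theorem isBounded_add {s t : Set V} (hs : IsBounded s) (ht : IsBounded t) :
    IsBounded (s + t) := by
  obtain ⟨D, h1, h2, h3, h4⟩ := exists_disk (hs.union ht)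
  refine (isBounded_rsmul 2 h3).subset ?_
  rintro _ ⟨x, hx, y, hy, rfl⟩
  have := h4.disk.add_mem zero_le_one zero_le_one
    (show x ∈ (1 : ℝ) • D by simpa using h1 (Or.inl hx))
    (show y ∈ (1 : ℝ) • D by simpa using h1 (Or.inr hy))
  norm_num at this
  exact this

/-- A subspace is closed if it contains the limits of its convergent sequences. -/
def IsBornClosed (N : Submodule ℂ V) : Prop :=
  ∀ (D : Set V) (u : ℕ → V) (x : V), IsDisk D → IsBounded D → (∀ n, u n ∈ N) →
    ConvergesIn D u x → x ∈ N

/-- The closure of a subspace: the smallest closed subspace containing it. -/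
def bornClosure (R : Submodule ℂ V) : Submodule ℂ V :=
  sInf {N | IsBornClosed N ∧ R ≤ N}

theorem le_bornClosure (R : Submodule ℂ V) : R ≤ bornClosure R :=
  le_sInf fun _ h => h.2

theorem isBornClosed_bornClosure (R : Submodule ℂ V) : IsBornClosed (bornClosure R) := by
  intro D u x hD hb hu hx
  simp only [bornClosure, Submodule.mem_sInf] at hu ⊢
  exact fun N hN => hN.1 D u x hD hb (fun n => hu n N hN) hx

theorem bornClosure_le {R N : Submodule ℂ V} (hN : IsBornClosed N) (h : R ≤ N) :
    bornClosure R ≤ N := sInf_le ⟨hN, h⟩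

theorem IsBornClosed.mem_of_approx {N : Submodule ℂ V} (hN : IsBornClosed N) {D : Set V}
    (hb : IsBounded D) {x : V}
    (h : ∀ ε : ℝ, 0 < ε → ∃ y ∈ N, x - y ∈ ε • D) : x ∈ N := by
  obtain ⟨E, hE1, hE2, hE3, hE4⟩ := exists_disk (hb.union (isBounded_singleton (x := x)))
  choose y hyN hy using fun n : ℕ => h (1 / ((n : ℝ) + 1)) (by positivity)
  have hDE : ∀ r : ℝ, r • D ⊆ r • E := fun r =>
    Set.smul_set_mono (fun z hz => hE1 (Or.inl hz))
  have hxE : x ∈ Submodule.span ℂ E := Submodule.subset_span (hE1 (Or.inr rfl))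
  have hyE : ∀ n, y n ∈ Submodule.span ℂ E := fun n => by
    have := Submodule.sub_mem _ hxE (smul_subset_span _ (hDE _ (hy n)))
    simpa using this
  refine hN E y x hE4.disk hE3 hyN ⟨hyE, hxE, ?_⟩
  refine squeeze_zero (fun n => gauge_nonneg _) (fun n => ?_)
    tendsto_one_div_add_atTop_nhds_zero_nat
  refine gauge_le_of_mem (by positivity) ?_
  rw [← neg_sub]
  exact hE4.disk.neg_mem (hDE _ (hy n))

end Basic


/-! ## Bounded linear maps -/

section BHom

variable {U V W X : Type*}
  [AddCommGroup U] [Module ℂ U] [Bornology U] [CompleteBornology U]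
  [AddCommGroup V] [Module ℂ V] [Bornology V] [CompleteBornology V]
  [AddCommGroup W] [Module ℂ W] [Bornology W] [CompleteBornology W]
  [AddCommGroup X] [Module ℂ X] [Bornology X] [CompleteBornology X]

/-- A map is bounded if it maps bounded sets to bounded sets. -/
def IsBoundedMap {α β : Type*} [Bornology α] [Bornology β] (f : α → β) : Prop :=
  ∀ s, IsBounded s → IsBounded (f '' s)

/-- A bornological isomorphism: a bijection, bounded in both directions. -/
def IsBornIso {α β : Type*} [Bornology α] [Bornology β] (f : α → β) : Prop :=
  Function.Bijective f ∧ IsBoundedMap f ∧ ∀ s, IsBounded s → IsBounded (f ⁻¹' s)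

variable (V W) in
/-- The subspace of bounded linear maps. -/
def boundedMaps : Submodule ℂ (V →ₗ[ℂ] W) where
  carrier := {f | IsBoundedMap f}
  add_mem' {f g} hf hg s hs := by
    refine (isBounded_add (hf s hs) (hg s hs)).subset ?_
    rintro _ ⟨x, hx, rfl⟩
    exact Set.add_mem_add ⟨x, hx, rfl⟩ ⟨x, hx, rfl⟩
  zero_mem' s _ := (isBounded_singleton (x := (0 : W))).subset (by rintro _ ⟨x, _, rfl⟩; rfl)
  smul_mem' c f hf s hs := by
    refine (isBounded_csmul c (hf s hs)).subset ?_
    rintro _ ⟨x, hx, rfl⟩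
    exact ⟨f x, ⟨x, hx, rfl⟩, rfl⟩

variable (V W) in
/-- The space `Hom(V, W)` of bounded linear maps. -/
def BHom : Type _ := boundedMaps V W

namespace BHom

instance : AddCommGroup (BHom V W) := inferInstanceAs (AddCommGroup (boundedMaps V W))
instance : Module ℂ (BHom V W) := inferInstanceAs (Module ℂ (boundedMaps V W))

/-- The linear map underlying a bounded linear map. -/
def toLin (f : BHom V W) : V →ₗ[ℂ] W := f.1

instance : FunLike (BHom V W) V W where
  coe f := f.toLin
  coe_injective _ _ h := Subtype.ext (DFunLike.coe_injective h)

instance : LinearMapClass (BHom V W) ℂ V W where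
  map_add f := f.toLin.map_add
  map_smulₛₗ f := f.toLin.map_smul

/-- Build a bounded linear map. -/
def mk (f : V →ₗ[ℂ] W) (hf : IsBoundedMap f) : BHom V W := ⟨f, hf⟩

@[simp] theorem mk_apply (f : V →ₗ[ℂ] W) (hf : IsBoundedMap f) (x : V) : mk f hf x = f x := rfl
@[simp] theorem toLin_apply (f : BHom V W) (x : V) : f.toLin x = f x := rfl
@[simp] theorem add_apply (f g : BHom V W) (x : V) : (f + g) x = f x + g x := rfl
@[simp] theorem sub_apply (f g : BHom V W) (x : V) : (f - g) x = f x - g x := rfl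
@[simp] theorem zero_apply (x : V) : (0 : BHom V W) x = 0 := rfl
@[simp] theorem smul_apply (c : ℂ) (f : BHom V W) (x : V) : (c • f) x = c • f x := rfl
@[simp] theorem rsmul_apply (c : ℝ) (f : BHom V W) (x : V) : (c • f) x = c • f x := rfl

@[ext] theorem ext {f g : BHom V W} (h : ∀ x, f x = g x) : f = g := DFunLike.ext f g h

theorem bounded (f : BHom V W) : IsBoundedMap f := f.2

@[simp] theorem sum_apply {ι : Type*} (s : Finset ι) (f : ι → BHom V W) (x : V) :
    (∑ i ∈ s, f i) x = ∑ i ∈ s, f i x :=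
  map_sum (⟨⟨fun f : BHom V W => f x, rfl⟩, fun _ _ => rfl⟩ : BHom V W →+ W) f s

/-- The equibounded bornology on `Hom(V, W)`: a set `L` of maps is bounded if `L(S)` is bounded
for every bounded set `S`. -/
instance : Bornology (BHom V W) :=
  Bornology.ofBounded
    {L | ∀ s : Set V, IsBounded s → IsBounded (Set.image2 (fun (f : BHom V W) x => f x) L s)}
    (fun s _ => by simp)
    (fun L hL M hM s hs => (hL s hs).subset (Set.image2_subset_right hM))
    (fun L hL M hM s hs => by
      rw [Set.image2_union_left]
      exact (hL s hs).union (hM s hs))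
    (fun f s hs => by
      rw [Set.image2_singleton_left]
      exact f.bounded s hs)

theorem isBounded_iff {L : Set (BHom V W)} : IsBounded L ↔
    ∀ s : Set V, IsBounded s → IsBounded (Set.image2 (fun (f : BHom V W) x => f x) L s) :=
  Bornology.isBounded_ofBounded_iff _

instance : CompleteBornology (BHom V W) where
  smul_bounded c L hL := by
    rw [isBounded_iff] at hL ⊢
    intro s hs
    refine (isBounded_csmul c (hL s hs)).subset ?_
    rintro _ ⟨_, ⟨f, hf, rfl⟩, x, hx, rfl⟩
    exact ⟨f x, ⟨f, hf, x, hx, rfl⟩, rfl⟩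
  exists_completant L hL := by
    rw [isBounded_iff] at hL
    choose E hE1 hE2 hE3 hE4 using fun s : {s : Set V // IsBounded s} => exists_disk (hL s.1 s.2)
    let D : Set (BHom V W) := {f | ∀ s : {s : Set V // IsBounded s}, ∀ x ∈ s.1, f x ∈ E s}
    have hmem : ∀ {r : ℝ}, 0 < r → ∀ f : BHom V W,
        (∀ s : {s : Set V // IsBounded s}, ∀ x ∈ s.1, f x ∈ r • E s) → f ∈ r • D := by
      intro r hr f hf
      refine ⟨r⁻¹ • f, fun s x hx => ?_, ?_⟩
      · have := hf s x hx
        rwa [Set.mem_smul_set_iff_inv_smul_mem₀ hr.ne'] at this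
      · simp [smul_smul, hr.ne']
    have hmem' : ∀ {r : ℝ} {f : BHom V W}, f ∈ r • D →
        ∀ s : {s : Set V // IsBounded s}, ∀ x ∈ s.1, f x ∈ r • E s := by
      rintro r _ ⟨f, hf, rfl⟩ s x hx
      exact ⟨f x, hf s x hx, rfl⟩
    have hdisk : IsDisk D := by
      constructor
      · rw [balanced_iff_smul_mem]
        intro a ha f hf s x hx
        exact (hE4 s).disk.1.smul_mem ha (hf s x hx)
      · intro f hf g hg a b ha hb hab s x hx
        exact (hE4 s).disk.2 (hf s x hx) (hg s x hx) ha hb hab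
    refine ⟨D, fun f hf s x hx => hE1 s ⟨f, hf, x, hx, rfl⟩, ?_, ?_⟩
    · rw [isBounded_iff]
      intro s hs
      refine (hE3 ⟨s, hs⟩).subset ?_
      rintro _ ⟨f, hf, x, hx, rfl⟩
      exact hf ⟨s, hs⟩ x hx
    · have hpt : ∀ x : V, IsBounded ({x} : Set V) := fun x => isBounded_singleton
      refine IsCompletant.of_hasDyadicSums hdisk
        ⟨0, fun s x _ => (hE4 s).disk.zero_mem (hE2 s)⟩ ?_ ?_
      · intro f hf
        ext x
        exact (hE4 ⟨{x}, hpt x⟩).eq_zero fun ε hε => hmem' (hf ε hε) _ x rfl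
      · intro d hd
        have hsum : ∀ (s : {s : Set V // IsBounded s}) (x : V), x ∈ s.1 → ∃ y, ∀ N : ℕ,
            y - ∑ n ∈ Finset.range N, ((1 / 2 : ℝ) ^ n) • d n x
              ∈ (4 * (1 / 2 : ℝ) ^ N) • E s :=
          fun s x hx => (hE4 s).hasDyadicSums (fun n => d n x) (fun n => hd n s x hx)
        have hlim0 : ∀ ε : ℝ, 0 < ε → ∃ N : ℕ, 4 * (1 / 2 : ℝ) ^ N < ε := fun ε hε => by
          obtain ⟨N, hN⟩ := exists_pow_lt_of_lt_one (show 0 < ε / 4 by positivity)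
            (show (1 / 2 : ℝ) < 1 by norm_num)
          exact ⟨N, by linarith⟩
        -- sums in different disks agree
        have huniq : ∀ (s t : {s : Set V // IsBounded s}) (u : ℕ → W) (y z : W),
            (∀ N : ℕ, y - u N ∈ (4 * (1 / 2 : ℝ) ^ N) • E s) →
            (∀ N : ℕ, z - u N ∈ (4 * (1 / 2 : ℝ) ^ N) • E t) → y = z := by
          intro s t u y z hy hz
          obtain ⟨F, hF1, hF2, hF3, hF4⟩ := exists_disk ((hE3 s).union (hE3 t))
          refine sub_eq_zero.1 (hF4.eq_zero fun ε hε => ?_)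
          obtain ⟨N, hN⟩ := hlim0 (ε / 2) (by positivity)
          have h1 : y - u N ∈ (4 * (1 / 2 : ℝ) ^ N) • F :=
            Set.smul_set_mono (fun z hz => hF1 (Or.inl hz)) (hy N)
          have h2 : z - u N ∈ (4 * (1 / 2 : ℝ) ^ N) • F :=
            Set.smul_set_mono (fun z hz => hF1 (Or.inr hz)) (hz N)
          have h3 := hF4.disk.sub_mem (by positivity) (by positivity) h1 h2
          rw [sub_sub_sub_cancel_right] at h3
          exact hF4.disk.smul_subset (by positivity) (by linarith) h3
        choose! g hg using fun x : V => hsum ⟨{x}, hpt x⟩ x rfl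
        have hg' : ∀ (s : {s : Set V // IsBounded s}) (x : V), x ∈ s.1 → ∀ N : ℕ,
            g x - ∑ n ∈ Finset.range N, ((1 / 2 : ℝ) ^ n) • d n x
              ∈ (4 * (1 / 2 : ℝ) ^ N) • E s := by
          intro s x hx
          obtain ⟨y, hy⟩ := hsum s x hx
          rwa [huniq _ _ _ _ _ (hg x) hy]
        have hadd : ∀ x y, g (x + y) = g x + g y := by
          intro x y
          let s : {s : Set V // IsBounded s} := ⟨{x, y, x + y}, by simp⟩
          refine sub_eq_zero.1 ((hE4 s).eq_zero fun ε hε => ?_)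
          obtain ⟨N, hN⟩ := hlim0 (ε / 3) (by positivity)
          have h1 := hg' s x (by simp [s]) N
          have h2 := hg' s y (by simp [s]) N
          have h3 := hg' s (x + y) (by simp [s]) N
          have h4 := (hE4 s).disk.sub_mem (by positivity) (by positivity) h3
            ((hE4 s).disk.add_mem (by positivity) (by positivity) h1 h2)
          refine (hE4 s).disk.smul_subset (by positivity) (by linarith) ?_
            (r := 4 * (1 / 2 : ℝ) ^ N + (4 * (1 / 2 : ℝ) ^ N + 4 * (1 / 2 : ℝ) ^ N))
          convert h4 using 1
          simp only [map_add, smul_add, Finset.sum_add_distrib]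
          abel
        have hsmul : ∀ (c : ℂ) x, g (c • x) = c • g x := by
          intro c x
          let s : {s : Set V // IsBounded s} := ⟨{x, c • x}, by simp⟩
          refine sub_eq_zero.1 ((hE4 s).eq_zero fun ε hε => ?_)
          obtain ⟨N, hN⟩ := hlim0 (ε / (1 + ‖c‖)) (by positivity)
          have h1 := hg' s x (by simp [s]) N
          have h2 := hg' s (c • x) (by simp [s]) N
          have h4 := (hE4 s).disk.sub_mem (by positivity) (by positivity) h2
            ((hE4 s).disk.csmul_mem c h1)
          rw [lt_div_iff₀ (by positivity)] at hN
          refine (hE4 s).disk.smul_subset (by positivity) (by linarith) ?_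
            (r := 4 * (1 / 2 : ℝ) ^ N + ‖c‖ * (4 * (1 / 2 : ℝ) ^ N))
          convert h4 using 1
          simp only [map_smul, smul_sub, Finset.smul_sum]
          simp only [smul_comm c]
          abel
        let G : V →ₗ[ℂ] W := ⟨⟨g, hadd⟩, hsmul⟩
        have hG : IsBoundedMap G := by
          intro s hs
          refine (isBounded_rsmul 4 (hE3 ⟨s, hs⟩)).subset ?_
          rintro _ ⟨x, hx, rfl⟩
          change g x ∈ _
          simpa using hg' ⟨s, hs⟩ x hx 0
        refine ⟨mk G hG, fun N => hmem (by positivity) _ fun s x hx => ?_⟩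
        simpa only [sub_apply, sum_apply, rsmul_apply] using! hg' s x hx N

/-- Composition of bounded linear maps. -/
def comp (g : BHom W X) (f : BHom V W) : BHom V X :=
  mk (g.toLin ∘ₗ f.toLin) (fun s hs => by
    have := g.bounded _ (f.bounded s hs)
    rwa [Set.image_image] at this)

@[simp] theorem comp_apply (g : BHom W X) (f : BHom V W) (x : V) : g.comp f x = g (f x) := rfl

variable (V) in
/-- The identity map. -/
def id : BHom V V := mk LinearMap.id (fun s hs => by simpa using hs)

@[simp] theorem id_apply (x : V) : BHom.id V x = x := rfl

/-- Bounded bilinear maps `V × W → X`, viewed as elements of `Hom(V, Hom(W, X))`. -/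
def mk₂ (f : V → W → X) (h1 : ∀ v v' w, f (v + v') w = f v w + f v' w)
    (h2 : ∀ (c : ℂ) v w, f (c • v) w = c • f v w)
    (h3 : ∀ v w w', f v (w + w') = f v w + f v w')
    (h4 : ∀ (c : ℂ) v w, f v (c • w) = c • f v w)
    (hb : ∀ s t, IsBounded s → IsBounded t → IsBounded (Set.image2 f s t)) :
    BHom V (BHom W X) :=
  mk
    { toFun := fun v => mk ⟨⟨f v, h3 v⟩, fun c w => h4 c v w⟩ (fun t ht => by
        have := hb {v} t isBounded_singleton ht
        rwa [Set.image2_singleton_left] at this)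
      map_add' := fun v v' => ext fun w => h1 v v' w
      map_smul' := fun c v => ext fun w => h2 c v w }
    (fun s hs => isBounded_iff.2 fun t ht => by
      refine (hb s t hs ht).subset ?_
      rintro _ ⟨_, ⟨v, hv, rfl⟩, w, hw, rfl⟩
      exact ⟨v, hv, w, hw, rfl⟩)

@[simp] theorem mk₂_apply (f : V → W → X) (h1 h2 h3 h4 hb) (v : V) (w : W) :
    mk₂ f h1 h2 h3 h4 hb v w = f v w := rfl

theorem bounded₂ (b : BHom V (BHom W X)) {s : Set V} {t : Set W} (hs : IsBounded s)
    (ht : IsBounded t) : IsBounded (Set.image2 (fun v w => b v w) s t) := by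
  have := isBounded_iff.1 (b.bounded s hs) t ht
  rwa [Set.image2_image_left] at this

end BHom

end BHom

/-! ## Quotients -/

section Quotient

variable {V W X : Type*}
  [AddCommGroup V] [Module ℂ V] [Bornology V] [CompleteBornology V]
  [AddCommGroup X] [Module ℂ X] [Bornology X] [CompleteBornology X]

/-- The complete quotient of a bornological vector space by (the closure of) a subspace. -/
def BQuot (R : Submodule ℂ V) : Type _ := V ⧸ bornClosure R

namespace BQuot

variable (R : Submodule ℂ V)

instance : AddCommGroup (BQuot R) := inferInstanceAs (AddCommGroup (V ⧸ bornClosure R))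
instance : Module ℂ (BQuot R) := inferInstanceAs (Module ℂ (V ⧸ bornClosure R))

/-- The quotient map. -/
def mkLin : V →ₗ[ℂ] BQuot R := (bornClosure R).mkQ

theorem mkLin_surjective : Function.Surjective (mkLin R) := Submodule.mkQ_surjective _

theorem mkLin_eq_zero {x : V} : mkLin R x = 0 ↔ x ∈ bornClosure R :=
  Submodule.Quotient.mk_eq_zero _

/-- The quotient bornology: the bounded sets are those contained in images of bounded sets. -/
instance : Bornology (BQuot R) :=
  Bornology.ofBounded {s | ∃ t : Set V, IsBounded t ∧ s ⊆ mkLin R '' t}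
    ⟨∅, isBounded_empty, by simp⟩
    (fun _ ⟨t, ht, h⟩ _ h' => ⟨t, ht, h'.trans h⟩)
    (fun _ ⟨t, ht, h⟩ _ ⟨t', ht', h'⟩ => ⟨t ∪ t', ht.union ht', by
      rw [Set.image_union]; exact Set.union_subset_union h h'⟩)
    (fun x => by
      obtain ⟨y, rfl⟩ := mkLin_surjective R x
      exact ⟨{y}, isBounded_singleton, by simp⟩)

theorem isBounded_iff {s : Set (BQuot R)} :
    IsBounded s ↔ ∃ t : Set V, IsBounded t ∧ s ⊆ mkLin R '' t :=
  Bornology.isBounded_ofBounded_iff _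

theorem mkLin_rsmul (r : ℝ) (x : V) : mkLin R (r • x) = r • mkLin R x := by
  simp [← Complex.coe_smul]

instance : CompleteBornology (BQuot R) where
  smul_bounded c s hs := by
    obtain ⟨t, ht, h⟩ := (isBounded_iff R).1 hs
    refine (isBounded_iff R).2 ⟨c • t, isBounded_csmul c ht, ?_⟩
    rintro _ ⟨x, hx, rfl⟩
    obtain ⟨y, hy, rfl⟩ := h hx
    exact ⟨c • y, ⟨y, hy, rfl⟩, (mkLin R).map_smul c y⟩
  exists_completant s hs := by
    obtain ⟨t, ht, h⟩ := (isBounded_iff R).1 hs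
    obtain ⟨D, hD1, hD2, hD3, hD4⟩ := exists_disk ht
    refine ⟨mkLin R '' D, h.trans (Set.image_mono hD1), (isBounded_iff R).2 ⟨D, hD3, le_rfl⟩, ?_⟩
    have hsm : ∀ r : ℝ, ∀ x, x ∈ r • (mkLin R '' D) ↔ ∃ y ∈ r • D, mkLin R y = x := by
      intro r x
      constructor
      · rintro ⟨_, ⟨y, hy, rfl⟩, rfl⟩
        exact ⟨r • y, ⟨y, hy, rfl⟩, mkLin_rsmul R r y⟩
      · rintro ⟨_, ⟨y, hy, rfl⟩, rfl⟩
        exact ⟨mkLin R y, ⟨y, hy, rfl⟩, (mkLin_rsmul R r y).symm⟩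
    refine IsCompletant.of_hasDyadicSums ⟨?_, ?_⟩ (hD2.image _) ?_ ?_
    · rw [balanced_iff_smul_mem]
      rintro a ha _ ⟨y, hy, rfl⟩
      exact ⟨a • y, hD4.disk.1.smul_mem ha hy, (mkLin R).map_smul a y⟩
    · rintro _ ⟨y, hy, rfl⟩ _ ⟨z, hz, rfl⟩ a b ha hb hab
      exact ⟨a • y + b • z, hD4.disk.2 hy hz ha hb hab, by
        rw [map_add, mkLin_rsmul, mkLin_rsmul]⟩
    · intro x hx
      obtain ⟨y, rfl⟩ := mkLin_surjective R x
      rw [mkLin_eq_zero]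
      refine (isBornClosed_bornClosure R).mem_of_approx hD3 fun ε hε => ?_
      obtain ⟨z, hz, hzy⟩ := (hsm ε _).1 (hx ε hε)
      refine ⟨y - z, (mkLin_eq_zero R).1 (by rw [map_sub, hzy, sub_self]), by simpa using hz⟩
    · intro d hd
      choose e heD hed using hd
      obtain ⟨x, hx⟩ := hD4.hasDyadicSums e heD
      refine ⟨mkLin R x, fun N => (hsm _ _).2 ⟨_, hx N, ?_⟩⟩
      simp only [map_sub, map_sum, mkLin_rsmul, hed]

/-- The quotient map, as a bounded linear map. -/
def mk : BHom V (BQuot R) :=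
  BHom.mk (mkLin R) fun s hs => (isBounded_iff R).2 ⟨s, hs, le_rfl⟩

theorem mk_surjective : Function.Surjective (mk R) := mkLin_surjective R

theorem mk_eq_zero {x : V} : mk R x = 0 ↔ x ∈ bornClosure R := mkLin_eq_zero R

theorem isBounded_iff' {s : Set (BQuot R)} :
    IsBounded s ↔ ∃ t : Set V, IsBounded t ∧ s ⊆ mk R '' t := isBounded_iff R

end BQuot

theorem isBornClosed_ker (f : BHom V X) : IsBornClosed (LinearMap.ker f.toLin) := by
  intro D u x hD hb hu hx
  rw [LinearMap.mem_ker]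
  rcases D.eq_empty_or_nonempty with rfl | hn
  · have h2 := hx.2.1
    simp only [Submodule.span_empty, Submodule.mem_bot] at h2
    rw [h2, map_zero]
  obtain ⟨E, hE1, hE2, hE3, hE4⟩ := exists_disk (f.bounded D hb)
  refine hE4.eq_zero fun ε hε => ?_
  obtain ⟨n, hn'⟩ := (hx.2.2.eventually_lt_const hε).exists
  obtain ⟨d, hd, hdx⟩ := hD.mem_smul_of_gauge_lt hn (Submodule.sub_mem _ (hx.1 n) hx.2.1) hn'
  have h3 : f.toLin (u n - x) ∈ ε • E := by
    rw [← hdx]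
    refine ⟨f d, hE1 ⟨d, hd, rfl⟩, ?_⟩
    simp [← Complex.coe_smul]
  have h4 := hE4.disk.neg_mem h3
  rw [map_sub, LinearMap.mem_ker.1 (hu n)] at h4
  simpa using h4

end Quotient

/-! ## The completed tensor product

`V ⊗̂ W` is the quotient of the space of absolutely summable formal combinations
`∑ c (v, w) · (v, w)` supported in a product of bounded sets by the closure of the bilinear
relations. -/

section Tensor

variable {V W X : Type*}
  [AddCommGroup V] [Module ℂ V] [Bornology V] [CompleteBornology V]
  [AddCommGroup W] [Module ℂ W] [Bornology W] [CompleteBornology W]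
  [AddCommGroup X] [Module ℂ X] [Bornology X] [CompleteBornology X]

/-- `c` is supported in `S × T`. -/
def SuppIn (S : Set V) (T : Set W) (c : V × W → ℂ) : Prop :=
  ∀ p, c p ≠ 0 → p.1 ∈ S ∧ p.2 ∈ T

variable (V W) in
/-- The absolutely summable functions on `V × W` supported in a product of bounded sets. -/
def ell1Submodule : Submodule ℂ (lp (fun _ : V × W => ℂ) 1) where
  carrier := {c | ∃ S T, IsBounded S ∧ IsBounded T ∧ SuppIn S T c}
  add_mem' := by
    rintro a b ⟨S, T, hS, hT, h⟩ ⟨S', T', hS', hT', h'⟩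
    refine ⟨S ∪ S', T ∪ T', hS.union hS', hT.union hT', fun p hp => ?_⟩
    by_cases ha : a p = 0
    · have hb : b p ≠ 0 := fun hb => hp (by simp [ha, hb])
      exact ⟨Or.inr (h' p hb).1, Or.inr (h' p hb).2⟩
    · exact ⟨Or.inl (h p ha).1, Or.inl (h p ha).2⟩
  zero_mem' := ⟨∅, ∅, isBounded_empty, isBounded_empty, fun p hp => (hp rfl).elim⟩
  smul_mem' := by
    rintro z a ⟨S, T, hS, hT, h⟩
    exact ⟨S, T, hS, hT, fun p hp => h p fun h0 => hp (by simp [h0])⟩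

variable (V W) in
/-- The free complete bornological vector space on the bounded products in `V × W`. -/
def Ell1 : Type _ := ell1Submodule V W

namespace Ell1

instance : AddCommGroup (Ell1 V W) := inferInstanceAs (AddCommGroup (ell1Submodule V W))
instance : Module ℂ (Ell1 V W) := inferInstanceAs (Module ℂ (ell1Submodule V W))

/-- The underlying summable family. -/
def val (c : Ell1 V W) : lp (fun _ : V × W => ℂ) 1 := c.1

theorem val_injective : Function.Injective (val (V := V) (W := W)) := Subtype.val_injective

@[simp] theorem val_add (a b : Ell1 V W) : (a + b).val = a.val + b.val := rfl
@[simp] theorem val_sub (a b : Ell1 V W) : (a - b).val = a.val - b.val := rfl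
@[simp] theorem val_smul (z : ℂ) (a : Ell1 V W) : (z • a).val = z • a.val := rfl
@[simp] theorem val_rsmul (z : ℝ) (a : Ell1 V W) : (z • a).val = z • a.val := rfl
@[simp] theorem val_zero : (0 : Ell1 V W).val = 0 := rfl
@[simp] theorem val_sum {ι : Type*} (s : Finset ι) (f : ι → Ell1 V W) :
    (∑ i ∈ s, f i).val = ∑ i ∈ s, (f i).val :=
  map_sum (⟨⟨val, rfl⟩, fun _ _ => rfl⟩ : Ell1 V W →+ lp (fun _ : V × W => ℂ) 1) f s

/-- The ball of summable families of norm at most `r` supported in `S × T`. -/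
def ball (S : Set V) (T : Set W) (r : ℝ) : Set (Ell1 V W) :=
  {c | SuppIn S T c.val ∧ ‖c.val‖ ≤ r}

/-- A set is bounded if its elements are supported in a common product of bounded sets and have
bounded `ℓ¹`-norm. -/
instance : Bornology (Ell1 V W) :=
  Bornology.ofBounded {B | ∃ S T r, IsBounded S ∧ IsBounded T ∧ B ⊆ ball S T r}
    ⟨∅, ∅, 0, isBounded_empty, isBounded_empty, by simp⟩
    (fun _ ⟨S, T, r, hS, hT, h⟩ _ h' => ⟨S, T, r, hS, hT, h'.trans h⟩)
    (fun _ ⟨S, T, r, hS, hT, h⟩ _ ⟨S', T', r', hS', hT', h'⟩ =>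
      ⟨S ∪ S', T ∪ T', max r r', hS.union hS', hT.union hT', by
        rintro c (hc | hc)
        · exact ⟨fun p hp => ⟨Or.inl ((h hc).1 p hp).1, Or.inl ((h hc).1 p hp).2⟩,
            (h hc).2.trans (le_max_left _ _)⟩
        · exact ⟨fun p hp => ⟨Or.inr ((h' hc).1 p hp).1, Or.inr ((h' hc).1 p hp).2⟩,
            (h' hc).2.trans (le_max_right _ _)⟩⟩)
    (fun c => by
      obtain ⟨S, T, hS, hT, h⟩ := c.2
      exact ⟨S, T, ‖c.val‖, hS, hT, by rintro _ rfl; exact ⟨h, le_rfl⟩⟩)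

theorem isBounded_iff {B : Set (Ell1 V W)} :
    IsBounded B ↔ ∃ S T r, IsBounded S ∧ IsBounded T ∧ B ⊆ ball S T r :=
  Bornology.isBounded_ofBounded_iff _

theorem mem_smul_ball {S : Set V} {T : Set W} {r : ℝ} (hr : 0 < r) {c : Ell1 V W} :
    c ∈ r • ball S T 1 ↔ c ∈ ball S T r := by
  rw [Set.mem_smul_set_iff_inv_smul_mem₀ hr.ne']
  have h1 : SuppIn S T ((r⁻¹ • c).val : V × W → ℂ) ↔ SuppIn S T (c.val : V × W → ℂ) := by
    simp [SuppIn, hr.ne']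
  have h2 : ‖(r⁻¹ • c).val‖ ≤ 1 ↔ ‖c.val‖ ≤ r := by
    rw [val_rsmul, norm_smul, norm_inv, Real.norm_eq_abs, abs_of_pos hr, inv_mul_le_iff₀ hr,
      mul_one]
  exact and_congr h1 h2

instance : CompleteBornology (Ell1 V W) where
  smul_bounded z B hB := by
    obtain ⟨S, T, r, hS, hT, h⟩ := isBounded_iff.1 hB
    refine isBounded_iff.2 ⟨S, T, ‖z‖ * r, hS, hT, ?_⟩
    rintro _ ⟨c, hc, rfl⟩
    refine ⟨fun p hp => (h hc).1 p fun h0 => hp (by simp [h0]), ?_⟩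
    simp only [val_smul, norm_smul]
    exact mul_le_mul_of_nonneg_left (h hc).2 (norm_nonneg z)
  exists_completant B hB := by
    obtain ⟨S, T, r, hS, hT, h⟩ := isBounded_iff.1 hB
    set R : ℝ := max r 1 with hR
    have hR0 : 0 < R := lt_max_of_lt_right one_pos
    have hdisk : IsDisk (ball S T R) := by
      constructor
      · rw [balanced_iff_smul_mem]
        intro a ha c hc
        refine ⟨fun p hp => hc.1 p fun h0 => hp (by simp [h0]), ?_⟩
        simp only [val_smul, norm_smul]
        exact (mul_le_of_le_one_left (norm_nonneg _) ha).trans hc.2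
      · intro c hc d hd a b ha hb hab
        refine ⟨fun p hp => ?_, ?_⟩
        · by_cases h0 : c.val p = 0
          · exact hd.1 p fun h1 => hp (by
              change a • c.val p + b • d.val p = 0
              simp [h0, h1])
          · exact hc.1 p h0
        · simp only [val_add, val_rsmul]
          refine (norm_add_le _ _).trans ?_
          rw [norm_smul, norm_smul, Real.norm_eq_abs, Real.norm_eq_abs, abs_of_nonneg ha,
            abs_of_nonneg hb]
          calc a * ‖c.val‖ + b * ‖d.val‖ ≤ a * R + b * R :=
                add_le_add (mul_le_mul_of_nonneg_left hc.2 ha) (mul_le_mul_of_nonneg_left hd.2 hb)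
            _ = R := by rw [← add_mul, hab, one_mul]
    have hball : ∀ {s : ℝ}, 0 < s → ∀ {c : Ell1 V W},
        c ∈ s • ball S T R ↔ c ∈ ball S T (s * R) := by
      intro s hs c
      rw [← mem_smul_ball (mul_pos hs hR0), mul_smul]
      have : R • ball S T 1 = ball S T R := Set.ext fun x => mem_smul_ball hR0
      rw [this]
    refine ⟨ball S T R, fun c hc => ⟨(h hc).1, (h hc).2.trans (le_max_left _ _)⟩,
      isBounded_iff.2 ⟨S, T, R, hS, hT, le_rfl⟩, ?_⟩
    refine IsCompletant.of_hasDyadicSums hdisk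
      ⟨0, fun p hp => (hp (by simp)).elim, by simpa using hR0.le⟩ ?_ ?_
    · intro c hc
      apply val_injective
      rw [val_zero, ← norm_le_zero_iff]
      refine le_of_forall_pos_le_add fun ε hε => ?_
      have := ((hball (div_pos hε hR0)).1 (hc _ (div_pos hε hR0))).2
      rwa [div_mul_cancel₀ _ hR0.ne', ← zero_add ε] at this
    · intro d hd
      have hle : ∀ n, ‖((1 / 2 : ℝ) ^ n) • (d n).val‖ ≤ R * (1 / 2 : ℝ) ^ n := fun n => by
        rw [norm_smul, Real.norm_eq_abs, abs_of_nonneg (by positivity), mul_comm]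
        exact mul_le_mul_of_nonneg_right (hd n).2 (by positivity)
      have hgeo : Summable fun n : ℕ => R * (1 / 2 : ℝ) ^ n :=
        (summable_geometric_of_lt_one (by norm_num) (by norm_num)).mul_left R
      have hs : Summable fun n => ((1 / 2 : ℝ) ^ n) • (d n).val :=
        Summable.of_norm_bounded hgeo hle
      set y := ∑' n, ((1 / 2 : ℝ) ^ n) • (d n).val with hy
      have hpt : ∀ p, HasSum (fun n => (((1 / 2 : ℝ) ^ n) • (d n).val) p) (y p) := fun p => by
        have hc : Continuous fun f : lp (fun _ : V × W => ℂ) 1 => f p :=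
          (continuous_apply p).comp lp.uniformContinuous_coe.continuous
        exact hs.hasSum.map
          (⟨⟨fun f => f p, rfl⟩, fun _ _ => rfl⟩ : lp (fun _ : V × W => ℂ) 1 →+ ℂ) hc
      have hysupp : SuppIn S T y := by
        intro p hp
        by_contra hcon
        refine hp ?_
        have : ∀ n, (((1 / 2 : ℝ) ^ n) • (d n).val) p = 0 := fun n => by
          have h0 : (d n).val p = 0 := by
            by_contra h0
            exact hcon ((hd n).1 p h0)
          rw [lp.coeFn_smul, Pi.smul_apply, h0, smul_zero]
        have h2 := hpt p
        simp only [this] at h2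
        exact h2.unique hasSum_zero
      obtain ⟨Y, hY⟩ : ∃ Y : Ell1 V W, Y.val = y := ⟨⟨y, S, T, hS, hT, hysupp⟩, rfl⟩
      refine ⟨Y, fun N => (hball (by positivity)).2 ⟨?_, ?_⟩⟩
      · intro p hp
        by_contra hcon
        refine hp ?_
        have hy0 : y p = 0 := by
          by_contra h0
          exact hcon (hysupp p h0)
        have hd0 : ∀ n, (d n).val p = 0 := fun n => by
          by_contra h0
          exact hcon ((hd n).1 p h0)
        rw [val_sub, hY, val_sum]
        change y p - (∑ n ∈ Finset.range N, (((1 / 2 : ℝ) ^ n) • d n).val :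
          lp (fun _ : V × W => ℂ) 1) p = 0
        rw [hy0, lp.coeFn_sum, Finset.sum_apply, Finset.sum_eq_zero, sub_zero]
        intro n _
        rw [val_rsmul]
        change ((1 / 2 : ℝ) ^ n) • (d n).val p = 0
        rw [hd0, smul_zero]
      · rw [val_sub, val_sum, hY]
        simp only [val_rsmul]
        have h1 := hs.sum_add_tsum_nat_add N
        rw [← hy] at h1
        rw [← h1, add_sub_cancel_left]
        refine (tsum_of_norm_bounded (g := fun n => R * (1 / 2 : ℝ) ^ (n + N))
          (a := 2 * (1 / 2 : ℝ) ^ N * R) ?_ fun n => hle (n + N)).trans ?_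
        · have := (hasSum_geometric_of_lt_one (r := (1 / 2 : ℝ)) (by norm_num)
            (by norm_num)).mul_left (R * (1 / 2 : ℝ) ^ N)
          have e : (fun n : ℕ => R * (1 / 2 : ℝ) ^ (n + N))
              = fun n => R * (1 / 2 : ℝ) ^ N * (1 / 2 : ℝ) ^ n := by
            funext n; rw [pow_add]; ring
          rw [e, show 2 * (1 / 2 : ℝ) ^ N * R = R * (1 / 2 : ℝ) ^ N * (1 - 1 / 2)⁻¹ by norm_num; ring]
          exact this
        · have : 0 ≤ (1 / 2 : ℝ) ^ N * R := by positivity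
          linarith

end Ell1

namespace Ell1

/-- The basis element at `(v, w)`. -/
def delta (v : V) (w : W) : Ell1 V W := by
  classical
  exact ⟨lp.single 1 (v, w) (1 : ℂ), {v}, {w}, isBounded_singleton, isBounded_singleton, by
    intro p hp
    by_cases h : p = (v, w)
    · subst h; simp
    · exact (hp (lp.single_apply_ne 1 _ _ h)).elim⟩

theorem val_delta [DecidableEq (V × W)] (v : V) (w : W) :
    (delta v w).val = lp.single 1 (v, w) (1 : ℂ) := by
  unfold delta val
  congr!

/-- Partial sums of the series `∑ c (v, w) • b v w`. -/
def psum (b : BHom V (BHom W X)) (c : Ell1 V W) (F : Finset (V × W)) : X :=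
  ∑ p ∈ F, c.val p • b p.1 p.2

/-- The partial sums converge to `x` with respect to `D`. -/
def SumsTo (D : Set X) (b : BHom V (BHom W X)) (c : Ell1 V W) (x : X) : Prop :=
  ∀ ε : ℝ, 0 < ε → ∃ F₀ : Finset (V × W), ∀ F, F₀ ⊆ F → x - psum b c F ∈ ε • D

theorem psum_mem {D : Set X} (hD : IsDisk D) (hn : D.Nonempty) {b : BHom V (BHom W X)}
    {c : Ell1 V W} {S : Set V} {T : Set W} (hc : SuppIn S T c.val)
    (hb : ∀ v ∈ S, ∀ w ∈ T, b v w ∈ D) (F : Finset (V × W)) :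
    psum b c F ∈ (∑ p ∈ F, ‖c.val p‖) • D := by
  classical
  induction F using Finset.induction_on with
  | empty => exact ⟨0, hD.zero_mem hn, by simp [psum]⟩
  | insert p F hp ih =>
    unfold psum at ih ⊢
    rw [Finset.sum_insert hp, Finset.sum_insert hp]
    refine hD.add_mem (norm_nonneg _) (Finset.sum_nonneg fun _ _ => norm_nonneg _) ?_ ih
    by_cases h0 : c.val p = 0
    · rw [h0]; exact ⟨0, hD.zero_mem hn, by simp⟩
    · have h1 := hb p.1 (hc p h0).1 p.2 (hc p h0).2
      simpa using hD.csmul_mem (r := 1) (c.val p) (by simpa using h1)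

theorem sum_norm_le (c : Ell1 V W) (F : Finset (V × W)) : ∑ p ∈ F, ‖c.val p‖ ≤ ‖c.val‖ := by
  have := lp.sum_rpow_le_norm_rpow (p := 1) (by simp) c.val F
  simpa using this

theorem summable_norm (c : Ell1 V W) : Summable fun p => ‖c.val p‖ := by
  simpa using (lp.memℓp c.val).summable (p := 1) (by simp)

theorem exists_sumsTo {D : Set X} (hD : IsCompletant D) (hn : D.Nonempty)
    {b : BHom V (BHom W X)} {c : Ell1 V W} {S : Set V} {T : Set W} (hc : SuppIn S T c.val)
    (hb : ∀ v ∈ S, ∀ w ∈ T, b v w ∈ D) : ∃ x, SumsTo D b c x := by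
  classical
  have hvan : ∀ n : ℕ, ∃ F₀ : Finset (V × W), ∀ F, Disjoint F F₀ →
      ∑ p ∈ F, ‖c.val p‖ < (1 / 2 : ℝ) ^ n := by
    intro n
    obtain ⟨F₀, h⟩ := summable_iff_vanishing_norm.1 (summable_norm c) ((1 / 2 : ℝ) ^ n)
      (by positivity)
    refine ⟨F₀, fun F hF => ?_⟩
    have := h F hF
    rwa [Real.norm_eq_abs, abs_of_nonneg (Finset.sum_nonneg fun _ _ => norm_nonneg _)] at this
  choose G hG using hvan
  let P : ℕ → Finset (V × W) := fun n => (Finset.range (n + 1)).biUnion G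
  have hGP : ∀ n, G n ⊆ P n := fun n => Finset.subset_biUnion_of_mem G (by simp)
  have hP : ∀ n, P n ⊆ P (n + 1) := fun n =>
    Finset.biUnion_subset_biUnion_of_subset_left _ (Finset.range_mono (by omega))
  have hdiff : ∀ n F, P n ⊆ F → psum b c F - psum b c (P n) ∈ ((1 / 2 : ℝ) ^ n) • D := by
    intro n F hF
    have h1 : psum b c F - psum b c (P n) = psum b c (F \ P n) := by
      unfold psum
      rw [sub_eq_iff_eq_add, Finset.sum_sdiff hF]
    rw [h1]
    exact hD.disk.smul_subset (Finset.sum_nonneg fun _ _ => norm_nonneg _)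
      (hG n _ (Finset.sdiff_disjoint.mono_right (hGP n))).le (psum_mem hD.disk hn hc hb _)
  choose d hdD hde using fun n => hdiff n (P (n + 1)) (hP n)
  obtain ⟨y, hy⟩ := hD.hasDyadicSums d hdD
  refine ⟨y + psum b c (P 0), fun ε hε => ?_⟩
  obtain ⟨n, hn'⟩ := exists_pow_lt_of_lt_one (show 0 < ε / 5 by positivity)
    (show (1 / 2 : ℝ) < 1 by norm_num)
  refine ⟨P n, fun F hF => ?_⟩
  have h1 := hy n
  simp only at hde
  simp_rw [hde] at h1
  rw [Finset.sum_range_sub (fun k => psum b c (P k))] at h1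
  have h2 := hD.disk.sub_mem (by positivity) (by positivity) h1 (hdiff n F hF)
  refine hD.disk.smul_subset (by positivity) (by linarith) ?_
    (r := 4 * (1 / 2 : ℝ) ^ n + (1 / 2 : ℝ) ^ n)
  convert h2 using 1
  abel

theorem SumsTo.mem {D : Set X} (hD : IsDisk D) (hn : D.Nonempty)
    {b : BHom V (BHom W X)} {c : Ell1 V W} {S : Set V} {T : Set W} (hc : SuppIn S T c.val)
    (hb : ∀ v ∈ S, ∀ w ∈ T, b v w ∈ D) {x : X} (h : SumsTo D b c x) {r : ℝ} (hr : ‖c.val‖ ≤ r) :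
    x ∈ (r + 1) • D := by
  obtain ⟨F, hF⟩ := h 1 one_pos
  have h1 := hD.add_mem zero_le_one (Finset.sum_nonneg fun _ _ => norm_nonneg _) (hF F le_rfl)
    (psum_mem hD hn hc hb F)
  rw [sub_add_cancel] at h1
  refine hD.smul_subset (add_nonneg zero_le_one (Finset.sum_nonneg fun _ _ => norm_nonneg _)) ?_ h1
  linarith [sum_norm_le c F]

theorem SumsTo.mono {D E : Set X} (hDE : D ⊆ E) {b : BHom V (BHom W X)} {c : Ell1 V W} {x : X}
    (h : SumsTo D b c x) : SumsTo E b c x := fun ε hε => by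
  obtain ⟨F₀, hF⟩ := h ε hε
  exact ⟨F₀, fun F hF' => Set.smul_set_mono hDE (hF F hF')⟩

theorem SumsTo.unique {D E : Set X} (hD : IsBounded D) (hE : IsBounded E)
    {b : BHom V (BHom W X)} {c : Ell1 V W} {x y : X} (hx : SumsTo D b c x)
    (hy : SumsTo E b c y) : x = y := by
  classical
  obtain ⟨K, hK1, hK2, hK3, hK4⟩ := exists_disk (hD.union hE)
  refine sub_eq_zero.1 (hK4.eq_zero fun ε hε => ?_)
  obtain ⟨F, hF⟩ := (hx.mono (Set.subset_union_left.trans hK1)) (ε / 2) (by positivity)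
  obtain ⟨G, hG⟩ := (hy.mono (Set.subset_union_right.trans hK1)) (ε / 2) (by positivity)
  have h1 := hK4.disk.sub_mem (by positivity) (by positivity)
    (hF (F ∪ G) Finset.subset_union_left) (hG (F ∪ G) Finset.subset_union_right)
  rwa [sub_sub_sub_cancel_right, add_halves] at h1

theorem exists_sum (b : BHom V (BHom W X)) (c : Ell1 V W) :
    ∃ x, ∃ D, IsBounded D ∧ IsDisk D ∧ SumsTo D b c x := by
  obtain ⟨S, T, hS, hT, hc⟩ := c.2
  obtain ⟨D, hD1, hD2, hD3, hD4⟩ := exists_disk (b.bounded₂ hS hT)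
  obtain ⟨x, hx⟩ := exists_sumsTo (b := b) hD4 hD2 hc fun v hv w hw => hD1 ⟨v, hv, w, hw, rfl⟩
  exact ⟨x, D, hD3, hD4.disk, hx⟩

/-- The sum `∑ c (v, w) • b v w`. -/
def bsum (b : BHom V (BHom W X)) (c : Ell1 V W) : X := (exists_sum b c).choose

theorem bsum_spec (b : BHom V (BHom W X)) (c : Ell1 V W) :
    ∃ D, IsBounded D ∧ IsDisk D ∧ SumsTo D b c (bsum b c) := (exists_sum b c).choose_spec

theorem bsum_eq {b : BHom V (BHom W X)} {c : Ell1 V W} {D : Set X} (hD : IsBounded D) {x : X}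
    (h : SumsTo D b c x) : bsum b c = x := by
  obtain ⟨E, hE, _, h'⟩ := bsum_spec b c
  exact h'.unique hE hD h

theorem bsum_mem {D : Set X} (hD : IsCompletant D) (hbd : IsBounded D) (hn : D.Nonempty)
    {b : BHom V (BHom W X)} {c : Ell1 V W} {S : Set V} {T : Set W} {r : ℝ}
    (hc : c ∈ ball S T r) (hb : ∀ v ∈ S, ∀ w ∈ T, b v w ∈ D) : bsum b c ∈ (r + 1) • D := by
  obtain ⟨x, hx⟩ := exists_sumsTo hD hn hc.1 hb
  rw [bsum_eq hbd hx]
  exact hx.mem hD.disk hn hc.1 hb hc.2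

/-- Extension of a bounded bilinear map to `Ell1 V W`. -/
def extend (b : BHom V (BHom W X)) : BHom (Ell1 V W) X :=
  BHom.mk
    { toFun := bsum b
      map_add' := by
        classical
        intro c c'
        obtain ⟨D, hD, _, h⟩ := bsum_spec b c
        obtain ⟨D', hD', _, h'⟩ := bsum_spec b c'
        obtain ⟨K, hK1, hK2, hK3, hK4⟩ := exists_disk (hD.union hD')
        refine bsum_eq hK3 fun ε hε => ?_
        obtain ⟨F, hF⟩ := (h.mono (Set.subset_union_left.trans hK1)) (ε / 2) (by positivity)
        obtain ⟨G, hG⟩ := (h'.mono (Set.subset_union_right.trans hK1)) (ε / 2) (by positivity)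
        refine ⟨F ∪ G, fun L hL => ?_⟩
        have h1 := hK4.disk.add_mem (by positivity) (by positivity)
          (hF L (Finset.subset_union_left.trans hL)) (hG L (Finset.subset_union_right.trans hL))
        rw [add_halves] at h1
        convert h1 using 1
        have : psum b (c + c') L = psum b c L + psum b c' L := by
          unfold psum
          rw [← Finset.sum_add_distrib]
          exact Finset.sum_congr rfl fun p _ => add_smul (c.val p) (c'.val p) _
        rw [this]
        abel
      map_smul' := by
        intro z c
        obtain ⟨D, hD, hD', h⟩ := bsum_spec b c
        refine bsum_eq hD fun ε hε => ?_
        obtain ⟨F, hF⟩ := h (ε / (1 + ‖z‖)) (by positivity)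
        refine ⟨F, fun L hL => ?_⟩
        have h1 := hD'.csmul_mem z (hF L hL)
        refine hD'.smul_subset (by positivity) ?_ (r := ‖z‖ * (ε / (1 + ‖z‖))) ?_
        · rw [mul_div_assoc', div_le_iff₀ (by positivity)]
          nlinarith [norm_nonneg z]
        · convert h1 using 1
          have : psum b (z • c) L = z • psum b c L := by
            unfold psum
            rw [Finset.smul_sum]
            exact Finset.sum_congr rfl fun p _ => mul_smul z (c.val p) _
          rw [this, smul_sub]
          rfl }
    (by
      intro B hB
      obtain ⟨S, T, r, hS, hT, h⟩ := isBounded_iff.1 hB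
      obtain ⟨D, hD1, hD2, hD3, hD4⟩ := exists_disk (b.bounded₂ hS hT)
      refine (isBounded_rsmul (r + 1) hD3).subset ?_
      rintro _ ⟨c, hc, rfl⟩
      exact bsum_mem hD4 hD3 hD2 (h hc) fun v hv w hw => hD1 ⟨v, hv, w, hw, rfl⟩)

theorem extend_apply (b : BHom V (BHom W X)) (c : Ell1 V W) : extend b c = bsum b c := rfl

theorem extend_delta (b : BHom V (BHom W X)) (v : V) (w : W) : extend b (delta v w) = b v w := by
  classical
  refine bsum_eq (isBounded_singleton (x := (0 : X))) fun ε hε => ⟨{(v, w)}, fun F hF => ?_⟩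
  have : psum b (delta v w) F = b v w := by
    unfold psum
    rw [Finset.sum_eq_single (v, w)]
    · rw [val_delta, lp.single_apply_self, one_smul]
    · intro p _ hp
      rw [val_delta, lp.single_apply_ne 1 _ _ hp, zero_smul]
    · intro h
      exact (h (hF (by simp))).elim
  rw [this]
  exact ⟨0, rfl, by simp⟩

/-- Bounded linear maps on `Ell1 V W` are determined on the basis elements. -/
theorem eq_zero_of_delta {f : BHom (Ell1 V W) X} (h : ∀ v w, f (delta v w) = 0) (c : Ell1 V W) :
    f c = 0 := by
  classical
  obtain ⟨S, T, hS, hT, hc⟩ := c.2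
  have hlim := lp.hasSum_single (p := 1) (by simp) c.val
  suffices c ∈ LinearMap.ker f.toLin from LinearMap.mem_ker.1 this
  obtain ⟨E, hE1, _, hE3, hE4⟩ := exists_disk (isBounded_iff.2 ⟨S, T, 1, hS, hT, le_rfl⟩)
  refine (isBornClosed_ker f).mem_of_approx hE3 fun ε hε => ?_
  obtain ⟨F, hF⟩ := (Metric.tendsto_nhds.1 hlim ε hε).exists
  refine ⟨∑ p ∈ F, c.val p • delta p.1 p.2, ?_, ?_⟩
  · refine Submodule.sum_mem _ fun p _ => Submodule.smul_mem _ _ ?_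
    exact LinearMap.mem_ker.2 (h p.1 p.2)
  · have hval : (∑ p ∈ F, c.val p • delta p.1 p.2).val
        = ∑ p ∈ F, lp.single 1 p (c.val p) := by
      rw [val_sum]
      refine Finset.sum_congr rfl fun p _ => ?_
      rw [val_smul, val_delta, ← lp.single_smul, smul_eq_mul, mul_one]
    refine Set.smul_set_mono hE1 ((mem_smul_ball hε).2 ⟨?_, ?_⟩)
    · intro p hp
      by_contra hcon
      refine hp ?_
      have h0 : c.val p = 0 := by
        by_contra h0
        exact hcon (hc p h0)
      rw [val_sub, hval]
      change c.val p - (∑ p ∈ F, lp.single 1 p (c.val p) : lp (fun _ : V × W => ℂ) 1) p = 0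
      rw [h0, zero_sub, neg_eq_zero, lp.coeFn_sum, Finset.sum_apply]
      refine Finset.sum_eq_zero fun q _ => ?_
      by_cases hq : p = q
      · subst hq; rw [lp.single_apply_self, h0]
      · exact lp.single_apply_ne 1 _ _ hq
    · rw [val_sub, hval, ← dist_eq_norm, dist_comm]
      exact hF.le

variable (V W) in
/-- The bilinear relations. -/
def bilinRel : Submodule ℂ (Ell1 V W) :=
  Submodule.span ℂ
    ({c | ∃ v v' w, c = delta (v + v') w - delta v w - delta v' w} ∪
     {c | ∃ v w w', c = delta v (w + w') - delta v w - delta v w'} ∪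
     {c | ∃ (z : ℂ) (v : V) (w : W), c = delta (z • v) w - z • delta v w} ∪
     {c | ∃ (z : ℂ) (v : V) (w : W), c = delta v (z • w) - z • delta v w})

end Ell1

variable (V W) in
/-- The completed bornological tensor product `V ⊗̂ W`. -/
def CTensor : Type _ := BQuot (Ell1.bilinRel V W)

namespace CTensor

instance : AddCommGroup (CTensor V W) := inferInstanceAs (AddCommGroup (BQuot _))
instance : Module ℂ (CTensor V W) := inferInstanceAs (Module ℂ (BQuot _))
instance : Bornology (CTensor V W) := inferInstanceAs (Bornology (BQuot _))
instance : CompleteBornology (CTensor V W) := inferInstanceAs (CompleteBornology (BQuot _))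

variable (V W) in
/-- The quotient map. -/
def proj : BHom (Ell1 V W) (CTensor V W) := BQuot.mk _

theorem proj_eq_zero_of_rel {c : Ell1 V W} (h : c ∈ Ell1.bilinRel V W) : proj V W c = 0 :=
  (BQuot.mk_eq_zero _).2 (le_bornClosure _ h)

variable (V W) in
/-- The canonical bounded bilinear map `V × W → V ⊗̂ W`. -/
def tmulHom : BHom V (BHom W (CTensor V W)) :=
  BHom.mk₂ (fun v w => proj V W (Ell1.delta v w))
    (fun v v' w => by
      rw [← sub_eq_zero, ← sub_sub, ← map_sub, ← map_sub]
      exact proj_eq_zero_of_rel (Submodule.subset_span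
        (Or.inl (Or.inl (Or.inl ⟨v, v', w, rfl⟩)))))
    (fun z v w => by
      rw [← sub_eq_zero, ← map_smul, ← map_sub]
      exact proj_eq_zero_of_rel (Submodule.subset_span (Or.inl (Or.inr ⟨z, v, w, rfl⟩))))
    (fun v w w' => by
      rw [← sub_eq_zero, ← sub_sub, ← map_sub, ← map_sub]
      exact proj_eq_zero_of_rel (Submodule.subset_span (Or.inl (Or.inl (Or.inr ⟨v, w, w', rfl⟩)))))
    (fun z v w => by
      rw [← sub_eq_zero, ← map_smul, ← map_sub]
      exact proj_eq_zero_of_rel (Submodule.subset_span (Or.inr ⟨z, v, w, rfl⟩)))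
    (fun s t hs ht => by
      classical
      have h : IsBounded (Set.image2 (fun v w => Ell1.delta v w) s t) := by
        refine Ell1.isBounded_iff.2 ⟨s, t, 1, hs, ht, ?_⟩
        rintro _ ⟨v, hv, w, hw, rfl⟩
        refine ⟨fun p hp => ?_, ?_⟩
        · by_cases h : p = (v, w)
          · subst h; exact ⟨hv, hw⟩
          · rw [Ell1.val_delta, lp.single_apply_ne 1 _ _ h] at hp
            exact (hp rfl).elim
        · rw [Ell1.val_delta, lp.norm_single (by simp)]
          simp
      have h2 := (proj V W).bounded _ h
      rwa [Set.image_image2] at h2)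

/-- The elementary tensor `v ⊗ w`. -/
def tmul (v : V) (w : W) : CTensor V W := tmulHom V W v w

@[simp] theorem tmulHom_apply (v : V) (w : W) : tmulHom V W v w = tmul v w := rfl

theorem bilinRel_le_ker (b : BHom V (BHom W X)) :
    bornClosure (Ell1.bilinRel V W) ≤ LinearMap.ker (Ell1.extend b).toLin := by
  refine bornClosure_le (isBornClosed_ker _) (Submodule.span_le.2 ?_)
  rintro c (((⟨v, v', w, rfl⟩ | ⟨v, w, w', rfl⟩) | ⟨z, v, w, rfl⟩) | ⟨z, v, w, rfl⟩) <;>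
  · rw [SetLike.mem_coe, LinearMap.mem_ker]
    simp [Ell1.extend_delta, sub_sub]

/-- The universal property: bounded bilinear maps `V × W → X` correspond to bounded linear maps
`V ⊗̂ W → X`. -/
def lift (b : BHom V (BHom W X)) : BHom (CTensor V W) X :=
  BHom.mk ((bornClosure (Ell1.bilinRel V W)).liftQ (Ell1.extend b).toLin (bilinRel_le_ker b))
    (fun s hs => by
      obtain ⟨t, ht, h⟩ := (BQuot.isBounded_iff _).1 hs
      refine ((Ell1.extend b).bounded t ht).subset ?_
      rintro _ ⟨x, hx, rfl⟩
      obtain ⟨c, hc, rfl⟩ := h hx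
      exact ⟨c, hc, rfl⟩)

theorem lift_proj (b : BHom V (BHom W X)) (c : Ell1 V W) :
    lift b (proj V W c) = Ell1.extend b c := rfl

@[simp] theorem lift_tmul (b : BHom V (BHom W X)) (v : V) (w : W) :
    lift b (tmul v w) = b v w := by
  change lift b (proj V W (Ell1.delta v w)) = b v w
  rw [lift_proj, Ell1.extend_delta]

theorem proj_surjective : Function.Surjective (proj V W) := BQuot.mk_surjective _

theorem hom_ext {f g : BHom (CTensor V W) X} (h : ∀ v w, f (tmul v w) = g (tmul v w)) :
    f = g := by
  ext x
  obtain ⟨c, rfl⟩ := proj_surjective x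
  have := Ell1.eq_zero_of_delta (f := (f - g).comp (proj V W))
    (fun v w => by
      simp only [BHom.comp_apply, BHom.sub_apply]
      exact sub_eq_zero.2 (h v w)) c
  simp only [BHom.comp_apply, BHom.sub_apply] at this
  exact sub_eq_zero.1 this

theorem isBounded_lift {B : Set (BHom V (BHom W X))} (hB : IsBounded B) :
    IsBounded (lift '' B) := by
  refine BHom.isBounded_iff.2 fun s hs => ?_
  obtain ⟨t, ht, h⟩ := (BQuot.isBounded_iff _).1 hs
  obtain ⟨S, T, r, hS, hT, h'⟩ := Ell1.isBounded_iff.1 ht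
  obtain ⟨D, hD1, hD2, hD3, hD4⟩ := exists_disk
    (BHom.isBounded_iff.1 (BHom.isBounded_iff.1 hB S hS) T hT)
  refine (isBounded_rsmul (r + 1) hD3).subset ?_
  rintro _ ⟨_, ⟨b, hb, rfl⟩, x, hx, rfl⟩
  obtain ⟨c, hc, rfl⟩ := h hx
  exact Ell1.bsum_mem hD4 hD3 hD2 (h' hc) fun v hv w hw =>
    hD1 ⟨b v, ⟨b, hb, v, hv, rfl⟩, w, hw, rfl⟩

end CTensor

end Tensor

/-! ## Operations on bounded bilinear maps and tensor products -/

section Operations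

variable {U V W X Y V' W' : Type*}
  [AddCommGroup U] [Module ℂ U] [Bornology U] [CompleteBornology U]
  [AddCommGroup V] [Module ℂ V] [Bornology V] [CompleteBornology V]
  [AddCommGroup W] [Module ℂ W] [Bornology W] [CompleteBornology W]
  [AddCommGroup X] [Module ℂ X] [Bornology X] [CompleteBornology X]
  [AddCommGroup Y] [Module ℂ Y] [Bornology Y] [CompleteBornology Y]
  [AddCommGroup V'] [Module ℂ V'] [Bornology V'] [CompleteBornology V']
  [AddCommGroup W'] [Module ℂ W'] [Bornology W'] [CompleteBornology W']

namespace BHom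

/-- `(v, w) ↦ g (b (v, w))`. -/
def postcomp (g : BHom X Y) (b : BHom V (BHom W X)) : BHom V (BHom W Y) :=
  mk₂ (fun v w => g (b v w)) (by simp) (by simp) (by simp) (by simp)
    (fun s t hs ht => by
      have := g.bounded _ (b.bounded₂ hs ht)
      rwa [Set.image_image2] at this)

@[simp] theorem postcomp_apply (g : BHom X Y) (b : BHom V (BHom W X)) (v : V) (w : W) :
    postcomp g b v w = g (b v w) := rfl

/-- `(v, w) ↦ b (f v, g w)`. -/
def precomp (b : BHom V' (BHom W' X)) (f : BHom V V') (g : BHom W W') : BHom V (BHom W X) :=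
  mk₂ (fun v w => b (f v) (g w)) (by simp) (by simp) (by simp) (by simp)
    (fun s t hs ht => by
      have := b.bounded₂ (f.bounded s hs) (g.bounded t ht)
      rwa [Set.image2_image_left, Set.image2_image_right] at this)

@[simp] theorem precomp_apply (b : BHom V' (BHom W' X)) (f : BHom V V') (g : BHom W W')
    (v : V) (w : W) : precomp b f g v w = b (f v) (g w) := rfl

/-- `(w, v) ↦ b (v, w)`. -/
def flip (b : BHom V (BHom W X)) : BHom W (BHom V X) :=
  mk₂ (fun w v => b v w) (by simp) (by simp) (by simp) (by simp)
    (fun s t hs ht => by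
      have := b.bounded₂ ht hs
      rwa [Set.image2_swap] at this)

@[simp] theorem flip_apply (b : BHom V (BHom W X)) (v : V) (w : W) : flip b w v = b v w := rfl

variable (W X) in
/-- The evaluation pairing `Hom(W, X) × W → X`. -/
def evalHom : BHom (BHom W X) (BHom W X) := BHom.id _

variable (V W X) in
/-- Composition of bounded linear maps as a bounded bilinear map. -/
def compHom : BHom (BHom W X) (BHom (BHom V W) (BHom V X)) :=
  mk₂ (fun g f => g.comp f) (fun _ _ _ => rfl) (fun _ _ _ => rfl)
    (fun g _ _ => ext fun x => by simp) (fun c g _ => ext fun x => by simp)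
    (fun L M hL hM => isBounded_iff.2 fun s hs => by
      refine (isBounded_iff.1 hL _ (isBounded_iff.1 hM s hs)).subset ?_
      rintro _ ⟨_, ⟨g, hg, f, hf, rfl⟩, x, hx, rfl⟩
      exact ⟨g, hg, f x, ⟨f, hf, x, hx, rfl⟩, rfl⟩)

@[simp] theorem compHom_apply (g : BHom W X) (f : BHom V W) : compHom V W X g f = g.comp f := rfl

/-- Evaluation at a point. -/
def eval (w : W) : BHom (BHom W X) X := flip (evalHom W X) w

@[simp] theorem eval_apply (w : W) (f : BHom W X) : eval w f = f w := rfl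

end BHom

namespace CTensor

theorem bilin_ext {f g : BHom (CTensor V W) (BHom (CTensor V' W') X)}
    (h : ∀ v w v' w', f (tmul v w) (tmul v' w') = g (tmul v w) (tmul v' w'))
    (x : CTensor V W) (y : CTensor V' W') : f x y = g x y := by
  have : f = g := hom_ext fun v w => hom_ext fun v' w' => h v w v' w'
  rw [this]

/-- The tensor product `f ⊗̂ g` of two bounded linear maps. -/
def map (f : BHom V V') (g : BHom W W') : BHom (CTensor V W) (CTensor V' W') :=
  lift (BHom.precomp (tmulHom V' W') f g)

@[simp] theorem map_tmul (f : BHom V V') (g : BHom W W') (v : V) (w : W) :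
    map f g (tmul v w) = tmul (f v) (g w) := by simp [map]

variable (V V' W W') in
/-- `(f, g) ↦ f ⊗̂ g` as a bounded bilinear map. -/
def mapHom : BHom (BHom V V') (BHom (BHom W W') (BHom (CTensor V W) (CTensor V' W'))) :=
  BHom.mk₂ map
    (fun f f' g => hom_ext fun v w => by
      simp only [BHom.add_apply, map_tmul]
      simp [← tmulHom_apply])
    (fun c f g => hom_ext fun v w => by
      simp only [BHom.smul_apply, map_tmul]
      simp [← tmulHom_apply])
    (fun f g g' => hom_ext fun v w => by
      simp only [BHom.add_apply, map_tmul]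
      simp [← tmulHom_apply])
    (fun c f g => hom_ext fun v w => by
      simp only [BHom.smul_apply, map_tmul]
      simp [← tmulHom_apply])
    (fun L M hL hM => by
      have : IsBounded (Set.image2 (fun f g => BHom.precomp (tmulHom V' W') f g) L M) := by
        refine BHom.isBounded_iff.2 fun s hs => BHom.isBounded_iff.2 fun t ht => ?_
        refine ((tmulHom V' W').bounded₂ (BHom.isBounded_iff.1 hL s hs)
          (BHom.isBounded_iff.1 hM t ht)).subset ?_
        rintro _ ⟨_, ⟨_, ⟨f, hf, g, hg, rfl⟩, v, hv, rfl⟩, w, hw, rfl⟩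
        exact ⟨f v, ⟨f, hf, v, hv, rfl⟩, g w, ⟨g, hg, w, hw, rfl⟩, rfl⟩
      have h2 := isBounded_lift this
      rwa [Set.image_image2] at h2)

@[simp] theorem mapHom_apply (f : BHom V V') (g : BHom W W') : mapHom V W V' W' f g = map f g :=
  rfl

variable (V W) in
/-- The flip `v ⊗ w ↦ w ⊗ v`. -/
def flip : BHom (CTensor V W) (CTensor W V) := lift (BHom.flip (tmulHom W V))

@[simp] theorem flip_tmul (v : V) (w : W) : flip V W (tmul v w) = tmul w v := by simp [flip]

variable (V W X) in
/-- The associativity isomorphism `(v ⊗ w) ⊗ x ↦ v ⊗ (w ⊗ x)`. -/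
def assoc : BHom (CTensor (CTensor V W) X) (CTensor V (CTensor W X)) :=
  lift (lift (BHom.precomp (BHom.compHom X (CTensor W X) (CTensor V (CTensor W X)))
    (tmulHom V (CTensor W X)) (tmulHom W X)))

@[simp] theorem assoc_tmul (v : V) (w : W) (x : X) :
    assoc V W X (tmul (tmul v w) x) = tmul v (tmul w x) := by
  simp [assoc]

end CTensor

end Operations

/-! ## The complex numbers -/

instance : CompleteBornology ℂ where
  smul_bounded c s hs := hs.smul₀ c
  exists_completant s hs := by
    obtain ⟨r, hr, h⟩ := hs.subset_closedBall_lt 0 0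
    have hg : ∀ x : ℂ, gauge (Metric.closedBall (0 : ℂ) r) x = ‖x‖ / r :=
      gauge_closedBall hr.le
    have hspan : Submodule.span ℂ (Metric.closedBall (0 : ℂ) r) = ⊤ := by
      rw [eq_top_iff]
      intro x _
      have h1 : (r : ℂ) ∈ Submodule.span ℂ (Metric.closedBall (0 : ℂ) r) :=
        Submodule.subset_span (by simp [abs_of_pos hr])
      have h2 := Submodule.smul_mem _ (x / r) h1
      rwa [smul_eq_mul, div_mul_cancel₀ _ (by exact_mod_cast hr.ne')] at h2
    refine ⟨_, h, Metric.isBounded_closedBall,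
      ⟨balanced_closedBall_zero, convex_closedBall _ _⟩, ?_, ?_⟩
    · intro x _ hx
      rw [hg, div_eq_zero_iff] at hx
      simpa [hr.ne'] using hx
    · intro u _ hc
      have hcs : CauchySeq u := by
        rw [Metric.cauchySeq_iff]
        intro ε hε
        obtain ⟨N, hN⟩ := hc (ε / r) (by positivity)
        refine ⟨N, fun m hm n hn => ?_⟩
        have := hN m hm n hn
        rw [hg, div_lt_div_iff_of_pos_right hr] at this
        rwa [dist_eq_norm]
      obtain ⟨x, hx⟩ := cauchySeq_tendsto_of_complete hcs
      refine ⟨x, by rw [hspan]; trivial, ?_⟩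
      simp_rw [hg]
      simpa using (tendsto_iff_norm_sub_tendsto_zero.1 hx).div_const r

section Slices

variable {V W : Type*}
  [AddCommGroup V] [Module ℂ V] [Bornology V] [CompleteBornology V]
  [AddCommGroup W] [Module ℂ W] [Bornology W] [CompleteBornology W]

/-- The scalar multiplication as a bounded bilinear map. -/
def BHom.smulHom (V : Type*) [AddCommGroup V] [Module ℂ V] [Bornology V] [CompleteBornology V] :
    BHom ℂ (BHom V V) :=
  BHom.mk₂ (fun z v => z • v) (fun _ _ _ => add_smul _ _ _) (fun _ _ _ => mul_smul _ _ _)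
    (fun _ _ _ => smul_add _ _ _) (fun c z v => smul_comm z c v)
    (fun s t hs ht => by
      obtain ⟨r, hr⟩ := hs.exists_norm_le
      obtain ⟨D, hD1, _, hD3, hD4⟩ := exists_disk ht
      refine (isBounded_rsmul r hD3).subset ?_
      rintro _ ⟨z, hz, v, hv, rfl⟩
      have := hD4.disk.csmul_mem (r := 1) z (by simpa using hD1 hv)
      rw [mul_one] at this
      exact hD4.disk.smul_subset (norm_nonneg _) (hr z hz) this)

/-- The slice map `id ⊗̂ ω`. -/
def idTensor (V : Type*) [AddCommGroup V] [Module ℂ V] [Bornology V] [CompleteBornology V]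
    (ω : BHom W ℂ) : BHom (CTensor V W) V :=
  CTensor.lift (BHom.flip (BHom.precomp (BHom.smulHom V) ω (BHom.id V)))

@[simp] theorem idTensor_tmul (ω : BHom W ℂ) (v : V) (w : W) :
    idTensor V ω (CTensor.tmul v w) = ω w • v := by
  simp [idTensor]; rfl

/-- The slice map `ω ⊗̂ id`. -/
def tensorId (W : Type*) [AddCommGroup W] [Module ℂ W] [Bornology W] [CompleteBornology W]
    (ω : BHom V ℂ) : BHom (CTensor V W) W :=
  CTensor.lift (BHom.precomp (BHom.smulHom W) ω (BHom.id W))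

@[simp] theorem tensorId_tmul (ω : BHom V ℂ) (v : V) (w : W) :
    tensorId W ω (CTensor.tmul v w) = ω v • w := by
  simp [tensorId]; rfl

end Slices

/-! ## The approximation property -/

section Approximation

variable {V : Type*} [AddCommGroup V] [Module ℂ V] [Bornology V] [CompleteBornology V]

/-- A compact disk: a disk which is a (sequentially) compact subset of the Banach space `⟨T⟩` for
some bounded completant disk `T`. -/
def IsCompactDisk (S : Set V) : Prop :=
  IsDisk S ∧ ∃ T : Set V, IsBounded T ∧ IsCompletant T ∧ S ⊆ Submodule.span ℂ T ∧
    ∀ u : ℕ → V, (∀ n, u n ∈ S) → ∃ x ∈ S, ∃ k : ℕ → ℕ, StrictMono k ∧ ConvergesIn T (u ∘ k) x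

/-- Finite rank operators: the finite sums `x ↦ ∑ ωᵢ(x) wᵢ` with bounded functionals `ωᵢ`. -/
def IsFiniteRank (f : BHom V V) : Prop :=
  ∃ (k : ℕ) (ω : Fin k → BHom V ℂ) (w : Fin k → V), ∀ x, f x = ∑ i, ω i x • w i

variable (V) in
/-- The approximation property: for every compact disk `S` there are finite rank operators
converging to the identity in `Hom(⟨S⟩, V)`, that is, such that the differences map `S` into
`εₙ T` for one bounded disk `T` and a null sequence `εₙ`. -/
def ApproximationProperty : Prop :=
  ∀ S : Set V, IsCompactDisk S → ∃ f : ℕ → BHom V V, (∀ n, IsFiniteRank (f n)) ∧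
    ∃ T : Set V, IsDisk T ∧ IsBounded T ∧ ∃ ε : ℕ → ℝ, Tendsto ε atTop (𝓝 0) ∧
      ∀ n, ∀ x ∈ S, f n x - x ∈ ε n • T

end Approximation

/-! ## Bornological algebras and multipliers -/

/-- The multiplication of a bornological algebra is bounded. -/
class BornologicalAlgebra (A : Type*) [NonUnitalRing A] [Bornology A] : Prop where
  mul_bounded : ∀ s t : Set A, IsBounded s → IsBounded t → IsBounded (s * t)

instance : BornologicalAlgebra ℂ where
  mul_bounded s t hs ht := by
    obtain ⟨a, ha⟩ := hs.exists_norm_le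
    obtain ⟨b, hb⟩ := ht.exists_norm_le
    refine isBounded_iff_forall_norm_le.2 ⟨a * b, ?_⟩
    rintro _ ⟨x, hx, y, hy, rfl⟩
    simp only [norm_mul]
    exact mul_le_mul (ha x hx) (hb y hy) (norm_nonneg _) ((norm_nonneg _).trans (ha x hx))

section Algebra

variable (A B K L : Type*)
  [NonUnitalRing A] [Module ℂ A] [IsScalarTower ℂ A A] [SMulCommClass ℂ A A]
  [Bornology A] [CompleteBornology A] [BornologicalAlgebra A]
  [NonUnitalRing B] [Module ℂ B] [IsScalarTower ℂ B B] [SMulCommClass ℂ B B]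
  [Bornology B] [CompleteBornology B] [BornologicalAlgebra B]
  [NonUnitalRing K] [Module ℂ K] [IsScalarTower ℂ K K] [SMulCommClass ℂ K K]
  [Bornology K] [CompleteBornology K] [BornologicalAlgebra K]
  [NonUnitalRing L] [Module ℂ L] [IsScalarTower ℂ L L] [SMulCommClass ℂ L L]
  [Bornology L] [CompleteBornology L] [BornologicalAlgebra L]

/-- The multiplication as a bounded bilinear map. -/
def mulHom : BHom A (BHom A A) :=
  BHom.mk₂ (· * ·) add_mul smul_mul_assoc mul_add mul_smul_comm
    (fun s t hs ht => BornologicalAlgebra.mul_bounded s t hs ht)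

variable {A B K L}

@[simp] theorem mulHom_apply (a b : A) : mulHom A a b = a * b := rfl

namespace CTensor

/-- The multiplication of `A ⊗̂ B`, with `(a ⊗ b) (a' ⊗ b') = a a' ⊗ b b'`. -/
def mulT : BHom (CTensor A B) (BHom (CTensor A B) (CTensor A B)) :=
  lift (BHom.precomp (mapHom A B A B) (mulHom A) (mulHom B))

theorem mulT_tmul (a a' : A) (b b' : B) :
    mulT (tmul a b) (tmul a' b') = tmul (a * a') (b * b') := by simp [mulT]

theorem mulT_assoc (x y z : CTensor A B) : mulT (mulT x y) z = mulT x (mulT y z) := by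
  refine bilin_ext (f := BHom.postcomp (BHom.flip mulT z) mulT)
    (g := BHom.precomp mulT (BHom.id _) (BHom.flip mulT z)) (fun a b a' b' => ?_) x y
  have : mulT (mulT (tmul a b) (tmul a' b')) =
      (mulT (tmul a b)).comp (mulT (tmul a' b')) :=
    hom_ext fun a'' b'' => by simp [mulT_tmul, mul_assoc]
  exact DFunLike.congr_fun this z

instance : NonUnitalRing (CTensor A B) where
  __ := (inferInstance : AddCommGroup (CTensor A B))
  mul x y := mulT x y
  left_distrib x y z := map_add (mulT x) y z
  right_distrib x y z := by
    change mulT (x + y) z = mulT x z + mulT y z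
    simp
  zero_mul x := by
    change mulT 0 x = 0
    simp
  mul_zero x := map_zero (mulT x)
  mul_assoc := mulT_assoc

theorem mul_def (x y : CTensor A B) : x * y = mulT x y := rfl

@[simp] theorem tmul_mul_tmul (a a' : A) (b b' : B) :
    (tmul a b * tmul a' b' : CTensor A B) = tmul (a * a') (b * b') := mulT_tmul a a' b b'

instance : IsScalarTower ℂ (CTensor A B) (CTensor A B) where
  smul_assoc c x y := by
    change mulT (c • x) y = c • mulT x y
    simp

instance : SMulCommClass ℂ (CTensor A B) (CTensor A B) where
  smul_comm c x y := by
    change c • mulT x y = mulT x (c • y)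
    simp

instance : BornologicalAlgebra (CTensor A B) where
  mul_bounded _ _ hs ht := (mulT (A := A) (B := B)).bounded₂ hs ht

end CTensor

variable (K) in
/-- The multiplier algebra `M(K)`: pairs `(L, R)` of bounded linear maps with `L (f g) = L(f) g`,
`R (f g) = f R(g)` and `f L(g) = R(f) g`. The product of `(L, R)` and `(L', R')` is
`(L ∘ L', R' ∘ R)`. -/
def multiplierSubalgebra : Subalgebra ℂ (Module.End ℂ K × (Module.End ℂ K)ᵐᵒᵖ) where
  carrier := {m | IsBoundedMap m.1 ∧ IsBoundedMap m.2.unop ∧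
    (∀ f g, m.1 (f * g) = m.1 f * g) ∧ (∀ f g, m.2.unop (f * g) = f * m.2.unop g) ∧
    ∀ f g, f * m.1 g = m.2.unop f * g}
  mul_mem' := by
    rintro ⟨l, r⟩ ⟨l', r'⟩ ⟨h1, h2, h3, h4, h5⟩ ⟨h1', h2', h3', h4', h5'⟩
    refine ⟨fun s hs => ?_, fun s hs => ?_, fun f g => ?_, fun f g => ?_, fun f g => ?_⟩
    · have := h1 _ (h1' s hs)
      rwa [Set.image_image] at this
    · have := h2' _ (h2 s hs)
      rwa [Set.image_image] at this
    · change l (l' (f * g)) = l (l' f) * g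
      simp only at h3 h3'
      rw [h3', h3]
    · change r'.unop (r.unop (f * g)) = f * r'.unop (r.unop g)
      simp only at h4 h4'
      rw [h4, h4']
    · change f * l (l' g) = r'.unop (r.unop f) * g
      simp only at h5 h5'
      rw [h5, h5']
  add_mem' := by
    rintro ⟨l, r⟩ ⟨l', r'⟩ ⟨h1, h2, h3, h4, h5⟩ ⟨h1', h2', h3', h4', h5'⟩
    refine ⟨(boundedMaps K K).add_mem h1 h1', (boundedMaps K K).add_mem h2 h2',
      fun f g => ?_, fun f g => ?_, fun f g => ?_⟩
    · change l (f * g) + l' (f * g) = (l f + l' f) * g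
      simp only at h3 h3'
      rw [h3, h3', add_mul]
    · change r.unop (f * g) + r'.unop (f * g) = f * (r.unop g + r'.unop g)
      simp only at h4 h4'
      rw [h4, h4', mul_add]
    · change f * (l g + l' g) = (r.unop f + r'.unop f) * g
      simp only at h5 h5'
      rw [mul_add, add_mul, h5, h5']
  algebraMap_mem' := by
    intro c
    refine ⟨(boundedMaps K K).smul_mem c (BHom.id K).2,
      (boundedMaps K K).smul_mem c (BHom.id K).2, fun f g => ?_, fun f g => ?_, fun f g => ?_⟩
    · exact (smul_mul_assoc c f g).symm
    · exact (mul_smul_comm c f g).symm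
    · exact (mul_smul_comm c f g).trans (smul_mul_assoc c f g).symm

variable (K) in
/-- The multiplier algebra `M(K)`. -/
def Multiplier : Type _ := multiplierSubalgebra K

namespace Multiplier

instance : Ring (Multiplier K) := inferInstanceAs (Ring (multiplierSubalgebra K))
instance : Algebra ℂ (Multiplier K) := inferInstanceAs (Algebra ℂ (multiplierSubalgebra K))

/-- Left multiplication `x ↦ m · x` by a multiplier. -/
def left (m : Multiplier K) : BHom K K := BHom.mk m.1.1 m.2.1

/-- Right multiplication `x ↦ x · m` by a multiplier. -/
def right (m : Multiplier K) : BHom K K := BHom.mk m.1.2.unop m.2.2.1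

theorem left_mul' (m : Multiplier K) (x y : K) : m.left (x * y) = m.left x * y := m.2.2.2.1 x y

theorem right_mul' (m : Multiplier K) (x y : K) : m.right (x * y) = x * m.right y :=
  m.2.2.2.2.1 x y

theorem compat (m : Multiplier K) (x y : K) : x * m.left y = m.right x * y := m.2.2.2.2.2 x y

@[ext] theorem ext {m n : Multiplier K} (h1 : ∀ x, m.left x = n.left x)
    (h2 : ∀ x, m.right x = n.right x) : m = n :=
  Subtype.ext (Prod.ext (LinearMap.ext h1) (MulOpposite.unop_injective (LinearMap.ext h2)))

/-- Build a multiplier. -/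
def mk (l r : BHom K K) (h1 : ∀ f g, l (f * g) = l f * g) (h2 : ∀ f g, r (f * g) = f * r g)
    (h3 : ∀ f g, f * l g = r f * g) : Multiplier K :=
  ⟨(l.toLin, MulOpposite.op r.toLin), l.bounded, r.bounded, h1, h2, h3⟩

@[simp] theorem left_mk (l r : BHom K K) (h1 h2 h3) : (mk l r h1 h2 h3).left = l := rfl
@[simp] theorem right_mk (l r : BHom K K) (h1 h2 h3) : (mk l r h1 h2 h3).right = r := rfl
@[simp] theorem left_mul (m n : Multiplier K) (x : K) : (m * n).left x = m.left (n.left x) := rfl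
@[simp] theorem right_mul (m n : Multiplier K) (x : K) :
    (m * n).right x = n.right (m.right x) := rfl
@[simp] theorem left_add (m n : Multiplier K) : (m + n).left = m.left + n.left := rfl
@[simp] theorem right_add (m n : Multiplier K) : (m + n).right = m.right + n.right := rfl
@[simp] theorem left_smul (c : ℂ) (m : Multiplier K) : (c • m).left = c • m.left := rfl
@[simp] theorem right_smul (c : ℂ) (m : Multiplier K) : (c • m).right = c • m.right := rfl
@[simp] theorem left_one (x : K) : (1 : Multiplier K).left x = x := rfl
@[simp] theorem right_one (x : K) : (1 : Multiplier K).right x = x := rfl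

/-- The bornology of `M(K)`: the left and the right multiplications are equibounded. -/
instance : Bornology (Multiplier K) :=
  Bornology.ofBounded {M | IsBounded (left '' M) ∧ IsBounded (right '' M)}
    (by simp)
    (fun _ h _ h' => ⟨h.1.subset (Set.image_mono h'), h.2.subset (Set.image_mono h')⟩)
    (fun _ h _ h' => by
      simp only [Set.mem_ofPred_eq, Set.image_union, isBounded_union]
      exact ⟨⟨h.1, h'.1⟩, h.2, h'.2⟩)
    (fun m => by simp)

theorem isBounded_iff {M : Set (Multiplier K)} :
    IsBounded M ↔ IsBounded (left '' M) ∧ IsBounded (right '' M) :=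
  Bornology.isBounded_ofBounded_iff _

/-- The tensor product of two multipliers, acting on `K ⊗̂ L`. -/
def tensor (m : Multiplier K) (n : Multiplier L) : Multiplier (CTensor K L) :=
  mk (CTensor.map m.left n.left) (CTensor.map m.right n.right)
    (CTensor.bilin_ext (f := BHom.postcomp (CTensor.map m.left n.left) CTensor.mulT)
      (g := BHom.precomp CTensor.mulT (CTensor.map m.left n.left) (BHom.id _))
      (fun a b a' b' => by simp [CTensor.mulT_tmul, left_mul']))
    (CTensor.bilin_ext (f := BHom.postcomp (CTensor.map m.right n.right) CTensor.mulT)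
      (g := BHom.precomp CTensor.mulT (BHom.id _) (CTensor.map m.right n.right))
      (fun a b a' b' => by simp [CTensor.mulT_tmul, right_mul']))
    (CTensor.bilin_ext (f := BHom.precomp CTensor.mulT (BHom.id _) (CTensor.map m.left n.left))
      (g := BHom.precomp CTensor.mulT (CTensor.map m.right n.right) (BHom.id _))
      (fun a b a' b' => by simp [CTensor.mulT_tmul, compat]))

@[simp] theorem tensor_left (m : Multiplier K) (n : Multiplier L) :
    (tensor m n).left = CTensor.map m.left n.left := rfl
@[simp] theorem tensor_right (m : Multiplier K) (n : Multiplier L) :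
    (tensor m n).right = CTensor.map m.right n.right := rfl

/-- The multiplier given by an element of the algebra. -/
def of (a : K) : Multiplier K :=
  mk (mulHom K a) (BHom.flip (mulHom K) a) (fun f g => (mul_assoc a f g).symm)
    (fun f g => mul_assoc f g a) (fun f g => (mul_assoc f a g).symm)

@[simp] theorem of_left (a x : K) : (of a).left x = a * x := rfl
@[simp] theorem of_right (a x : K) : (of a).right x = x * a := rfl

end Multiplier

variable (A K) in
/-- A (bounded) homomorphism `A → M(K)`. -/
structure MultHom extends A →ₙₐ[ℂ] Multiplier K where
  bounded' : IsBoundedMap toFun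

namespace MultHom

instance : CoeFun (MultHom A K) (fun _ => A → Multiplier K) := ⟨fun f => f.toNonUnitalAlgHom⟩

/-- The left action of `A` on `K`, as a bounded bilinear map. -/
def leftHom (f : MultHom A K) : BHom A (BHom K K) :=
  BHom.mk
    { toFun := fun a => (f a).left
      map_add' := fun a b => by rw [map_add, Multiplier.left_add]
      map_smul' := fun c a => by rw [map_smul, Multiplier.left_smul]; rfl }
    (fun s hs => by
      have := (Multiplier.isBounded_iff.1 (f.bounded' s hs)).1
      rwa [Set.image_image] at this)

/-- The right action of `A` on `K`, as a bounded bilinear map. -/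
def rightHom (f : MultHom A K) : BHom A (BHom K K) :=
  BHom.mk
    { toFun := fun a => (f a).right
      map_add' := fun a b => by rw [map_add, Multiplier.right_add]
      map_smul' := fun c a => by rw [map_smul, Multiplier.right_smul]; rfl }
    (fun s hs => by
      have := (Multiplier.isBounded_iff.1 (f.bounded' s hs)).2
      rwa [Set.image_image] at this)

@[simp] theorem leftHom_apply (f : MultHom A K) (a : A) : f.leftHom a = (f a).left := rfl
@[simp] theorem rightHom_apply (f : MultHom A K) (a : A) : f.rightHom a = (f a).right := rfl

variable (A) in
/-- The canonical homomorphism `ι : A → M(A)`. -/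
def incl : MultHom A A where
  toFun := Multiplier.of
  map_smul' c a := by ext x <;> simp [smul_mul_assoc, mul_smul_comm]
  map_zero' := by
    have h : ∀ m : Multiplier A, m + m = m → m = 0 := fun m hm => by simpa using hm
    exact h _ (by ext x <;> simp)
  map_add' a b := by ext x <;> simp [add_mul, mul_add]
  map_mul' a b := by ext x <;> simp [mul_assoc]
  bounded' s hs := by
    rw [Multiplier.isBounded_iff, Set.image_image, Set.image_image]
    exact ⟨(mulHom A).bounded s hs, (BHom.flip (mulHom A)).bounded s hs⟩

@[simp] theorem incl_apply (a : A) : incl A a = Multiplier.of a := rfl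

section TensorHom

variable (f : MultHom A K) (g : MultHom B L)

/-- The left action of `A ⊗̂ B` on `K ⊗̂ L`. -/
def tensorLeft : BHom (CTensor A B) (BHom (CTensor K L) (CTensor K L)) :=
  CTensor.lift (BHom.precomp (CTensor.mapHom K L K L) f.leftHom g.leftHom)

/-- The right action of `A ⊗̂ B` on `K ⊗̂ L`. -/
def tensorRight : BHom (CTensor A B) (BHom (CTensor K L) (CTensor K L)) :=
  CTensor.lift (BHom.precomp (CTensor.mapHom K L K L) f.rightHom g.rightHom)

theorem tensorLeft_tmul (a : A) (b : B) :
    tensorLeft f g (CTensor.tmul a b) = (Multiplier.tensor (f a) (g b)).left := by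
  simp [tensorLeft]

theorem tensorRight_tmul (a : A) (b : B) :
    tensorRight f g (CTensor.tmul a b) = (Multiplier.tensor (f a) (g b)).right := by
  simp [tensorRight]

/-- The multiplier of `K ⊗̂ L` given by an element of `A ⊗̂ B`. -/
def tensorFun (x : CTensor A B) : Multiplier (CTensor K L) :=
  Multiplier.mk (tensorLeft f g x) (tensorRight f g x)
    (fun y z => by
      have : (BHom.eval (y * z)).comp (tensorLeft f g) =
          (BHom.flip (mulHom _) z).comp ((BHom.eval y).comp (tensorLeft f g)) :=
        CTensor.hom_ext fun a b => by
          simp only [BHom.comp_apply, tensorLeft_tmul, BHom.eval_apply]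
          exact Multiplier.left_mul' _ y z
      exact DFunLike.congr_fun this x)
    (fun y z => by
      have : (BHom.eval (y * z)).comp (tensorRight f g) =
          (mulHom _ y).comp ((BHom.eval z).comp (tensorRight f g)) :=
        CTensor.hom_ext fun a b => by
          simp only [BHom.comp_apply, tensorRight_tmul, BHom.eval_apply]
          exact Multiplier.right_mul' _ y z
      exact DFunLike.congr_fun this x)
    (fun y z => by
      have : (mulHom _ y).comp ((BHom.eval z).comp (tensorLeft f g)) =
          (BHom.flip (mulHom _) z).comp ((BHom.eval y).comp (tensorRight f g)) :=
        CTensor.hom_ext fun a b => by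
          simp only [BHom.comp_apply, tensorRight_tmul, tensorLeft_tmul, BHom.eval_apply]
          exact Multiplier.compat _ y z
      exact DFunLike.congr_fun this x)

@[simp] theorem tensorFun_left (x : CTensor A B) : (tensorFun f g x).left = tensorLeft f g x := rfl
@[simp] theorem tensorFun_right (x : CTensor A B) : (tensorFun f g x).right = tensorRight f g x :=
  rfl

/-- The induced homomorphism `f ⊗̂ g : A ⊗̂ B → M(K ⊗̂ L)`, with `a ⊗ b ↦ f(a) ⊗ g(b)`. -/
def tensor : MultHom (CTensor A B) (CTensor K L) where
  toFun := tensorFun f g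
  map_smul' c x := by ext y <;> simp
  map_zero' := by
    have h : ∀ m : Multiplier (CTensor K L), m + m = m → m = 0 := fun m hm => by simpa using hm
    exact h _ (by ext x <;> simp)
  map_add' x y := by ext z <;> simp
  map_mul' x x' := by
    ext y
    · refine CTensor.bilin_ext
        (f := BHom.postcomp ((BHom.eval y).comp (tensorLeft f g)) CTensor.mulT)
        (g := BHom.precomp (tensorLeft f g) (BHom.id _) ((BHom.eval y).comp (tensorLeft f g)))
        (fun a b a' b' => ?_) x x'
      simp only [BHom.postcomp_apply, BHom.comp_apply, BHom.precomp_apply, BHom.id_apply,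
        CTensor.mulT_tmul, tensorLeft_tmul, BHom.eval_apply, map_mul, Multiplier.tensor_left]
      have : CTensor.map (f a * f a').left (g b * g b').left =
          (CTensor.map (f a).left (g b).left).comp (CTensor.map (f a').left (g b').left) :=
        CTensor.hom_ext fun v w => by simp
      exact DFunLike.congr_fun this y
    · refine CTensor.bilin_ext
        (f := BHom.postcomp ((BHom.eval y).comp (tensorRight f g)) CTensor.mulT)
        (g := BHom.flip (BHom.precomp (tensorRight f g) (BHom.id _)
          ((BHom.eval y).comp (tensorRight f g))))
        (fun a b a' b' => ?_) x x'
      simp only [BHom.postcomp_apply, BHom.comp_apply, BHom.precomp_apply, BHom.id_apply,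
        CTensor.mulT_tmul, tensorRight_tmul, BHom.eval_apply, map_mul, Multiplier.tensor_right,
        BHom.flip_apply]
      have : CTensor.map (f a * f a').right (g b * g b').right =
          (CTensor.map (f a').right (g b').right).comp (CTensor.map (f a).right (g b).right) :=
        CTensor.hom_ext fun v w => by simp
      exact DFunLike.congr_fun this y
  bounded' s hs := by
    rw [Multiplier.isBounded_iff, Set.image_image, Set.image_image]
    exact ⟨(tensorLeft f g).bounded s hs, (tensorRight f g).bounded s hs⟩

theorem tensor_tmul (a : A) (b : B) :
    tensor f g (CTensor.tmul a b) = Multiplier.tensor (f a) (g b) := by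
  change tensorFun f g _ = _
  refine Multiplier.ext (fun x => ?_) (fun x => ?_)
  · simp [tensorLeft_tmul]
  · simp [tensorRight_tmul]

end TensorHom

/-- `F : M(A) → M(K)` is a (bounded) unital homomorphism extending `f : A → M(K)`. For essential
`f` there is exactly one such `F`. -/
def IsExtension (f : MultHom A K) (F : Multiplier A →ₐ[ℂ] Multiplier K) : Prop :=
  IsBoundedMap F ∧ ∀ a, F (Multiplier.of a) = f a

end MultHom

end Algebra

/-! ## Essential algebras and homomorphisms -/

section Essential

variable {A V W X : Type*}
  [AddCommGroup V] [Module ℂ V] [Bornology V] [CompleteBornology V]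
  [AddCommGroup W] [Module ℂ W] [Bornology W] [CompleteBornology W]
  [AddCommGroup X] [Module ℂ X] [Bornology X] [CompleteBornology X]

/-- For a right action `r` of `A` on `V` and a left action `l` of `A` on `W`, the completed
balanced tensor product `V ⊗̂_A W`: the quotient of `V ⊗̂ W` by the closed subspace generated by
`v a ⊗ w - v ⊗ a w`. -/
def BalancedTensor (r : V → A → V) (l : A → W → W) : Type _ :=
  BQuot (Submodule.span ℂ {x : CTensor V W | ∃ v a w,
    x = CTensor.tmul (r v a) w - CTensor.tmul v (l a w)})

namespace BalancedTensor

variable (r : V → A → V) (l : A → W → W)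

instance : AddCommGroup (BalancedTensor r l) := inferInstanceAs (AddCommGroup (BQuot _))
instance : Module ℂ (BalancedTensor r l) := inferInstanceAs (Module ℂ (BQuot _))
instance : Bornology (BalancedTensor r l) := inferInstanceAs (Bornology (BQuot _))
instance : CompleteBornology (BalancedTensor r l) :=
  inferInstanceAs (CompleteBornology (BQuot _))

/-- The quotient map `V ⊗̂ W → V ⊗̂_A W`. -/
def mk : BHom (CTensor V W) (BalancedTensor r l) := BQuot.mk _

end BalancedTensor

/-- The bilinear map `m : V × W → X` induces a bornological isomorphism `V ⊗̂_A W ≅ X`. -/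
def InducesIso (r : V → A → V) (l : A → W → W) (m : V → W → X) : Prop :=
  ∃ e : BHom (BalancedTensor r l) X, IsBornIso e ∧
    ∀ v w, e (BalancedTensor.mk r l (CTensor.tmul v w)) = m v w

end Essential

/-! ## Bornological quantum groups -/

section QuantumGroup

variable (H : Type*)
  [NonUnitalRing H] [Module ℂ H] [IsScalarTower ℂ H H] [SMulCommClass ℂ H H]
  [Bornology H] [CompleteBornology H] [BornologicalAlgebra H]

/-- `H` is essential: the multiplication induces an isomorphism `H ⊗̂_H H ≅ H`. -/
def IsEssentialAlgebra : Prop :=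
  InducesIso (A := H) (V := H) (W := H) (X := H) (· * ·) (· * ·) (· * ·)

variable {H}

/-- A homomorphism `f : H → M(K)` is essential if it turns `K` into an essential left and right
`H`-module: `H ⊗̂_H K ≅ K` and `K ⊗̂_H H ≅ K`. -/
def MultHom.IsEssential {K : Type*}
    [NonUnitalRing K] [Module ℂ K] [IsScalarTower ℂ K K] [SMulCommClass ℂ K K]
    [Bornology K] [CompleteBornology K] [BornologicalAlgebra K] (f : MultHom H K) : Prop :=
  InducesIso (A := H) (V := H) (W := K) (X := K) (· * ·)
    (fun h k => (f h).left k) (fun h k => (f h).left k) ∧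
  InducesIso (A := H) (V := K) (W := H) (X := K)
    (fun k h => (f h).right k) (· * ·) (fun k h => (f h).right k)

/-- Coassociativity `(Δ ⊗̂ id) Δ = (id ⊗̂ Δ) Δ`, where `Δ ⊗̂ id : H ⊗̂ H → M((H ⊗̂ H) ⊗̂ H)` and
`id ⊗̂ Δ : H ⊗̂ H → M(H ⊗̂ (H ⊗̂ H))` are extended to `M(H ⊗̂ H)` and the two triple tensor
products are identified by associativity. -/
def IsCoassociative (Δ : MultHom H (CTensor H H)) : Prop :=
  ∃ (F : Multiplier (CTensor H H) →ₐ[ℂ] Multiplier (CTensor (CTensor H H) H))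
    (G : Multiplier (CTensor H H) →ₐ[ℂ] Multiplier (CTensor H (CTensor H H))),
    (MultHom.tensor Δ (MultHom.incl H)).IsExtension F ∧
    (MultHom.tensor (MultHom.incl H) Δ).IsExtension G ∧
    ∀ (h : H) (x : CTensor (CTensor H H) H),
      CTensor.assoc H H H ((F (Δ h)).left x) = (G (Δ h)).left (CTensor.assoc H H H x) ∧
      CTensor.assoc H H H ((F (Δ h)).right x) = (G (Δ h)).right (CTensor.assoc H H H x)

/-- A bounded functional is faithful if `ω(fg) = 0` for all `g` implies `f = 0` and `ω(fg) = 0`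
for all `f` implies `g = 0`. -/
def IsFaithful (ω : BHom H ℂ) : Prop :=
  (∀ f, (∀ g, ω (f * g) = 0) → f = 0) ∧ (∀ g, (∀ f, ω (f * g) = 0) → g = 0)

variable (H) in
/-- A bornological quantum group structure on the bornological algebra `H`. The Galois maps, which
take values in `H ⊗̂ H ⊆ M(H ⊗̂ H)`, are recorded together with the comultiplication that
determines them. -/
structure BornologicalQuantumGroup where
  nontrivial : Nontrivial H
  essential : IsEssentialAlgebra H
  approximation : ApproximationProperty H
  /-- The comultiplication `Δ : H → M(H ⊗̂ H)`. -/
  Δ : MultHom H (CTensor H H)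
  essential_Δ : Δ.IsEssential
  coassociative : IsCoassociative Δ
  /-- The Galois map `γ_l(f ⊗ g) = Δ(f) (g ⊗ 1)`. -/
  γl : BHom (CTensor H H) (CTensor H H)
  /-- The Galois map `γ_r(f ⊗ g) = Δ(f) (1 ⊗ g)`. -/
  γr : BHom (CTensor H H) (CTensor H H)
  /-- The Galois map `ρ_l(f ⊗ g) = (f ⊗ 1) Δ(g)`. -/
  ρl : BHom (CTensor H H) (CTensor H H)
  /-- The Galois map `ρ_r(f ⊗ g) = (1 ⊗ f) Δ(g)`. -/
  ρr : BHom (CTensor H H) (CTensor H H)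
  γl_spec : ∀ f g : H, Multiplier.of (γl (CTensor.tmul f g)) =
    Δ f * Multiplier.tensor (Multiplier.of g) 1
  γr_spec : ∀ f g : H, Multiplier.of (γr (CTensor.tmul f g)) =
    Δ f * Multiplier.tensor 1 (Multiplier.of g)
  ρl_spec : ∀ f g : H, Multiplier.of (ρl (CTensor.tmul f g)) =
    Multiplier.tensor (Multiplier.of f) 1 * Δ g
  ρr_spec : ∀ f g : H, Multiplier.of (ρr (CTensor.tmul f g)) =
    Multiplier.tensor 1 (Multiplier.of f) * Δ g
  γl_iso : IsBornIso γl
  γr_iso : IsBornIso γr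
  ρl_iso : IsBornIso ρl
  ρr_iso : IsBornIso ρr
  /-- The left Haar functional. -/
  φ : BHom H ℂ
  faithful : IsFaithful φ
  /-- Left invariance `(id ⊗̂ φ) Δ(f) = φ(f) 1` in `M(H)`, where the multiplier
  `(id ⊗̂ φ) Δ(f)` acts by `g ↦ (id ⊗̂ φ) γ_l(f ⊗ g)` from the left and by
  `g ↦ (id ⊗̂ φ) ρ_l(g ⊗ f)` from the right. -/
  leftInvariant : ∀ f g : H, idTensor H φ (γl (CTensor.tmul f g)) = φ f • g ∧
    idTensor H φ (ρl (CTensor.tmul g f)) = φ f • g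

/-- `ε` is the counit and `S` the antipode of the bornological quantum group `H`. -/
structure IsCounitAntipode (Q : BornologicalQuantumGroup H) (ε : BHom H ℂ) (S : BHom H H) :
    Prop where
  counit_mul : ∀ f g, ε (f * g) = ε f * ε g
  /-- The homomorphism `ε` is essential: `H ⊗̂_H ℂ ≅ ℂ` and `ℂ ⊗̂_H H ≅ ℂ`. -/
  counit_essential :
    InducesIso (A := H) (V := H) (W := ℂ) (X := ℂ) (· * ·)
      (fun h z => ε h * z) (fun h z => ε h * z) ∧
    InducesIso (A := H) (V := ℂ) (W := H) (X := ℂ)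
      (fun z h => z * ε h) (· * ·) (fun z h => z * ε h)
  /-- `(ε ⊗̂ id) Δ(f) = f` in `M(H)`. -/
  counit_left : ∀ f g, tensorId H ε (Q.γr (CTensor.tmul f g)) = f * g ∧
    tensorId H ε (Q.ρr (CTensor.tmul g f)) = g * f
  /-- `(id ⊗̂ ε) Δ(f) = f` in `M(H)`. -/
  counit_right : ∀ f g, idTensor H ε (Q.γl (CTensor.tmul f g)) = f * g ∧
    idTensor H ε (Q.ρl (CTensor.tmul g f)) = g * f
  antipode_iso : IsBornIso S
  antipode_mul : ∀ f g, S (f * g) = S g * S f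
  /-- `S` is a coalgebra antihomomorphism, `Δ(S(h)) = (S ⊗̂ S) τ Δ(h)`, where the algebra
  antiautomorphism `θ = (S ⊗̂ S) τ` of `H ⊗̂ H` is extended to multipliers by
  `θ(m) θ(x) = θ(x m)` and `θ(x) θ(m) = θ(m x)`. -/
  antipode_comul : ∀ (h : H) (x : CTensor H H),
    (Q.Δ (S h)).left (CTensor.map S S (CTensor.flip H H x)) =
      CTensor.map S S (CTensor.flip H H ((Q.Δ h).right x)) ∧
    (Q.Δ (S h)).right (CTensor.map S S (CTensor.flip H H x)) =
      CTensor.map S S (CTensor.flip H H ((Q.Δ h).left x))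
  /-- `μ (S ⊗̂ id) γ_r = ε ⊗̂ id`. -/
  antipode_left : ∀ x : CTensor H H,
    CTensor.lift (mulHom H) (CTensor.map S (BHom.id H) (Q.γr x)) = tensorId H ε x
  /-- `μ (id ⊗̂ S) ρ_l = id ⊗̂ ε`. -/
  antipode_right : ∀ x : CTensor H H,
    CTensor.lift (mulHom H) (CTensor.map (BHom.id H) S (Q.ρl x)) = idTensor H ε x

end QuantumGroup

end BornQG

end

noncomputable section

namespace BornQG

/-! ## The Banach space spanned by a completant disk -/

section DiskSpan

variable {V : Type*} [AddCommGroup V] [Module ℂ V] {D : Set V}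

/-! The structure is extracted from the Galois maps, with the Haar functional `φ` normalising
scalars. Two principles make this possible. First, cancellation: `φ` is faithful, so `H` has a
separating dual and trivial annihilators, and the approximation property carries both facts to
tensor products. The key point is `ApproximationProperty.eq_zero`: an `x` in `V ⊗̂ W` all of whose
slices `(ω ⊗ id)x` vanish is zero, because `(f ⊗ id)x = 0` for finite rank `f`, while suitable
finite rank `f` make `(f ⊗ id)x - x` small. Consequently `H ⊗̂ H` embeds into `M(H ⊗̂ H)`, and
identities between multipliers become identities between Galois maps. Second, each Galois map is
onto, so an identity of bounded linear maps may be tested on its values on elementary tensors.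

Coassociativity takes the form `(a ⊗ 1 ⊗ 1) Δ²(b) (1 ⊗ 1 ⊗ c)`, computed in two ways (`ρl_γr_comm`).
It yields `a ⊗ μγ_r⁻¹(b ⊗ c) = μρ_l⁻¹(a ⊗ b) ⊗ c`, whose two sides can only be `ε(b) a ⊗ c`; this
defines the counit. The antipode is defined by strong left invariance, `S((id ⊗ φ)γ_r(u)) = (id ⊗
φ)ρ_r(u)`. All of this is done for an abstract `IsGaloisSystem`, which is satisfied by `H` and by
its opposite algebra. The antipode of the opposite satisfies the reversed slice formula, and is
therefore the inverse of `S`.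

Since `S` exchanges the legs of `Δ` (`γr_antipode`), `ψ = φ ∘ S` is right invariant and `φ ∘ S²` is
left invariant. Left invariant functionals are unique up to a scalar, hence `φ ∘ S² = ν φ`.

For `σ`, every functional `φ(f ·)` must be rewritten as `φ(· h)`. The passage goes through `ψ`:
computing `(ψ ⊗ φ)(y Δ(x))` by either invariance relates `φ(d ·)` to `ψ(d' ·)` (`φ_inverse_mul`),
and strong invariance relates `ψ(d' ·)` to `φ(· h)` (`φ_mul_slice`). The elements arising in this
way exhaust `H`. Faithfulness then gives multiplicativity, bijectivity and uniqueness of `σ`.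
Applying the defining relation twice gives `φ(fg) = φ(σ(f)σ(g))`, and `φ ∘ S² = ν φ` gives `S²σ =
σS²`. -/

theorem IsDisk.gauge_csmul (hD : IsDisk D) (hn : D.Nonempty) (z : ℂ) {x : V}
    (hx : x ∈ Submodule.span ℂ D) : gauge D (z • x) ≤ ‖z‖ * gauge D x := by
  refine le_of_forall_pos_le_add fun ε hε => ?_
  have h1 : x ∈ (gauge D x + ε / (‖z‖ + 1)) • D :=
    hD.mem_smul_of_gauge_lt hn hx (by have : 0 < ε / (‖z‖ + 1) := by positivity
                                      linarith)
  have h2 := gauge_le_of_mem (by have := gauge_nonneg (s := D) x; positivity) (hD.csmul_mem z h1)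
  refine h2.trans ?_
  rw [mul_add]
  have : ‖z‖ * (ε / (‖z‖ + 1)) ≤ ε := by
    rw [mul_div_assoc', div_le_iff₀ (by positivity)]
    nlinarith [norm_nonneg z]
  linarith

theorem IsDisk.gauge_add (hD : IsDisk D) (hn : D.Nonempty) {x y : V}
    (hx : x ∈ Submodule.span ℂ D) (hy : y ∈ Submodule.span ℂ D) :
    gauge D (x + y) ≤ gauge D x + gauge D y := by
  refine le_of_forall_pos_le_add fun ε hε => ?_
  have h1 : x ∈ (gauge D x + ε / 2) • D :=
    hD.mem_smul_of_gauge_lt hn hx (by linarith)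
  have h2 : y ∈ (gauge D y + ε / 2) • D :=
    hD.mem_smul_of_gauge_lt hn hy (by linarith)
  have hx0 := gauge_nonneg (s := D) x
  have hy0 := gauge_nonneg (s := D) y
  refine (gauge_le_of_mem (by positivity)
    (hD.add_mem (by positivity) (by positivity) h1 h2)).trans ?_
  linarith

/-- The span of a completant disk, as a normed group. -/
@[reducible] def IsCompletant.normedGroup (hD : IsCompletant D) (hn : D.Nonempty) :
    NormedAddCommGroup (Submodule.span ℂ D) :=
  AddGroupNorm.toNormedAddCommGroup
    { toFun := fun x => gauge D x
      map_zero' := by simp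
      add_le' := fun x y => hD.disk.gauge_add hn x.2 y.2
      neg' := fun x => le_antisymm
        (by simpa using hD.disk.gauge_csmul hn (-1) x.2)
        (by simpa using hD.disk.gauge_csmul hn (-1) (neg_mem x.2))
      eq_zero_of_map_eq_zero' := fun x hx => Subtype.ext (hD.separated x x.2 hx) }

/-- The span of a completant disk, as a normed space. -/
@[reducible] def IsCompletant.normedSpace (hD : IsCompletant D) (hn : D.Nonempty) :
    letI := hD.normedGroup hn
    NormedSpace ℂ (Submodule.span ℂ D) :=
  letI := hD.normedGroup hn
  { norm_smul_le := fun z x => hD.disk.gauge_csmul hn z x.2 }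

theorem IsCompletant.completeSpace (hD : IsCompletant D) (hn : D.Nonempty) :
    letI := hD.normedGroup hn
    CompleteSpace (Submodule.span ℂ D) := by
  let := hD.normedGroup hn
  refine Metric.complete_of_cauchySeq_tendsto fun u hu => ?_
  obtain ⟨x, hx, h⟩ := hD.complete (fun n => (u n : V)) (fun n => (u n).2) (by
    intro ε hε
    obtain ⟨N, hN⟩ := Metric.cauchySeq_iff.1 hu ε hε
    refine ⟨N, fun m hm n hn' => ?_⟩
    have := hN m hm n hn'
    rw [dist_eq_norm] at this
    exact this)
  exact ⟨⟨x, hx⟩, tendsto_iff_norm_sub_tendsto_zero.2 h⟩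

/-- A totally bounded subset of the Banach space `⟨D⟩` is contained in a compact disk. -/
theorem exists_compactDisk [Bornology V] [CompleteBornology V] (hD : IsCompletant D)
    (hn : D.Nonempty) (hb : IsBounded D) (A : Set V) (hA : A ⊆ D)
    (hfin : ∀ ε : ℝ, 0 < ε → {a ∈ A | a ∉ ε • D}.Finite) :
    ∃ S, IsCompactDisk S ∧ A ⊆ S := by
  let := hD.normedGroup hn
  let := hD.normedSpace hn
  have := hD.completeSpace hn
  let : NormedSpace ℝ (Submodule.span ℂ D) := NormedSpace.restrictScalars ℝ ℂ _
  have hnorm : ∀ x : Submodule.span ℂ D, ‖x‖ = gauge D x := fun x => rfl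
  let A' : Set (Submodule.span ℂ D) := Subtype.val ⁻¹' A
  -- For each `ε`, the finitely many points of `A` outside `(ε/2) D`, together with `0`, form an
  -- `ε`-net; the halving provides the strict inequality.
  have htb : TotallyBounded A' := by
    rw [Metric.totallyBounded_iff]
    intro ε hε
    have h1 := (hfin (ε / 2) (by positivity)).preimage
      (f := (Subtype.val : Submodule.span ℂ D → V)) Subtype.val_injective.injOn
    refine ⟨insert 0 (Subtype.val ⁻¹' {a ∈ A | a ∉ (ε / 2) • D}), h1.insert 0, fun x hx => ?_⟩
    simp only [mem_iUnion, exists_prop]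
    by_cases hx' : (x : V) ∈ (ε / 2) • D
    · refine ⟨0, Or.inl rfl, ?_⟩
      rw [mem_ball_zero_iff, hnorm]
      exact (gauge_le_of_mem (by positivity) hx').trans_lt (by linarith)
    · exact ⟨x, Or.inr ⟨hx, hx'⟩, Metric.mem_ball_self hε⟩
  have hcl : IsCompact (closure A') := htb.closure.isCompact_of_isClosed isClosed_closure
  -- The balanced hull comes before the convex hull: it is the continuous image of a compact set,
  -- and convex hulls and closures of balanced sets stay balanced.
  have hB : IsCompact ((fun p : ℂ × Submodule.span ℂ D => p.1 • p.2) ''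
      (Metric.closedBall 0 1 ×ˢ closure A')) :=
    ((isCompact_closedBall _ _).prod hcl).image continuous_smul
  set B := (fun p : ℂ × Submodule.span ℂ D => p.1 • p.2) ''
      (Metric.closedBall 0 1 ×ˢ closure A') with hBdef
  have hbal : Balanced ℂ B := by
    rw [balanced_iff_smul_mem]
    rintro a ha _ ⟨⟨z, x⟩, ⟨hz, hx⟩, rfl⟩
    refine ⟨⟨a * z, x⟩, ⟨?_, hx⟩, by simp [mul_smul]⟩
    simp only [mem_closedBall_zero_iff, norm_mul] at hz ⊢
    exact mul_le_one₀ ha (norm_nonneg _) hz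
  -- Mazur's theorem: in a Banach space the closed convex hull of a compact set is compact.
  have hKc : IsCompact (closure (convexHull ℝ B)) :=
    ((hB.totallyBounded.convexHull).closure).isCompact_of_isClosed isClosed_closure
  set K := closure (convexHull ℝ B) with hK
  have hKbal : Balanced ℂ K := by
    refine Balanced.closure (balanced_iff_smul_mem.2 fun a ha x hx => ?_)
    refine (convexHull_min (fun y hy => ?_) ((convex_convexHull ℝ B).linear_preimage
      (LinearMap.lsmul ℂ _ a |>.restrictScalars ℝ)) : convexHull ℝ B ⊆ _) hx
    exact subset_convexHull ℝ B (hbal.smul_mem ha hy)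
  have hKconv : Convex ℝ K := (convex_convexHull ℝ B).closure
  refine ⟨Subtype.val '' K, ⟨⟨?_, ?_⟩, D, hb, hD, ?_, ?_⟩, fun a ha => ?_⟩
  · rw [balanced_iff_smul_mem]
    rintro a ha _ ⟨x, hx, rfl⟩
    exact ⟨a • x, hKbal.smul_mem ha hx, rfl⟩
  · rintro _ ⟨x, hx, rfl⟩ _ ⟨y, hy, rfl⟩ a b ha hb' hab
    exact ⟨a • x + b • y, hKconv hx hy ha hb' hab, rfl⟩
  · rintro _ ⟨x, _, rfl⟩
    exact x.2
  · intro u hu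
    choose w hw hwu using hu
    obtain ⟨x, hx, k, hk, hlim⟩ := hKc.tendsto_subseq hw
    refine ⟨x, ⟨x, hx, rfl⟩, k, hk, fun n => ?_, x.2, ?_⟩
    · rw [Function.comp_apply, ← hwu]; exact (w _).2
    · have := tendsto_iff_norm_sub_tendsto_zero.1 hlim
      refine this.congr fun n => ?_
      rw [hnorm, Function.comp_apply, Function.comp_apply, ← hwu]
      rfl
  · have haD : a ∈ Submodule.span ℂ D := Submodule.subset_span (hA ha)
    refine ⟨⟨a, haD⟩, subset_closure (subset_convexHull ℝ B ?_), rfl⟩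
    exact ⟨⟨1, ⟨a, haD⟩⟩, ⟨by simp, subset_closure ha⟩, by simp⟩

/-- Absolutely convergent series in `⟨D⟩`. -/
theorem exists_sum_of_summable [Bornology V] [CompleteBornology V] (hD : IsCompletant D)
    (hn : D.Nonempty) {ι : Type*} (f : ι → V) (r : ι → ℝ) (hr : ∀ i, 0 ≤ r i) (hs : Summable r)
    (hf : ∀ i, f i ∈ r i • D) :
    ∃ x, (∀ ε : ℝ, 0 < ε → ∃ F₀ : Finset ι, ∀ F, F₀ ⊆ F → x - ∑ i ∈ F, f i ∈ ε • D) ∧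
      ∀ δ : ℝ, (∑' i, r i) < δ → x ∈ δ • D := by
  let := hD.normedGroup hn
  have := hD.completeSpace hn
  have hnorm : ∀ x : Submodule.span ℂ D, ‖x‖ = gauge D x := fun x => rfl
  let g : ι → Submodule.span ℂ D := fun i => ⟨f i, smul_subset_span _ (hf i)⟩
  have hg : ∀ i, ‖g i‖ ≤ r i := fun i => gauge_le_of_mem (hr i) (hf i)
  have hsum : Summable g := Summable.of_norm_bounded hs hg
  refine ⟨(∑' i, g i : Submodule.span ℂ D), fun ε hε => ?_, fun δ hδ => ?_⟩
  · have h := hsum.hasSum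
    rw [HasSum, Metric.tendsto_nhds] at h
    obtain ⟨F₀, hF₀⟩ := Filter.eventually_atTop.1 (h ε hε)
    refine ⟨F₀, fun F hF => ?_⟩
    have h1 := hF₀ F hF
    rw [dist_comm, dist_eq_norm, hnorm] at h1
    have h2 := hD.disk.mem_smul_of_gauge_lt hn (Subtype.prop _) h1
    simpa [g] using h2
  · refine hD.disk.mem_smul_of_gauge_lt hn (Subtype.prop _) ?_
    rw [← hnorm]
    exact (tsum_of_norm_bounded hs.hasSum hg).trans_lt hδ

end DiskSpan

/-- A summable family stays summable after multiplication with suitable weights which tend to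
infinity on its support. -/
theorem exists_summable_weights {ι : Type*} {a : ι → ℝ} (ha : ∀ i, 0 ≤ a i) (hs : Summable a) :
    ∃ g : ι → ℝ, (∀ i, 1 ≤ g i) ∧ Summable (fun i => a i * g i) ∧
      ∀ N : ℝ, {i | a i ≠ 0 ∧ g i ≤ N}.Finite := by
  classical
  -- The tails outside `F n` have sum below `2⁻ⁿ`. Giving `i` one extra unit of weight for each `F
  -- n` that misses it then costs at most `∑ 2⁻ⁿ` in total.
  have h1 : ∀ n : ℕ, ∃ F : Finset ι, ∑' i : {i // i ∉ F}, a i < (1 / 2 : ℝ) ^ n := fun n =>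
    ((tendsto_tsum_compl_atTop_zero a).eventually_lt_const (by positivity)).exists
  choose F hF using h1
  -- the number of the sets `F n` which miss `i`
  let m : ι → ENNReal := fun i => ∑' n : ℕ, if i ∈ F n then 0 else 1
  have htot : ∑' i, ENNReal.ofReal (a i) * (1 + m i) < ⊤ := by
    have e : ∀ i, ENNReal.ofReal (a i) * (1 + m i) = ENNReal.ofReal (a i) +
        ∑' n : ℕ, if i ∈ F n then 0 else ENNReal.ofReal (a i) := fun i => by
      rw [mul_add, mul_one, ← ENNReal.tsum_mul_left]
      congr 1
      exact tsum_congr fun n => by split_ifs <;> simp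
    simp_rw [e]
    rw [ENNReal.tsum_add, ENNReal.tsum_comm, ENNReal.add_lt_top]
    refine ⟨hs.tsum_ofReal_lt_top, ?_⟩
    have h2 : ∀ n, (∑' i, if i ∈ F n then 0 else ENNReal.ofReal (a i)) ≤
        ENNReal.ofReal ((1 / 2 : ℝ) ^ n) := fun n => by
      have e2 : (∑' i, if i ∈ F n then 0 else ENNReal.ofReal (a i)) =
          ∑' i : {i // i ∉ F n}, ENNReal.ofReal (a i) := by
        rw [← tsum_subtype_eq_of_support_subset (s := {i | i ∉ F n})]
        · exact tsum_congr fun i => if_neg i.2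
        · intro i hi hF'
          simp [hF'] at hi
      have h3 : Summable fun i : {i // i ∉ F n} => a i := hs.subtype {i | i ∉ F n}
      rw [e2, ← ENNReal.ofReal_tsum_of_nonneg (f := fun i : {i // i ∉ F n} => a i)
        (fun i => ha i) h3]
      exact ENNReal.ofReal_le_ofReal (hF n).le
    refine (ENNReal.tsum_le_tsum h2).trans_lt ?_
    exact (summable_geometric_of_lt_one (by norm_num) (by norm_num)).tsum_ofReal_lt_top
  have hm : ∀ i, a i ≠ 0 → m i ≠ ⊤ := fun i hi hmi => by
    have h3 := (ENNReal.le_tsum i).trans_lt htot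
    rw [hmi, add_top, ENNReal.mul_top (by simpa using (ha i).lt_of_ne' hi)] at h3
    exact lt_irrefl _ h3
  refine ⟨fun i => 1 + (m i).toReal, fun i => by simp, ?_, fun N => ?_⟩
  · have h4 : ∀ i, a i * (1 + (m i).toReal) = (ENNReal.ofReal (a i) * (1 + m i)).toReal := by
      intro i
      by_cases hi : a i = 0
      · simp [hi]
      · rw [ENNReal.toReal_mul, ENNReal.toReal_ofReal (ha i),
          ENNReal.toReal_add ENNReal.one_ne_top (hm i hi), ENNReal.toReal_one]
    simp_rw [h4]
    exact ENNReal.summable_toReal htot.ne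
  · obtain ⟨K, hK⟩ := exists_nat_gt N
    refine ((Finset.range K).biUnion F).finite_toSet.subset ?_
    rintro i ⟨hi, hN⟩
    by_contra hcon
    -- A point outside `F 0, …, F (K - 1)` is missed at least `K > N` times, so its weight exceeds
    -- `N`.
    have h5 : (K : ENNReal) ≤ m i := by
      refine le_trans ?_ (ENNReal.sum_le_tsum (Finset.range K))
      rw [Finset.sum_congr rfl (g := fun _ => (1 : ENNReal))]
      · simp
      · intro n hn
        refine if_neg fun h => hcon ?_
        simp only [Finset.coe_biUnion, mem_iUnion]
        exact ⟨n, hn, h⟩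
    have h6 := (ENNReal.toReal_le_toReal (by simp) (hm i hi)).2 h5
    simp only [ENNReal.toReal_natCast] at h6
    linarith

/-! ### Slices and the approximation property -/

section

variable {V W : Type*}
  [AddCommGroup V] [Module ℂ V] [Bornology V] [CompleteBornology V]
  [AddCommGroup W] [Module ℂ W] [Bornology W] [CompleteBornology W]

namespace CTensor

theorem smul_tmul (c : ℂ) (v : V) (w : W) : tmul (c • v) w = c • tmul v w := by
  simp [← tmulHom_apply]

theorem tmul_smul (c : ℂ) (v : V) (w : W) : tmul v (c • w) = c • tmul v w := by
  simp [← tmulHom_apply]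

end CTensor

/-- Writing `f = ∑ ωᵢ(·) wᵢ` gives `(f ⊗ id)x = ∑ wᵢ ⊗ (ωᵢ ⊗ id)x`, so only slices of `x` enter. -/
theorem IsFiniteRank.map_eq_zero {f : BHom V V} (hf : IsFiniteRank f) {x : CTensor V W}
    (hx : ∀ ω : BHom V ℂ, tensorId W ω x = 0) : CTensor.map f (BHom.id W) x = 0 := by
  obtain ⟨k, ω, w, h⟩ := hf
  have : CTensor.map f (BHom.id W) =
      ∑ i, (CTensor.tmulHom V W (w i)).comp (tensorId W (ω i)) := by
    refine CTensor.hom_ext fun a b => ?_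
    simp only [CTensor.map_tmul, BHom.id_apply, BHom.sum_apply, BHom.comp_apply, tensorId_tmul,
      map_smul, h]
    rw [← CTensor.tmulHom_apply, map_sum, BHom.sum_apply]
    simp
  rw [this, BHom.sum_apply]
  exact Finset.sum_eq_zero fun i _ => by rw [BHom.comp_apply, hx, map_zero]

/-- If `V` has the approximation property, the slices by functionals on `V` separate the points
of `V ⊗̂ W`. -/
theorem ApproximationProperty.eq_zero (hV : ApproximationProperty V) {x : CTensor V W}
    (hx : ∀ ω : BHom V ℂ, tensorId W ω x = 0) : x = 0 := by
  classical
  obtain ⟨c, rfl⟩ := CTensor.proj_surjective x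
  obtain ⟨S, T, hS, hT, hc⟩ := c.2
  obtain ⟨D, hSD, hDn, hDb, hD⟩ := exists_disk hS
  -- Represent `x = ∑ c_p v_p ⊗ w_p`. The approximation property controls compact disks only, while
  -- the `v_p` merely lie in a bounded one. The weights let `v_p / g_p` tend to `0` in `⟨D⟩`, at the
  -- price of replacing `c_p` by the still summable `c_p g_p`.
  obtain ⟨g, hg1, hgs, hgfin⟩ := exists_summable_weights (fun _ => norm_nonneg _)
    (Ell1.summable_norm c)
  have hg0 : ∀ p, 0 < g p := fun p => one_pos.trans_le (hg1 p)
  set M := ∑' p, ‖c.val p‖ * g p with hM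
  have hM0 : 0 ≤ M := tsum_nonneg fun p => mul_nonneg (norm_nonneg _) (hg0 p).le
  have hsmall : ∀ p, ‖c.val p‖ ≠ 0 → (g p)⁻¹ • p.1 ∈ (g p)⁻¹ • D := fun p hp =>
    Set.smul_mem_smul_set (hSD (hc p (norm_ne_zero_iff.1 hp)).1)
  obtain ⟨K, hK, hAK⟩ := exists_compactDisk hD hDn hDb
    {a | ∃ p, ‖c.val p‖ ≠ 0 ∧ a = (g p)⁻¹ • p.1}
    (by
      rintro _ ⟨p, hp, rfl⟩
      have := hD.disk.smul_subset (inv_nonneg.2 (hg0 p).le) (inv_le_one_of_one_le₀ (hg1 p))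
        (hsmall p hp)
      simpa using this)
    (fun ε hε => by
      refine ((hgfin ε⁻¹).image fun p => (g p)⁻¹ • p.1).subset ?_
      rintro _ ⟨⟨p, hp, rfl⟩, hn⟩
      refine ⟨p, ⟨hp, ?_⟩, rfl⟩
      by_contra hlt
      refine hn (hD.disk.smul_subset (inv_nonneg.2 (hg0 p).le) ?_ (hsmall p hp))
      exact inv_le_of_inv_le₀ hε (not_le.1 hlt).le)
  obtain ⟨f, hf, T', hT', hT'b, ε, hε, hfε⟩ := hV K hK
  obtain ⟨E, hTE, hEn, hEb, hE⟩ := exists_disk ((CTensor.tmulHom V W).bounded₂ hT'b hT)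
  refine hE.eq_zero fun δ hδ => ?_
  obtain ⟨k, hk⟩ : ∃ k, M * |ε k| < δ := by
    have : Tendsto (fun k => M * |ε k|) atTop (𝓝 (M * |0|)) := hε.abs.const_mul M
    rw [abs_zero, mul_zero] at this
    exact (this.eventually_lt_const hδ).exists
  let b : BHom V (BHom W (CTensor V W)) :=
    BHom.precomp (CTensor.tmulHom V W) (f k - BHom.id V) (BHom.id W)
  -- On the compact disk `f k` differs from the identity by an element of `ε k • T'`; undoing the
  -- scaling of `v_p` multiplies the error by `g_p`.
  have hterm : ∀ p, c.val p • b p.1 p.2 ∈ (‖c.val p‖ * g p * |ε k|) • E := by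
    intro p
    by_cases hp : ‖c.val p‖ = 0
    · rw [norm_eq_zero.1 hp]
      exact ⟨0, hE.disk.zero_mem hEn, by simp⟩
    have h1 : f k ((g p)⁻¹ • p.1) - (g p)⁻¹ • p.1 ∈ ε k • T' := hfε k _ (hAK ⟨p, hp, rfl⟩)
    obtain ⟨t, ht, h2⟩ := h1
    have h3 : b p.1 p.2 = ((g p * ε k : ℝ) : ℂ) • CTensor.tmul t p.2 := by
      have h4 : f k p.1 - p.1 = ((g p * ε k : ℝ) : ℂ) • t := by
        have h5 : p.1 = ((g p : ℝ) : ℂ) • ((g p)⁻¹ • p.1) := by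
          rw [Complex.coe_smul, smul_smul, mul_inv_cancel₀ (hg0 p).ne', one_smul]
        simp only at h2
        rw [Complex.coe_smul, mul_smul, h2, smul_sub]
        nth_rw 1 [h5]
        rw [map_smul, Complex.coe_smul, smul_smul, mul_inv_cancel₀ (hg0 p).ne', one_smul]
      change CTensor.tmul (f k p.1 - p.1) p.2 = _
      rw [h4, CTensor.smul_tmul]
    have h6 : CTensor.tmul t p.2 ∈ (1 : ℝ) • E := by
      rw [one_smul]
      exact hTE ⟨t, ht, p.2, (hc p (norm_ne_zero_iff.1 hp)).2, rfl⟩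
    have h7 := hE.disk.csmul_mem (c.val p * ((g p * ε k : ℝ) : ℂ)) h6
    rw [h3, smul_smul]
    convert h7 using 2
    rw [norm_mul, Complex.norm_real, Real.norm_eq_abs, abs_mul, abs_of_pos (hg0 p)]
    ring
  obtain ⟨y, hy, hyδ⟩ := exists_sum_of_summable hE hEn (fun p => c.val p • b p.1 p.2)
    (fun p => ‖c.val p‖ * g p * |ε k|)
    (fun p => mul_nonneg (mul_nonneg (norm_nonneg _) (hg0 p).le) (abs_nonneg _))
    (hgs.mul_right _) hterm
  have h8 : Ell1.extend b c = y := Ell1.bsum_eq hEb hy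
  have h9 : CTensor.map (f k - BHom.id V) (BHom.id W) (CTensor.proj V W c) = y := by
    rw [← h8]; rfl
  have h10 : CTensor.map (f k - BHom.id V) (BHom.id W) =
      CTensor.map (f k) (BHom.id W) - BHom.id (CTensor V W) :=
    CTensor.hom_ext fun v w => by
      simp only [CTensor.map_tmul, BHom.sub_apply, BHom.id_apply]
      simp [← CTensor.tmulHom_apply]
  -- The slices of `x` vanish, so `((f k - id) ⊗ id)x` is just `-x`, and the estimate on the series
  -- bounds `x` itself.
  rw [h10, BHom.sub_apply, (hf k).map_eq_zero hx, BHom.id_apply, zero_sub] at h9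
  have h11 := hyδ δ (by rw [tsum_mul_right]; exact hk)
  rw [← h9] at h11
  simpa using hE.disk.neg_mem h11

end

section

variable {U V W X Y V' W' : Type*}
  [AddCommGroup U] [Module ℂ U] [Bornology U] [CompleteBornology U]
  [AddCommGroup V] [Module ℂ V] [Bornology V] [CompleteBornology V]
  [AddCommGroup W] [Module ℂ W] [Bornology W] [CompleteBornology W]
  [AddCommGroup X] [Module ℂ X] [Bornology X] [CompleteBornology X]
  [AddCommGroup Y] [Module ℂ Y] [Bornology Y] [CompleteBornology Y]
  [AddCommGroup V'] [Module ℂ V'] [Bornology V'] [CompleteBornology V']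
  [AddCommGroup W'] [Module ℂ W'] [Bornology W'] [CompleteBornology W']

/-! ## Calculus of tensor products of maps -/

/-- The bounded bilinear map underlying a bounded linear map on a tensor product. -/
def BHom.curry (f : BHom (CTensor V W) X) : BHom V (BHom W X) :=
  BHom.postcomp f (CTensor.tmulHom V W)

@[simp] theorem BHom.curry_apply (f : BHom (CTensor V W) X) (v : V) (w : W) :
    f.curry v w = f (CTensor.tmul v w) := rfl

@[simp] theorem BHom.comp_id (f : BHom V W) : f.comp (BHom.id V) = f := rfl

@[simp] theorem BHom.id_comp (f : BHom V W) : (BHom.id W).comp f = f := rfl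

/-- The inverse of a bornological isomorphism. -/
def BHom.inverse (f : BHom V W) (hf : IsBornIso f) : BHom W V :=
  BHom.mk (LinearEquiv.ofBijective f.toLin hf.1).symm.toLinearMap (fun s hs => by
    refine (hf.2.2 s hs).subset ?_
    rintro _ ⟨x, hx, rfl⟩
    have : f ((LinearEquiv.ofBijective f.toLin hf.1).symm x) = x :=
      (LinearEquiv.ofBijective f.toLin hf.1).apply_symm_apply x
    simpa [Set.mem_preimage, this] using hx)

@[simp] theorem BHom.apply_inverse (f : BHom V W) (hf : IsBornIso f) (x : W) :
    f (f.inverse hf x) = x :=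
  (LinearEquiv.ofBijective f.toLin hf.1).apply_symm_apply x

@[simp] theorem BHom.inverse_apply (f : BHom V W) (hf : IsBornIso f) (x : V) :
    f.inverse hf (f x) = x :=
  (LinearEquiv.ofBijective f.toLin hf.1).symm_apply_apply x

theorem isBornIso_of_inverse (f : BHom V W) (g : BHom W V) (h1 : ∀ x, g (f x) = x)
    (h2 : ∀ y, f (g y) = y) : IsBornIso f :=
  ⟨⟨Function.LeftInverse.injective h1, Function.RightInverse.surjective h2⟩, f.bounded,
    fun s hs => (g.bounded s hs).subset fun x hx => ⟨f x, hx, h1 x⟩⟩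

namespace CTensor

theorem eq_of_tmul (f g : BHom (CTensor V W) X) (h : ∀ v w, f (tmul v w) = g (tmul v w))
    (x : CTensor V W) : f x = g x := by
  rw [hom_ext h]

/-- Two bounded linear maps agree if they agree on the images of elementary tensors under a
surjection. -/
theorem eq_of_surjective {T : BHom (CTensor V W) U} (hT : Function.Surjective T)
    (f g : BHom U X) (h : ∀ v w, f (T (tmul v w)) = g (T (tmul v w))) (x : U) : f x = g x := by
  obtain ⟨y, rfl⟩ := hT x
  exact eq_of_tmul (f.comp T) (g.comp T) h y

theorem map_map {V'' W'' : Type*}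
    [AddCommGroup V''] [Module ℂ V''] [Bornology V''] [CompleteBornology V'']
    [AddCommGroup W''] [Module ℂ W''] [Bornology W''] [CompleteBornology W'']
    (f : BHom V' V'') (g : BHom W' W'') (f' : BHom V V') (g' : BHom W W') (x : CTensor V W) :
    map f g (map f' g' x) = map (f.comp f') (g.comp g') x :=
  eq_of_tmul ((map f g).comp (map f' g')) _ (fun v w => by simp) x

@[simp] theorem map_id (x : CTensor V W) : map (BHom.id V) (BHom.id W) x = x :=
  eq_of_tmul _ (BHom.id _) (fun v w => by simp) x

variable (V W) in
theorem map_id_id : map (BHom.id V) (BHom.id W) = BHom.id (CTensor V W) :=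
  BHom.ext map_id

@[simp] theorem flip_flip (x : CTensor V W) : flip W V (flip V W x) = x :=
  eq_of_tmul ((flip W V).comp (flip V W)) (BHom.id _) (fun v w => by simp) x

theorem flip_map (f : BHom V V') (g : BHom W W') (x : CTensor V W) :
    flip V' W' (map f g x) = map g f (flip V W x) :=
  eq_of_tmul ((flip V' W').comp (map f g)) ((map g f).comp (flip V W)) (fun v w => by simp) x

variable (V W) in
theorem isBornIso_flip : IsBornIso (flip V W) :=
  isBornIso_of_inverse _ (flip W V) flip_flip flip_flip

theorem assoc_map (f : BHom V V') (g : BHom W W') (h : BHom X Y) (x : CTensor (CTensor V W) X) :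
    assoc V' W' Y (map (map f g) h x) = map f (map g h) (assoc V W X x) := by
  refine eq_of_tmul ((assoc V' W' Y).comp (map (map f g) h))
    ((map f (map g h)).comp (assoc V W X)) (fun v x => ?_) x
  refine eq_of_tmul ((((assoc V' W' Y).comp (map (map f g) h)).curry).flip x)
    ((((map f (map g h)).comp (assoc V W X)).curry).flip x) (fun v w => ?_) v
  simp

end CTensor

theorem tensorId_map (ω : BHom V' ℂ) (f : BHom V V') (g : BHom W W') (x : CTensor V W) :
    tensorId W' ω (CTensor.map f g x) = g (tensorId W (ω.comp f) x) :=
  CTensor.eq_of_tmul ((tensorId W' ω).comp (CTensor.map f g)) (g.comp (tensorId W (ω.comp f)))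
    (fun v w => by simp) x

theorem idTensor_map (ω : BHom W' ℂ) (f : BHom V V') (g : BHom W W') (x : CTensor V W) :
    idTensor V' ω (CTensor.map f g x) = f (idTensor V (ω.comp g) x) :=
  CTensor.eq_of_tmul ((idTensor V' ω).comp (CTensor.map f g)) (f.comp (idTensor V (ω.comp g)))
    (fun v w => by simp) x

@[simp] theorem tensorId_flip (ω : BHom V ℂ) (x : CTensor W V) :
    tensorId W ω (CTensor.flip W V x) = idTensor W ω x :=
  CTensor.eq_of_tmul ((tensorId W ω).comp (CTensor.flip W V)) (idTensor W ω) (fun v w => by simp) x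

@[simp] theorem idTensor_flip (ω : BHom V ℂ) (x : CTensor V W) :
    idTensor W ω (CTensor.flip V W x) = tensorId W ω x :=
  CTensor.eq_of_tmul ((idTensor W ω).comp (CTensor.flip V W)) (tensorId W ω) (fun v w => by simp) x

/-- The two ways to apply a product functional agree. -/
theorem apply_idTensor (ω : BHom V ℂ) (η : BHom W ℂ) (x : CTensor V W) :
    ω (idTensor V η x) = η (tensorId W ω x) :=
  CTensor.eq_of_tmul (ω.comp (idTensor V η)) (η.comp (tensorId W ω))
    (fun v w => by simp [mul_comm]) x

/-! ## Separation properties -/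

variable (V) in
/-- The bounded functionals separate the points of `V`. -/
def HasSeparatingDual : Prop := ∀ v : V, (∀ ω : BHom V ℂ, ω v = 0) → v = 0

theorem ApproximationProperty.hasSeparatingDual_tensor (hV : ApproximationProperty V)
    (hW : HasSeparatingDual W) : HasSeparatingDual (CTensor V W) := fun _ hx =>
  hV.eq_zero fun ω => hW _ fun η => hx (η.comp (tensorId W ω))

/-- A jointly injective family of maps stays jointly injective after tensoring on the left. -/
theorem ApproximationProperty.map_id_eq_zero (hV : ApproximationProperty V) {ι : Type*}
    {f : ι → BHom W W'} (hf : ∀ w, (∀ i, f i w = 0) → w = 0) {x : CTensor V W}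
    (hx : ∀ i, CTensor.map (BHom.id V) (f i) x = 0) : x = 0 :=
  hV.eq_zero fun ω => hf _ fun i => by
    have := tensorId_map ω (BHom.id V) (f i) x
    rw [hx, map_zero] at this
    exact this.symm

/-- A jointly injective family of maps stays jointly injective after tensoring on the right. -/
theorem ApproximationProperty.map_eq_zero (hV : ApproximationProperty V)
    (hW : HasSeparatingDual W) {ι : Type*} {f : ι → BHom V V'}
    (hf : ∀ v, (∀ i, f i v = 0) → v = 0) {x : CTensor V W}
    (hx : ∀ i, CTensor.map (f i) (BHom.id W) x = 0) : x = 0 := by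
  refine hV.eq_zero fun ω => hW _ fun η => ?_
  rw [← apply_idTensor, hf (idTensor V η x), map_zero]
  intro i
  have := idTensor_map η (f i) (BHom.id W) x
  rw [hx, map_zero] at this
  exact this.symm

end

/-! ### Nondegeneracy of tensor product algebras -/

section

variable {A B : Type*}
  [NonUnitalRing A] [Module ℂ A] [IsScalarTower ℂ A A] [SMulCommClass ℂ A A]
  [Bornology A] [CompleteBornology A] [BornologicalAlgebra A]
  [NonUnitalRing B] [Module ℂ B] [IsScalarTower ℂ B B] [SMulCommClass ℂ B B]
  [Bornology B] [CompleteBornology B] [BornologicalAlgebra B]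

theorem CTensor.mul_tmul (x : CTensor A B) (a : A) (b : B) :
    x * tmul a b = map (BHom.flip (mulHom A) a) (BHom.flip (mulHom B) b) x :=
  eq_of_tmul (BHom.flip (mulHom _) (tmul a b)) _ (fun v w => by simp) x

theorem CTensor.tmul_mul (x : CTensor A B) (a : A) (b : B) :
    tmul a b * x = map (mulHom A a) (mulHom B b) x :=
  eq_of_tmul (mulHom _ (tmul a b)) _ (fun v w => by simp) x

/-- Right multiplications are jointly injective on `A ⊗̂ B` if they are so on `A` and `B`. -/
theorem ApproximationProperty.eq_zero_of_mul_tmul (hA : ApproximationProperty A)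
    (hB : HasSeparatingDual B) (h1 : ∀ x : A, (∀ y, x * y = 0) → x = 0)
    (h2 : ∀ x : B, (∀ y, x * y = 0) → x = 0) {x : CTensor A B}
    (hx : ∀ a b, x * CTensor.tmul a b = 0) : x = 0 := by
  refine hA.map_id_eq_zero (f := fun b => BHom.flip (mulHom B) b) h2 fun b => ?_
  refine hA.map_eq_zero hB (f := fun a => BHom.flip (mulHom A) a) h1 fun a => ?_
  rw [CTensor.map_map]
  have := hx a b
  rwa [CTensor.mul_tmul] at this

/-- Left multiplications are jointly injective on `A ⊗̂ B` if they are so on `A` and `B`. -/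
theorem ApproximationProperty.eq_zero_of_tmul_mul (hA : ApproximationProperty A)
    (hB : HasSeparatingDual B) (h1 : ∀ x : A, (∀ y, y * x = 0) → x = 0)
    (h2 : ∀ x : B, (∀ y, y * x = 0) → x = 0) {x : CTensor A B}
    (hx : ∀ a b, CTensor.tmul a b * x = 0) : x = 0 := by
  refine hA.map_id_eq_zero (f := fun b => mulHom B b) h2 fun b => ?_
  refine hA.map_eq_zero hB (f := fun a => mulHom A a) h1 fun a => ?_
  rw [CTensor.map_map]
  have := hx a b
  rwa [CTensor.tmul_mul] at this

end

/-! ## Counit and antipode from Galois maps -/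

section GaloisSystem

variable {V : Type*} [AddCommGroup V] [Module ℂ V] [Bornology V] [CompleteBornology V]

open CTensor

/-- For a bounded bilinear multiplication `m`, the relations between the maps
`L (a ⊗ b) = (a ⊗ 1) Δ(b)`, `R (a ⊗ b) = Δ(a) (1 ⊗ b)`, `P (a ⊗ b) = (1 ⊗ a) Δ(b)` and
`D c x = x Δ(c)`, which hold in a bornological quantum group and in its opposite. -/
structure IsGaloisSystem (m : BHom V (BHom V V)) (L R P : BHom (CTensor V V) (CTensor V V))
    (D : V → BHom (CTensor V V) (CTensor V V)) : Prop where
  L_iso : IsBornIso L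
  R_iso : IsBornIso R
  mul_assoc : ∀ a b c, m (m a b) c = m a (m b c)
  nondeg_left : ∀ x, (∀ b, m b x = 0) → x = 0
  left_R : ∀ a p q, map (m a) (BHom.id V) (R (tmul p q)) =
    map (BHom.id V) (BHom.flip m q) (L (tmul a p))
  left_P : ∀ b x c, map (m b) (BHom.id V) (P (tmul x c)) =
    map (BHom.id V) (m x) (L (tmul b c))
  D_tmul : ∀ c p q, D c (tmul p q) = map (BHom.id V) (m q) (L (tmul p c))
  L_mul : ∀ a b c, L (tmul a (m b c)) = D c (L (tmul a b))
  coassoc : ∀ a b c, CTensor.assoc V V V (map (L.curry a) (BHom.id V) (R (tmul b c))) =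
    map (BHom.id V) (BHom.flip R.curry c) (L (tmul a b))

theorem map_id_idTensor_assoc {U V W : Type*}
    [AddCommGroup U] [Module ℂ U] [Bornology U] [CompleteBornology U]
    [AddCommGroup V] [Module ℂ V] [Bornology V] [CompleteBornology V]
    [AddCommGroup W] [Module ℂ W] [Bornology W] [CompleteBornology W]
    (η : BHom W ℂ) (z : CTensor (CTensor U V) W) :
    map (BHom.id U) (idTensor V η) (CTensor.assoc U V W z) = idTensor (CTensor U V) η z := by
  refine eq_of_tmul ((map (BHom.id U) (idTensor V η)).comp (CTensor.assoc U V W))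
    (idTensor (CTensor U V) η) (fun x w => ?_) z
  refine eq_of_tmul
    (((map (BHom.id U) (idTensor V η)).comp (CTensor.assoc U V W)).curry.flip w)
    ((idTensor (CTensor U V) η).curry.flip w) (fun u v => ?_) x
  simp [tmul_smul]

namespace IsGaloisSystem

variable {m : BHom V (BHom V V)} {L R P : BHom (CTensor V V) (CTensor V V)}
    {D : V → BHom (CTensor V V) (CTensor V V)} (h : IsGaloisSystem m L R P D)

include h

theorem eq_of_nondeg {x y : V} (hxy : ∀ b, m b x = m b y) : x = y :=
  sub_eq_zero.1 (h.nondeg_left _ fun b => by rw [map_sub, hxy, sub_self])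

/-- For `u = R(p ⊗ q)`, coassociativity turns the argument into `(id ⊗ R(· ⊗ q)) L(a ⊗ p)`. Then `m
R⁻¹` leaves right multiplication by `q` on the second leg, and `left_R` gives `(a ⊗ 1) R(p ⊗ q)`. -/
theorem mul_inverse_R (a : V) (u : CTensor V V) :
    map (BHom.id V) ((lift m).comp (R.inverse h.R_iso))
      (CTensor.assoc V V V (map (L.curry a) (BHom.id V) u)) = map (m a) (BHom.id V) u := by
  refine eq_of_surjective h.R_iso.1.2
    ((map (BHom.id V) ((lift m).comp (R.inverse h.R_iso))).comp
      ((CTensor.assoc V V V).comp (map (L.curry a) (BHom.id V)))) _ (fun p q => ?_) u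
  simp only [BHom.comp_apply]
  rw [h.coassoc, CTensor.map_map, h.left_R]
  congr 2
  ext y
  simp

/-- This identity forces the counit to exist: `c` is untouched on the right and `a` on the left, so
both sides must be a scalar, depending on `b` alone, times `a ⊗ c`. It is `mul_inverse_R` at `u = b
⊗ c`, with the resulting occurrence of `L(a ⊗ b)` replaced by an arbitrary tensor. -/
theorem tmul_mul_inverse (a b c : V) :
    tmul a (lift m (R.inverse h.R_iso (tmul b c))) =
      tmul (lift m (L.inverse h.L_iso (tmul a b))) c := by
  have key : ∀ v : CTensor V V, map (BHom.id V) ((lift m).comp (R.inverse h.R_iso))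
      (CTensor.assoc V V V (tmul v c)) = tmul (lift m (L.inverse h.L_iso v)) c := fun v => by
    refine eq_of_surjective h.L_iso.1.2
      ((((map (BHom.id V) ((lift m).comp (R.inverse h.R_iso))).comp
        (CTensor.assoc V V V)).curry).flip c)
      (((tmulHom V V).flip c).comp ((lift m).comp (L.inverse h.L_iso))) (fun a b => ?_) v
    have := h.mul_inverse_R a (tmul b c)
    simpa using this
  have := key (tmul a b)
  simpa using this

/-- The scalar in `tmul_mul_inverse` is isolated by placing `f₀` in one outer leg and applying `φ`
there. This first gives `m R⁻¹(b ⊗ c) = ε(b) c`, and then `m L⁻¹(a ⊗ b) = ε(b) a`. -/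
theorem exists_counit {φ : BHom V ℂ} {f₀ : V} (hφ : φ f₀ = 1) :
    ∃ ε : BHom V ℂ, (∀ x, idTensor V ε (L x) = lift m x) ∧
      ∀ x, tensorId V ε (R x) = lift m x := by
  let ε : BHom V ℂ := φ.comp ((lift m).comp ((L.inverse h.L_iso).comp (tmulHom V V f₀)))
  have hR : ∀ b c, lift m (R.inverse h.R_iso (tmul b c)) = ε b • c := fun b c => by
    have := congrArg (tensorId V φ) (h.tmul_mul_inverse f₀ b c)
    simpa [hφ, ε] using this
  have hL : ∀ a b, lift m (L.inverse h.L_iso (tmul a b)) = ε b • a := fun a b => by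
    have := congrArg (idTensor V φ) (h.tmul_mul_inverse a b f₀)
    rw [hR] at this
    simpa [hφ] using this.symm
  refine ⟨ε, fun x => ?_, fun x => ?_⟩
  · have := eq_of_tmul ((lift m).comp (L.inverse h.L_iso)) (idTensor V ε)
      (fun a b => by simp [hL]) (L x)
    simpa using this.symm
  · have := eq_of_tmul ((lift m).comp (R.inverse h.R_iso)) (tensorId V ε)
      (fun a b => by simp [hR]) (R x)
    simpa using this.symm

section Counit

variable {ε : BHom V ℂ} (hL : ∀ x, idTensor V ε (L x) = lift m x)
  (hR : ∀ x, tensorId V ε (R x) = lift m x)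

include hL in
-- On `w = L(a ⊗ b)` one has `D c w = L(a ⊗ bc)`, so the claim is `a(bc) = (ab)c`.
theorem counit_D (c : V) (w : CTensor V V) :
    idTensor V ε (D c w) = m (idTensor V ε w) c := by
  refine eq_of_surjective h.L_iso.1.2 ((idTensor V ε).comp (D c))
    ((BHom.flip m c).comp (idTensor V ε)) (fun a b => ?_) w
  simp only [BHom.comp_apply, BHom.flip_apply]
  rw [← h.L_mul, hL, hL, lift_tmul, lift_tmul, h.mul_assoc]

include hL in
-- On `L(p ⊗ c)`, multiplying the second leg by `q` produces `D c (p ⊗ q)`, to which `id ⊗ ε`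
-- assigns `ε(q) pc` by `counit_D`. Surjectivity of `L` extends this to `x ⊗ y`; a nonzero `x` can
-- then be cancelled.
theorem counit_mul [Nontrivial V] (q y : V) : ε (m q y) = ε q * ε y := by
  have key : ∀ w, idTensor V (ε.comp (m q)) w = ε q • idTensor V ε w := fun w => by
    refine eq_of_surjective h.L_iso.1.2 (idTensor V (ε.comp (m q)))
      (ε q • idTensor V ε) (fun p c => ?_) w
    have h1 := idTensor_map ε (BHom.id V) (m q) (L (tmul p c))
    rw [← h.D_tmul, h.counit_D hL, BHom.id_apply] at h1
    rw [← h1, BHom.smul_apply, hL]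
    simp
  obtain ⟨x, hx⟩ := exists_ne (0 : V)
  have := key (tmul x y)
  simp only [idTensor_tmul, BHom.comp_apply, smul_smul] at this
  exact smul_left_injective ℂ hx this

/-- `L` commutes with the slices of `R`. -/
theorem L_slice (η : BHom V ℂ) (c : V) (z : CTensor V V) :
    L (map (BHom.id V) ((idTensor V η).comp (BHom.flip R.curry c)) z) =
      map (BHom.id V) ((idTensor V η).comp (BHom.flip R.curry c)) (L z) := by
  refine eq_of_tmul (L.comp (map (BHom.id V) ((idTensor V η).comp (BHom.flip R.curry c))))
    ((map (BHom.id V) ((idTensor V η).comp (BHom.flip R.curry c))).comp L) (fun a b => ?_) z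
  have h1 := congrArg (map (BHom.id V) (idTensor V η)) (h.coassoc a b c)
  rw [map_id_idTensor_assoc, idTensor_map, CTensor.map_map] at h1
  simp only [BHom.comp_apply, map_tmul, BHom.id_apply, BHom.flip_apply, BHom.curry_apply]
  exact h1

theorem inverse_L_slice (η : BHom V ℂ) (c : V) (z : CTensor V V) :
    L.inverse h.L_iso (map (BHom.id V) ((idTensor V η).comp (BHom.flip R.curry c)) z) =
      map (BHom.id V) ((idTensor V η).comp (BHom.flip R.curry c)) (L.inverse h.L_iso z) := by
  apply h.L_iso.1.1
  rw [BHom.apply_inverse, h.L_slice, BHom.apply_inverse]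

include hR in
-- For `u = x ⊗ c` both sides equal `(id ⊗ η(· c)) L⁻¹(b ⊗ x)`. On the left, `b P(x ⊗ c)` is `D c (b
-- ⊗ x)` and the invariance of `η` applies; on the right, the slice by `η` commutes with `L⁻¹`. The
-- right-hand side depends on `u` only through `(id ⊗ η)R(u)`, which makes the antipode well
-- defined.
theorem mul_slice_P {η : BHom V ℂ} (hη : ∀ g f, idTensor V η (L (tmul g f)) = η f • g)
    (b : V) (u : CTensor V V) :
    m b (idTensor V η (P u)) = idTensor V ε (L.inverse h.L_iso (tmul b (idTensor V η (R u)))) := by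
  refine eq_of_tmul ((m b).comp ((idTensor V η).comp P))
    ((idTensor V ε).comp ((L.inverse h.L_iso).comp ((tmulHom V V b).comp
      ((idTensor V η).comp R)))) (fun x c => ?_) u
  simp only [BHom.comp_apply, tmulHom_apply]
  have h1 : ∀ w, idTensor V η (D c w) =
      idTensor V (η.comp (BHom.flip m c)) (L.inverse h.L_iso w) := fun w => by
    refine eq_of_surjective h.L_iso.1.2 ((idTensor V η).comp (D c))
      ((idTensor V (η.comp (BHom.flip m c))).comp (L.inverse h.L_iso)) (fun p q => ?_) w
    simp only [BHom.comp_apply]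
    rw [← h.L_mul, hη, BHom.inverse_apply, idTensor_tmul]
    rfl
  have h2 := idTensor_map η (m b) (BHom.id V) (P (tmul x c))
  rw [h.left_P, ← h.D_tmul, h1] at h2
  -- Both sides are `(ε ⊗ η) R(y ⊗ c)`, since `(ε ⊗ id) R(y ⊗ c) = yc`.
  have h3 : η.comp (BHom.flip m c) = ε.comp ((idTensor V η).comp (BHom.flip R.curry c)) := by
    ext y
    simp only [BHom.comp_apply, BHom.flip_apply, BHom.curry_apply]
    rw [apply_idTensor, hR, lift_tmul]
  have h4 := h.inverse_L_slice η c (tmul b x)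
  have h5 := idTensor_map ε (BHom.id V) ((idTensor V η).comp (BHom.flip R.curry c))
    (L.inverse h.L_iso (tmul b x))
  rw [← h4, ← h3, h2] at h5
  simpa using h5.symm

include hR in
-- The map is `x ↦ (id ⊗ φ) P R⁻¹(x ⊗ f₀)`: with `u = R⁻¹(x ⊗ f₀)` the slice `(id ⊗ φ)R(u)` is `x`,
-- and `mul_slice_P` applies.
theorem exists_antipode {φ : BHom V ℂ} {f₀ : V} (hf₀ : φ f₀ = 1)
    (hφ : ∀ g f, idTensor V φ (L (tmul g f)) = φ f • g) :
    ∃ S : BHom V V, ∀ b x, m b (S x) = idTensor V ε (L.inverse h.L_iso (tmul b x)) := by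
  refine ⟨(idTensor V φ).comp (P.comp ((R.inverse h.R_iso).comp ((tmulHom V V).flip f₀))),
    fun b x => ?_⟩
  have := h.mul_slice_P hR hφ b (R.inverse h.R_iso (tmul x f₀))
  simpa [hf₀] using this

variable {S : BHom V V}
  (hS : ∀ b x, m b (S x) = idTensor V ε (L.inverse h.L_iso (tmul b x)))

include hR hS in
/-- Strong left invariance. -/
theorem antipode_slice {η : BHom V ℂ} (hη : ∀ g f, idTensor V η (L (tmul g f)) = η f • g)
    (u : CTensor V V) : S (idTensor V η (R u)) = idTensor V η (P u) :=
  h.eq_of_nondeg fun b => by rw [hS, h.mul_slice_P hR hη]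

include hS in
theorem antipode_L (x : CTensor V V) :
    lift m (map (BHom.id V) S (L x)) = idTensor V ε x := by
  have := eq_of_tmul ((lift m).comp (map (BHom.id V) S))
    ((idTensor V ε).comp (L.inverse h.L_iso)) (fun b x => by simp [hS]) (L x)
  simpa using this

include hL hR hS in
-- This is the classical convolution argument, `a₁ S(a₂) a₃` computed in two ways. With `E = m(S ⊗
-- id)`, coassociativity and `antipode_L` give `m(id ⊗ E R(· ⊗ q)) w = (id ⊗ ε)(w) q` for `w` in the
-- range of `L`, hence for `w = b ⊗ y`; finally `b` is cancelled.
theorem antipode_R (x : CTensor V V) :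
    lift m (map S (BHom.id V) (R x)) = tensorId V ε x := by
  set E := (lift m).comp (map S (BHom.id V)) with hE
  have h1 : ∀ (v : CTensor V V) (z : V), lift m (map (BHom.id V) E (CTensor.assoc V V V
      (tmul v z))) = m (lift m (map (BHom.id V) S v)) z := fun v z => by
    refine eq_of_tmul (((lift m).comp ((map (BHom.id V) E).comp (CTensor.assoc V V V))).curry.flip z)
      ((BHom.flip m z).comp ((lift m).comp (map (BHom.id V) S))) (fun x y => ?_) v
    simp [hE, h.mul_assoc]
  have h2 : ∀ (a : V) (u : CTensor V V), lift m (map (BHom.id V) E (CTensor.assoc V V V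
      (map (L.curry a) (BHom.id V) u))) = m a (tensorId V ε u) := fun a u => by
    refine eq_of_tmul ((lift m).comp ((map (BHom.id V) E).comp ((CTensor.assoc V V V).comp
      (map (L.curry a) (BHom.id V))))) ((m a).comp (tensorId V ε)) (fun y z => ?_) u
    simp only [BHom.comp_apply, map_tmul, BHom.id_apply, BHom.curry_apply, h1]
    rw [h.antipode_L hS]
    simp
  have h3 : ∀ (q : V) (w : CTensor V V),
      lift m (map (BHom.id V) (E.comp (BHom.flip R.curry q)) w) = m (idTensor V ε w) q :=
    fun q w => by
      refine eq_of_surjective h.L_iso.1.2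
        ((lift m).comp (map (BHom.id V) (E.comp (BHom.flip R.curry q))))
        ((BHom.flip m q).comp (idTensor V ε)) (fun a p => ?_) w
      have h4 := h2 a (R (tmul p q))
      rw [h.coassoc, CTensor.map_map, hR, lift_tmul] at h4
      simp only [BHom.comp_apply, BHom.flip_apply]
      rw [hL, lift_tmul, h.mul_assoc]
      exact h4
  refine eq_of_tmul (E.comp R) (tensorId V ε) (fun y q => h.eq_of_nondeg fun b => ?_) x
  have := h3 q (tmul b y)
  simpa using this

include hL hS in
-- The claim follows from `m(id ⊗ S(q ·)) w = m(id ⊗ S)(w) S(q)` at `w = b ⊗ y`. On `w = L(p ⊗ z)`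
-- both sides are `ε(z) p S(q)`: the left-hand side is `m(id ⊗ S)` of `D z (p ⊗ q)`, and
-- multiplicativity of `ε` shows that `D z` contributes the factor `ε(z)`.
theorem antipode_mul [Nontrivial V] (q y : V) : S (m q y) = m (S y) (S q) := by
  have h1 : ∀ (z : V) (v : CTensor V V), lift m (map (BHom.id V) S (D z v)) =
      ε z • lift m (map (BHom.id V) S v) := fun z v => by
    refine eq_of_surjective h.L_iso.1.2 ((lift m).comp ((map (BHom.id V) S).comp (D z)))
      (ε z • (lift m).comp (map (BHom.id V) S)) (fun a b => ?_) v
    simp only [BHom.comp_apply, BHom.smul_apply]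
    rw [← h.L_mul, h.antipode_L hS, h.antipode_L hS, idTensor_tmul, idTensor_tmul,
      h.counit_mul hL, smul_smul, mul_comm]
  have h2 : ∀ w : CTensor V V, lift m (map (BHom.id V) (S.comp (m q)) w) =
      m (lift m (map (BHom.id V) S w)) (S q) := fun w => by
    refine eq_of_surjective h.L_iso.1.2 ((lift m).comp (map (BHom.id V) (S.comp (m q))))
      ((BHom.flip m (S q)).comp ((lift m).comp (map (BHom.id V) S))) (fun p z => ?_) w
    have h3 := h1 z (tmul p q)
    rw [h.D_tmul, CTensor.map_map] at h3
    simp only [BHom.comp_apply, BHom.flip_apply]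
    rw [h.antipode_L hS]
    simpa using! h3
  refine h.eq_of_nondeg fun b => ?_
  have := h2 (tmul b y)
  simpa [h.mul_assoc] using this

end Counit

end IsGaloisSystem

end GaloisSystem

open CTensor

/-! ## Multipliers and the Galois maps -/

section

variable {A K V W X : Type*}
  [NonUnitalRing K] [Module ℂ K] [IsScalarTower ℂ K K] [SMulCommClass ℂ K K]
  [Bornology K] [CompleteBornology K] [BornologicalAlgebra K]
  [AddCommGroup V] [Module ℂ V] [Bornology V] [CompleteBornology V]
  [AddCommGroup W] [Module ℂ W] [Bornology W] [CompleteBornology W]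
  [AddCommGroup X] [Module ℂ X] [Bornology X] [CompleteBornology X]

theorem Multiplier.of_left_apply (m : Multiplier K) (x : K) : of (m.left x) = m * of x :=
  Multiplier.ext (fun y => (m.left_mul' x y).symm) (fun y => m.compat y x)

theorem Multiplier.of_right_apply (m : Multiplier K) (x : K) : of (m.right x) = of x * m :=
  Multiplier.ext (fun y => (m.compat x y).symm) (fun y => (m.right_mul' y x).symm)

theorem Multiplier.of_mul (x y : K) : of (x * y) = of x * of y :=
  Multiplier.of_left_apply (of x) y

section

variable {A B : Type*}
  [NonUnitalRing A] [Module ℂ A] [IsScalarTower ℂ A A] [SMulCommClass ℂ A A]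
  [Bornology A] [CompleteBornology A] [BornologicalAlgebra A]
  [NonUnitalRing B] [Module ℂ B] [IsScalarTower ℂ B B] [SMulCommClass ℂ B B]
  [Bornology B] [CompleteBornology B] [BornologicalAlgebra B]

theorem Multiplier.of_tmul (p : A) (q : B) : Multiplier.of (tmul p q) =
    Multiplier.tensor (Multiplier.of p) 1 * Multiplier.tensor 1 (Multiplier.of q) := by
  refine Multiplier.ext (fun x => ?_) (fun x => ?_)
  · rw [Multiplier.of_left, tmul_mul, Multiplier.left_mul, Multiplier.tensor_left,
      Multiplier.tensor_left, CTensor.map_map]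
    rfl
  · rw [Multiplier.of_right, mul_tmul, Multiplier.right_mul, Multiplier.tensor_right,
      Multiplier.tensor_right, CTensor.map_map]
    rfl

theorem Multiplier.of_tmul' (p : A) (q : B) : Multiplier.of (tmul p q) =
    Multiplier.tensor 1 (Multiplier.of q) * Multiplier.tensor (Multiplier.of p) 1 := by
  refine Multiplier.ext (fun x => ?_) (fun x => ?_)
  · rw [Multiplier.of_left, tmul_mul, Multiplier.left_mul, Multiplier.tensor_left,
      Multiplier.tensor_left, CTensor.map_map]
    rfl
  · rw [Multiplier.of_right, mul_tmul, Multiplier.right_mul, Multiplier.tensor_right,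
      Multiplier.tensor_right, CTensor.map_map]
    rfl

end

theorem InducesIso.surjective {r : V → A → V} {l : A → W → W} {b : BHom V (BHom W X)}
    (h : InducesIso r l (fun v w => b v w)) : Function.Surjective (lift b) := by
  obtain ⟨e, he, h'⟩ := h
  have : lift b = e.comp (BalancedTensor.mk r l) := hom_ext fun v w => by simp [h']
  rw [this]
  exact he.1.2.comp (BQuot.mk_surjective _)

theorem assoc_mul_tmul {A B C : Type*}
    [NonUnitalRing A] [Module ℂ A] [IsScalarTower ℂ A A] [SMulCommClass ℂ A A]
    [Bornology A] [CompleteBornology A] [BornologicalAlgebra A]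
    [NonUnitalRing B] [Module ℂ B] [IsScalarTower ℂ B B] [SMulCommClass ℂ B B]
    [Bornology B] [CompleteBornology B] [BornologicalAlgebra B]
    [NonUnitalRing C] [Module ℂ C] [IsScalarTower ℂ C C] [SMulCommClass ℂ C C]
    [Bornology C] [CompleteBornology C] [BornologicalAlgebra C]
    (x : CTensor (CTensor A B) C) (a : A) (b : B) (c : C) :
    CTensor.assoc A B C (x * tmul (tmul a b) c) =
      CTensor.assoc A B C x * tmul a (tmul b c) := by
  rw [mul_tmul, mul_tmul]
  have h1 : BHom.flip (mulHom (CTensor A B)) (tmul a b) =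
      map (BHom.flip (mulHom A) a) (BHom.flip (mulHom B) b) := BHom.ext fun y => mul_tmul y a b
  have h2 : BHom.flip (mulHom (CTensor B C)) (tmul b c) =
      map (BHom.flip (mulHom B) b) (BHom.flip (mulHom C) c) := BHom.ext fun y => mul_tmul y b c
  rw [h1, h2, assoc_map]

end

/-! ### Nondegeneracy of a quantum group and of its tensor powers -/

namespace BornologicalQuantumGroup

variable {H : Type*}
  [NonUnitalRing H] [Module ℂ H] [IsScalarTower ℂ H H] [SMulCommClass ℂ H H]
  [Bornology H] [CompleteBornology H] [BornologicalAlgebra H] (Q : BornologicalQuantumGroup H)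

include Q

theorem eq_zero_of_mul_left {x : H} (hx : ∀ b, b * x = 0) : x = 0 :=
  Q.faithful.2 x fun f => by rw [hx, map_zero]

theorem eq_zero_of_mul_right {x : H} (hx : ∀ b, x * b = 0) : x = 0 :=
  Q.faithful.1 x fun f => by rw [hx, map_zero]

theorem eq_of_mul_left {x y : H} (h : ∀ b, b * x = b * y) : x = y :=
  sub_eq_zero.1 (Q.eq_zero_of_mul_left fun b => by rw [mul_sub, h, sub_self])

theorem eq_of_mul_right {x y : H} (h : ∀ b, x * b = y * b) : x = y :=
  sub_eq_zero.1 (Q.eq_zero_of_mul_right fun b => by rw [sub_mul, h, sub_self])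

theorem hasSeparatingDual : HasSeparatingDual H := fun x hx =>
  Q.faithful.1 x fun g => hx (Q.φ.comp (BHom.flip (mulHom H) g))

theorem mul_surjective : Function.Surjective (lift (mulHom H)) :=
  InducesIso.surjective (b := mulHom H) Q.essential

theorem exists_φ_eq_one : ∃ f₀, Q.φ f₀ = 1 := by
  obtain ⟨x, hx⟩ := @exists_ne H Q.nontrivial 0
  have : ∃ g, Q.φ (x * g) ≠ 0 := by
    by_contra! h
    exact hx (Q.faithful.1 x h)
  obtain ⟨g, hg⟩ := this
  exact ⟨(Q.φ (x * g))⁻¹ • (x * g), by rw [map_smul, smul_eq_mul, inv_mul_cancel₀ hg]⟩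

theorem tensor_eq_zero_of_mul {x : CTensor H H} (hx : ∀ y, x * y = 0) : x = 0 :=
  Q.approximation.eq_zero_of_mul_tmul Q.hasSeparatingDual (fun _ h => Q.eq_zero_of_mul_right h)
    (fun _ h => Q.eq_zero_of_mul_right h) fun _ _ => hx _

theorem tensor_eq_zero_of_mul' {x : CTensor H H} (hx : ∀ y, y * x = 0) : x = 0 :=
  Q.approximation.eq_zero_of_tmul_mul Q.hasSeparatingDual (fun _ h => Q.eq_zero_of_mul_left h)
    (fun _ h => Q.eq_zero_of_mul_left h) fun _ _ => hx _

/-- As `H ⊗̂ H` acts faithfully on itself, equations between values of Galois maps may be checked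
among multipliers, where `Δ` is multiplicative and the defining formulas hold. -/
theorem of_injective {x y : CTensor H H} (h : Multiplier.of x = Multiplier.of y) : x = y :=
  sub_eq_zero.1 (Q.tensor_eq_zero_of_mul fun z => by
    have := congrArg (fun m => Multiplier.left m z) h
    simp only [Multiplier.of_left] at this
    rw [sub_mul, this, sub_self])

/-- Jointly on all three legs, multiplications from the right are injective. -/
theorem tensor₃_ext {x y : CTensor H (CTensor H H)}
    (h : ∀ a b c, x * tmul a (tmul b c) = y * tmul a (tmul b c)) : x = y := by
  refine sub_eq_zero.1 (Q.approximation.eq_zero_of_mul_tmul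
    (Q.approximation.hasSeparatingDual_tensor Q.hasSeparatingDual)
    (fun _ h => Q.eq_zero_of_mul_right h) (fun _ h => Q.tensor_eq_zero_of_mul h) fun a z => ?_)
  refine eq_of_tmul ((mulHom _ (x - y)).comp (tmulHom _ _ a)) 0 (fun b c => ?_) z
  simp only [BHom.comp_apply, tmulHom_apply, mulHom_apply, BHom.zero_apply]
  rw [sub_mul, h, sub_self]

/-! ### Relations between the Galois maps -/

/-- Both sides are `(a ⊗ 1) Δ(p) (1 ⊗ q)`, bracketed in two ways. The next relations have the same
origin, with other legs. -/
theorem ρl_mul_right (a p q : H) : map (mulHom H a) (BHom.id H) (Q.γr (tmul p q)) =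
    map (BHom.id H) (BHom.flip (mulHom H) q) (Q.ρl (tmul a p)) := by
  refine Q.of_injective ?_
  have h1 := Multiplier.of_left_apply (Multiplier.tensor (Multiplier.of a) 1) (Q.γr (tmul p q))
  have h2 := Multiplier.of_right_apply (Multiplier.tensor 1 (Multiplier.of q)) (Q.ρl (tmul a p))
  rw [Q.γr_spec, ← mul_assoc, ← Q.ρl_spec, ← h2] at h1
  exact h1

theorem ρr_mul_right (a p q : H) : map (BHom.id H) (mulHom H a) (Q.γl (tmul p q)) =
    map (BHom.flip (mulHom H) q) (BHom.id H) (Q.ρr (tmul a p)) := by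
  refine Q.of_injective ?_
  have h1 := Multiplier.of_left_apply (Multiplier.tensor 1 (Multiplier.of a)) (Q.γl (tmul p q))
  have h2 := Multiplier.of_right_apply (Multiplier.tensor (Multiplier.of q) 1) (Q.ρr (tmul a p))
  rw [Q.γl_spec, ← mul_assoc, ← Q.ρr_spec, ← h2] at h1
  exact h1

theorem ρl_mul_right' (a p q : H) : map (mulHom H a) (BHom.id H) (Q.γl (tmul p q)) =
    map (BHom.flip (mulHom H) q) (BHom.id H) (Q.ρl (tmul a p)) := by
  refine Q.of_injective ?_
  have h1 := Multiplier.of_left_apply (Multiplier.tensor (Multiplier.of a) 1) (Q.γl (tmul p q))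
  have h2 := Multiplier.of_right_apply (Multiplier.tensor (Multiplier.of q) 1) (Q.ρl (tmul a p))
  rw [Q.γl_spec, ← mul_assoc, ← Q.ρl_spec, ← h2] at h1
  exact h1

theorem ρr_mul_right' (a p q : H) : map (BHom.id H) (mulHom H a) (Q.γr (tmul p q)) =
    map (BHom.id H) (BHom.flip (mulHom H) q) (Q.ρr (tmul a p)) := by
  refine Q.of_injective ?_
  have h1 := Multiplier.of_left_apply (Multiplier.tensor 1 (Multiplier.of a)) (Q.γr (tmul p q))
  have h2 := Multiplier.of_right_apply (Multiplier.tensor 1 (Multiplier.of q)) (Q.ρr (tmul a p))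
  rw [Q.γr_spec, ← mul_assoc, ← Q.ρr_spec, ← h2] at h1
  exact h1

theorem Δ_right_tmul (c p q : H) : (Q.Δ c).right (tmul p q) =
    map (BHom.id H) (mulHom H q) (Q.ρl (tmul p c)) := by
  refine Q.of_injective ?_
  have h1 := Multiplier.of_left_apply (Multiplier.tensor 1 (Multiplier.of q)) (Q.ρl (tmul p c))
  rw [Multiplier.of_right_apply, Multiplier.of_tmul', mul_assoc, ← Q.ρl_spec]
  exact h1.symm

theorem Δ_right_tmul' (c p q : H) : (Q.Δ c).right (tmul p q) =
    map (mulHom H p) (BHom.id H) (Q.ρr (tmul q c)) := by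
  refine Q.of_injective ?_
  have h1 := Multiplier.of_left_apply (Multiplier.tensor (Multiplier.of p) 1) (Q.ρr (tmul q c))
  rw [Multiplier.of_right_apply, Multiplier.of_tmul, mul_assoc, ← Q.ρr_spec]
  exact h1.symm

theorem Δ_left_tmul (c p q : H) : (Q.Δ c).left (tmul p q) =
    map (BHom.id H) (BHom.flip (mulHom H) q) (Q.γl (tmul c p)) := by
  refine Q.of_injective ?_
  have h1 := Multiplier.of_right_apply (Multiplier.tensor 1 (Multiplier.of q)) (Q.γl (tmul c p))
  rw [Multiplier.of_left_apply, Multiplier.of_tmul, ← mul_assoc, ← Q.γl_spec]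
  exact h1.symm

theorem Δ_left_tmul' (c p q : H) : (Q.Δ c).left (tmul p q) =
    map (BHom.flip (mulHom H) p) (BHom.id H) (Q.γr (tmul c q)) := by
  refine Q.of_injective ?_
  have h1 := Multiplier.of_right_apply (Multiplier.tensor (Multiplier.of p) 1) (Q.γr (tmul c q))
  rw [Multiplier.of_left_apply, Multiplier.of_tmul', ← mul_assoc, ← Q.γr_spec]
  exact h1.symm

theorem ρl_mul_ρr (b x c : H) : map (mulHom H b) (BHom.id H) (Q.ρr (tmul x c)) =
    map (BHom.id H) (mulHom H x) (Q.ρl (tmul b c)) := by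
  rw [← Δ_right_tmul, Δ_right_tmul']

theorem γr_mul_γl (b x c : H) : map (BHom.flip (mulHom H) b) (BHom.id H) (Q.γr (tmul c x)) =
    map (BHom.id H) (BHom.flip (mulHom H) x) (Q.γl (tmul c b)) := by
  rw [← Δ_left_tmul, Δ_left_tmul']

theorem ρl_tmul_mul (a b c : H) : Q.ρl (tmul a (b * c)) = (Q.Δ c).right (Q.ρl (tmul a b)) :=
  Q.of_injective (by rw [Multiplier.of_right_apply, Q.ρl_spec, Q.ρl_spec, map_mul, mul_assoc])

theorem ρr_tmul_mul (a b c : H) : Q.ρr (tmul a (b * c)) = (Q.Δ c).right (Q.ρr (tmul a b)) :=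
  Q.of_injective (by rw [Multiplier.of_right_apply, Q.ρr_spec, Q.ρr_spec, map_mul, mul_assoc])

theorem γl_mul_tmul (a b c : H) : Q.γl (tmul (c * b) a) = (Q.Δ c).left (Q.γl (tmul b a)) :=
  Q.of_injective (by rw [Multiplier.of_left_apply, Q.γl_spec, Q.γl_spec, map_mul, mul_assoc])

theorem γr_mul (b c : H) (x : CTensor H H) :
    Q.γr (tmul b c) * x = (Q.Δ b).left (map (BHom.id H) (mulHom H c) x) :=
  congrArg (fun m => Multiplier.left m x) (Q.γr_spec b c)

theorem mul_ρl (a b : H) (x : CTensor H H) :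
    x * Q.ρl (tmul a b) = (Q.Δ b).right (map (BHom.flip (mulHom H) a) (BHom.id H) x) :=
  congrArg (fun m => Multiplier.right m x) (Q.ρl_spec a b)

theorem ρl_mul (a b : H) (x : CTensor H H) :
    Q.ρl (tmul a b) * x = map (mulHom H a) (BHom.id H) ((Q.Δ b).left x) :=
  congrArg (fun m => Multiplier.left m x) (Q.ρl_spec a b)

/-! ### Coassociativity in terms of the Galois maps -/

theorem Δ_left_surjective : Function.Surjective (lift Q.Δ.leftHom) := Q.essential_Δ.1.surjective

theorem Δ_right_surjective : Function.Surjective (lift (BHom.flip Q.Δ.rightHom)) :=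
  InducesIso.surjective (b := BHom.flip Q.Δ.rightHom) Q.essential_Δ.2

/-- As `Δ` is essential, the elements `x Δ(v)` generate `H ⊗̂ H`, and `(x Δ(v)) y = x (Δ(v) y) = 0`;
so `y` is annihilated by all left multiplications. -/
theorem eq_zero_of_Δ_left {y : CTensor H H} (h : ∀ v, (Q.Δ v).left y = 0) : y = 0 := by
  refine Q.tensor_eq_zero_of_mul' fun z => ?_
  refine eq_of_surjective Q.Δ_right_surjective (BHom.flip (mulHom _) y) 0 (fun x v => ?_) z
  simp only [lift_tmul, BHom.flip_apply, mulHom_apply, MultHom.rightHom_apply, BHom.zero_apply]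
  rw [← Multiplier.compat, h, mul_zero]

variable {F : Multiplier (CTensor H H) →ₐ[ℂ] Multiplier (CTensor (CTensor H H) H)}
  {G : Multiplier (CTensor H H) →ₐ[ℂ] Multiplier (CTensor H (CTensor H H))}

/-- In multipliers: `F(Δ(b)) (1 ⊗ c) = (Δ ⊗ id)(Δ(b)(1 ⊗ c))`. An extension is known only on
elements of the algebra, so one applies `F` to `Δ(b)(u ⊗ cc')` and lets it act. This proves the
formula on vectors `Δ(u)y ⊗ c'd`, which suffice because `Δ` and `H` are essential. -/
theorem extension_left_apply (hF : (MultHom.tensor Q.Δ (MultHom.incl H)).IsExtension F)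
    (b c : H) (Y : CTensor H H) (e : H) : (F (Q.Δ b)).left (tmul Y (c * e)) =
      (MultHom.tensor Q.Δ (MultHom.incl H) (Q.γr (tmul b c))).left (tmul Y e) := by
  have h1 : ∀ (u c' : H) (y : CTensor H H) (d : H),
      (F (Q.Δ b)).left (tmul ((Q.Δ u).left y) (c * (c' * d))) =
      (MultHom.tensor Q.Δ (MultHom.incl H) (Q.γr (tmul b c))).left
        (tmul ((Q.Δ u).left y) (c' * d)) := fun u c' y d => by
    have h2 : Q.Δ b * Multiplier.of (tmul u (c * c')) =
        Multiplier.of (Q.γr (tmul b c)) * Multiplier.of (tmul u c') := by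
      rw [← Multiplier.of_mul, γr_mul, Multiplier.of_left_apply]
      simp
    have h3 := congrArg (fun m => Multiplier.left (F m) (tmul y d)) h2
    simp only [map_mul, hF.2, MultHom.tensor_tmul, Multiplier.left_mul, Multiplier.tensor_left,
      map_tmul, MultHom.incl_apply, Multiplier.of_left] at h3
    exact h3
  refine eq_of_surjective Q.mul_surjective
    ((F (Q.Δ b)).left.comp ((tmulHom _ _ Y).comp (mulHom H c)))
    ((MultHom.tensor Q.Δ (MultHom.incl H) (Q.γr (tmul b c))).left.comp (tmulHom _ _ Y))
    (fun c' d => ?_) e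
  simp only [lift_tmul, BHom.comp_apply, mulHom_apply, tmulHom_apply]
  refine eq_of_surjective Q.Δ_left_surjective
    ((F (Q.Δ b)).left.comp ((tmulHom _ _).flip (c * (c' * d))))
    ((MultHom.tensor Q.Δ (MultHom.incl H) (Q.γr (tmul b c))).left.comp
      ((tmulHom _ _).flip (c' * d))) (fun u y => ?_) Y
  simpa using h1 u c' y d

/-- In multipliers: `(a ⊗ 1) G(Δ(b)) = (id ⊗ Δ)((a ⊗ 1)Δ(b))`. Multiplying by `a' ⊗ Δ(v)` from the
left puts everything inside `G` of an element of the algebra, and these multiplications are jointly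
injective. -/
theorem map_extension_left_apply (hG : (MultHom.tensor (MultHom.incl H) Q.Δ).IsExtension G)
    (a b : H) (Z : CTensor H (CTensor H H)) :
    map (mulHom H a) (BHom.id _) ((G (Q.Δ b)).left Z) =
      (MultHom.tensor (MultHom.incl H) Q.Δ (Q.ρl (tmul a b))).left Z := by
  have h1 : ∀ a' v : H, map (mulHom H a') (Q.Δ v).left
      (map (mulHom H a) (BHom.id _) ((G (Q.Δ b)).left Z)) = map (mulHom H a') (Q.Δ v).left
      ((MultHom.tensor (MultHom.incl H) Q.Δ (Q.ρl (tmul a b))).left Z) := fun a' v => by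
    have h2 : Multiplier.of (tmul (a' * a) v) * Q.Δ b =
        Multiplier.of (tmul a' v) * Multiplier.of (Q.ρl (tmul a b)) := by
      rw [← Multiplier.of_mul, mul_ρl, Multiplier.of_right_apply]
      simp
    have h3 := congrArg (fun m => Multiplier.left (G m) Z) h2
    simp only [map_mul, hG.2, MultHom.tensor_tmul, Multiplier.left_mul, Multiplier.tensor_left,
      MultHom.incl_apply] at h3
    rw [CTensor.map_map]
    refine Eq.trans ?_ h3
    congr 2
  refine sub_eq_zero.1 ?_
  refine Q.approximation.map_id_eq_zero (f := fun v => (Q.Δ v).left)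
    (fun _ h => Q.eq_zero_of_Δ_left h) fun v => ?_
  refine Q.approximation.map_eq_zero
    (Q.approximation.hasSeparatingDual_tensor Q.hasSeparatingDual) (f := fun a => mulHom H a)
    (fun _ h => Q.eq_zero_of_mul_left h) fun a' => ?_
  rw [CTensor.map_map, BHom.comp_id, BHom.id_comp, map_sub, sub_eq_zero]
  exact h1 a' v

/-- Both sides are `(a ⊗ 1 ⊗ 1) Δ²(b) (1 ⊗ 1 ⊗ c)`. They are compared after right multiplication by
elementary tensors, where the two extension formulas and `IsCoassociative` apply. -/
theorem ρl_γr_comm (a b c : H) :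
    CTensor.assoc H H H (map (Q.ρl.curry a) (BHom.id H) (Q.γr (tmul b c))) =
      map (BHom.id H) (BHom.flip Q.γr.curry c) (Q.ρl (tmul a b)) := by
  obtain ⟨F, G, hF, hG, hFG⟩ := Q.coassociative
  refine Q.tensor₃_ext fun y₁ y₂ e => ?_
  have h1 : map (map (mulHom H a) (BHom.id H)) (BHom.id H)
      ((MultHom.tensor Q.Δ (MultHom.incl H) (Q.γr (tmul b c))).left (tmul (tmul y₁ y₂) e)) =
      map (Q.ρl.curry a) (BHom.id H) (Q.γr (tmul b c)) * tmul (tmul y₁ y₂) e := by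
    refine eq_of_tmul ((map (map (mulHom H a) (BHom.id H)) (BHom.id H)).comp
      ((BHom.eval (tmul (tmul y₁ y₂) e)).comp
        (MultHom.tensor Q.Δ (MultHom.incl H)).leftHom))
      ((BHom.flip (mulHom _) (tmul (tmul y₁ y₂) e)).comp
        (map (Q.ρl.curry a) (BHom.id H))) (fun x y => ?_) _
    simp [MultHom.tensor_tmul, ρl_mul]
  have h2 : (MultHom.tensor (MultHom.incl H) Q.Δ (Q.ρl (tmul a b))).left
      (tmul y₁ (tmul y₂ (c * e))) =
      map (BHom.id H) (BHom.flip Q.γr.curry c) (Q.ρl (tmul a b)) * tmul y₁ (tmul y₂ e) := by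
    refine eq_of_tmul ((BHom.eval (tmul y₁ (tmul y₂ (c * e)))).comp
        (MultHom.tensor (MultHom.incl H) Q.Δ).leftHom)
      ((BHom.flip (mulHom _) (tmul y₁ (tmul y₂ e))).comp
        (map (BHom.id H) (BHom.flip Q.γr.curry c))) (fun x y => ?_) _
    simp [MultHom.tensor_tmul, γr_mul]
  rw [← assoc_mul_tmul, ← h1, ← Q.extension_left_apply hF, assoc_map, (hFG b _).1, map_id_id,
    Q.map_extension_left_apply hG, assoc_tmul, h2]

end BornologicalQuantumGroup

/-! ### Isomorphisms and balanced tensor products -/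

section

variable {V W X : Type*}
  [AddCommGroup V] [Module ℂ V] [Bornology V] [CompleteBornology V]
  [AddCommGroup W] [Module ℂ W] [Bornology W] [CompleteBornology W]
  [AddCommGroup X] [Module ℂ X] [Bornology X] [CompleteBornology X]

theorem IsBornIso.comp {g : BHom W X} {f : BHom V W} (hg : IsBornIso g) (hf : IsBornIso f) :
    IsBornIso (g.comp f) :=
  isBornIso_of_inverse _ ((f.inverse hf).comp (g.inverse hg)) (fun x => by simp)
    (fun y => by simp)

/-- A bounded linear map which vanishes on `R` factors through the quotient. -/
def BQuot.lift {R : Submodule ℂ V} (f : BHom V X) (hf : R ≤ LinearMap.ker f.toLin) :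
    BHom (BQuot R) X :=
  BHom.mk ((bornClosure R).liftQ f.toLin (bornClosure_le (isBornClosed_ker f) hf))
    (fun s hs => by
      obtain ⟨t, ht, h⟩ := (BQuot.isBounded_iff _).1 hs
      refine (f.bounded t ht).subset ?_
      rintro _ ⟨x, hx, rfl⟩
      obtain ⟨c, hc, rfl⟩ := h hx
      exact ⟨c, hc, rfl⟩)

/-- A criterion for a bilinear map to induce an isomorphism on the balanced tensor product. -/
theorem InducesIso.of_inverse {A : Type*} {r : V → A → V} {l : A → W → W} (f : BHom (CTensor V W) X)
    (hf : ∀ v a w, f (tmul (r v a) w) = f (tmul v (l a w)))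
    (g : BHom X (CTensor V W)) (hfg : ∀ x, f (g x) = x)
    (hgf : ∀ v w, BalancedTensor.mk r l (g (f (tmul v w))) = BalancedTensor.mk r l (tmul v w)) :
    InducesIso r l (fun v w => f (tmul v w)) := by
  have hker : Submodule.span ℂ {x : CTensor V W | ∃ v a w,
      x = tmul (r v a) w - tmul v (l a w)} ≤ LinearMap.ker f.toLin := by
    refine Submodule.span_le.2 ?_
    rintro _ ⟨v, a, w, rfl⟩
    rw [SetLike.mem_coe, LinearMap.mem_ker, BHom.toLin_apply, map_sub, hf, sub_self]
  let e : BHom (BalancedTensor r l) X := BQuot.lift f hker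
  have he : ∀ x, e (BalancedTensor.mk r l x) = f x := fun x => rfl
  refine ⟨e, isBornIso_of_inverse e ((BalancedTensor.mk r l).comp g) (fun x => ?_) (fun y => ?_),
    fun v w => he _⟩
  · obtain ⟨x, rfl⟩ := BQuot.mk_surjective _ x
    exact eq_of_tmul ((BalancedTensor.mk r l).comp (g.comp f)) (BalancedTensor.mk r l) hgf x
  · rw [BHom.comp_apply, he, hfg]

theorem BalancedTensor.mk_eq {A : Type*} (r : V → A → V) (l : A → W → W) (v : V) (a : A) (w : W) :
    BalancedTensor.mk r l (tmul (r v a) w) = BalancedTensor.mk r l (tmul v (l a w)) := by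
  refine sub_eq_zero.1 ?_
  rw [← map_sub]
  exact (BQuot.mk_eq_zero _).2 (le_bornClosure _ (Submodule.subset_span ⟨v, a, w, rfl⟩))

/-- The flip map followed by `S` on both factors. -/
def antiTensor (S : BHom V W) : BHom (CTensor V V) (CTensor W W) :=
  (map S S).comp (flip V V)

@[simp] theorem antiTensor_tmul (S : BHom V W) (x y : V) :
    antiTensor S (tmul x y) = tmul (S y) (S x) := by simp [antiTensor]

end

/-! ### Galois systems, counit and antipode of a quantum group -/

namespace BornologicalQuantumGroup

variable {H : Type*}
  [NonUnitalRing H] [Module ℂ H] [IsScalarTower ℂ H H] [SMulCommClass ℂ H H]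
  [Bornology H] [CompleteBornology H] [BornologicalAlgebra H] (Q : BornologicalQuantumGroup H)

include Q

theorem γl_mul (b c : H) (x : CTensor H H) :
    Q.γl (tmul b c) * x = (Q.Δ b).left (map (mulHom H c) (BHom.id H) x) :=
  congrArg (fun m => Multiplier.left m x) (Q.γl_spec b c)

theorem mul_ρr (a b : H) (x : CTensor H H) :
    x * Q.ρr (tmul a b) = (Q.Δ b).right (map (BHom.id H) (BHom.flip (mulHom H) a) x) :=
  congrArg (fun m => Multiplier.right m x) (Q.ρr_spec a b)

theorem map_mul_left_injective {W : Type*} [AddCommGroup W] [Module ℂ W] [Bornology W]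
    [CompleteBornology W] (hW : HasSeparatingDual W) {x y : CTensor H W}
    (h : ∀ p, map (mulHom H p) (BHom.id W) x = map (mulHom H p) (BHom.id W) y) : x = y :=
  sub_eq_zero.1 (Q.approximation.map_eq_zero hW (f := fun p => mulHom H p)
    (fun _ h => Q.eq_zero_of_mul_left h) fun p => by rw [map_sub, h, sub_self])

/-- Both sides are `(p ⊗ 1 ⊗ x) Δ²(c)`. Right multiplication by `q` on the third leg is jointly
injective and replaces `ρ_r(x ⊗ c)(1 ⊗ q)` by `(1 ⊗ x)γ_r(c ⊗ q)`, which reduces the claim to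
`ρl_γr_comm`. -/
theorem ρl_ρr_comm (p x c : H) :
    CTensor.assoc H H H (map (Q.ρl.curry p) (BHom.id H) (Q.ρr (tmul x c))) =
      map (BHom.id H) (Q.ρr.curry x) (Q.ρl (tmul p c)) := by
  refine sub_eq_zero.1 (Q.approximation.map_id_eq_zero
    (f := fun q => map (BHom.id H) (BHom.flip (mulHom H) q)) (fun w hw =>
      Q.approximation.map_id_eq_zero (f := fun q => BHom.flip (mulHom H) q)
        (fun _ h => Q.eq_zero_of_mul_right h) hw) fun q => ?_)
  rw [map_sub, sub_eq_zero, ← assoc_map, CTensor.map_map, CTensor.map_map, map_id_id]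
  have h1 : map (Q.ρl.curry p) (BHom.flip (mulHom H) q) (Q.ρr (tmul x c)) =
      map (map (BHom.id H) (BHom.id H)) (mulHom H x)
        (map (Q.ρl.curry p) (BHom.id H) (Q.γr (tmul c q))) := by
    have := congrArg (map (Q.ρl.curry p) (BHom.id H)) (Q.ρr_mul_right' x c q)
    rw [CTensor.map_map, CTensor.map_map] at this
    rw [CTensor.map_map, map_id_id]
    exact this.symm
  have h2 : (map (BHom.id H) (BHom.flip (mulHom H) q)).comp (Q.ρr.curry x) =
      (map (BHom.id H) (mulHom H x)).comp (BHom.flip Q.γr.curry q) :=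
    BHom.ext fun y => (Q.ρr_mul_right' x y q).symm
  simp only [BHom.comp_id, BHom.id_comp]
  rw [h1, assoc_map, Q.ρl_γr_comm, CTensor.map_map, BHom.comp_id, h2]

/-- Both sides are `(1 ⊗ 1 ⊗ c) Δ²(b) (a ⊗ 1 ⊗ 1)`. Left multiplication by `p` on the first leg
converts `γ_l` into `ρ_l` and reduces the claim to `ρl_ρr_comm`. It is the coassociativity needed
for the opposite algebra. -/
theorem γl_ρr_comm (a b c : H) :
    CTensor.assoc H H H (map (BHom.flip Q.γl.curry a) (BHom.id H) (Q.ρr (tmul c b))) =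
      map (BHom.id H) (Q.ρr.curry c) (Q.γl (tmul b a)) := by
  refine Q.map_mul_left_injective
    (Q.approximation.hasSeparatingDual_tensor Q.hasSeparatingDual) fun p => ?_
  rw [← map_id_id, ← assoc_map, CTensor.map_map, CTensor.map_map, map_id_id]
  have h1 : (map (mulHom H p) (BHom.id H)).comp (BHom.flip Q.γl.curry a) =
      (map (BHom.flip (mulHom H) a) (BHom.id H)).comp (Q.ρl.curry p) :=
    BHom.ext fun y => Q.ρl_mul_right' p y a
  have h2 := congrArg (map (BHom.id H) (Q.ρr.curry c)) (Q.ρl_mul_right' p b a)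
  have h3 := congrArg (map (BHom.flip (mulHom H) a) (BHom.id (CTensor H H)))
    (Q.ρl_ρr_comm p c b)
  rw [← map_id_id, ← assoc_map, CTensor.map_map, CTensor.map_map, map_id_id] at h3
  rw [CTensor.map_map, CTensor.map_map] at h2
  simp only [BHom.comp_id, BHom.id_comp] at h2 h3 ⊢
  rw [h1, h3, h2]

theorem ρl_slice (η : BHom H ℂ) (p x c : H) : Q.ρl (tmul p (idTensor H η (Q.ρr (tmul x c)))) =
    map (BHom.id H) ((idTensor H η).comp (Q.ρr.curry x)) (Q.ρl (tmul p c)) := by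
  have h1 := congrArg (map (BHom.id H) (idTensor H η)) (Q.ρl_ρr_comm p x c)
  rw [map_id_idTensor_assoc, idTensor_map, CTensor.map_map] at h1
  exact h1

theorem galoisSystem : IsGaloisSystem (mulHom H) Q.ρl Q.γr Q.ρr (fun c => (Q.Δ c).right) where
  L_iso := Q.ρl_iso
  R_iso := Q.γr_iso
  mul_assoc := mul_assoc
  nondeg_left _ hx := Q.eq_zero_of_mul_left hx
  left_R := Q.ρl_mul_right
  left_P := Q.ρl_mul_ρr
  D_tmul := Q.Δ_right_tmul
  L_mul := Q.ρl_tmul_mul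
  coassoc := Q.ρl_γr_comm

/-- Reversing the product exchanges `ρ_l` with `γ_l` and `γ_r` with `ρ_r`; the flips restore the
order of the arguments. The antipode of this system will be the inverse of `S`. -/
theorem galoisSystem_op : IsGaloisSystem (BHom.flip (mulHom H)) (Q.γl.comp (flip H H))
    (Q.ρr.comp (flip H H)) (Q.γr.comp (flip H H)) (fun c => (Q.Δ c).left) where
  L_iso := Q.γl_iso.comp (isBornIso_flip H H)
  R_iso := Q.ρr_iso.comp (isBornIso_flip H H)
  mul_assoc a b c := (mul_assoc c b a).symm
  nondeg_left _ hx := Q.eq_zero_of_mul_right hx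
  left_R a p q := by simpa using! (Q.ρr_mul_right q p a).symm
  left_P b x c := by simpa using! Q.γr_mul_γl b x c
  D_tmul c p q := by simpa using! Q.Δ_left_tmul c p q
  L_mul a b c := by simpa using! Q.γl_mul_tmul a b c
  coassoc a b c := by
    have h1 : (Q.γl.comp (flip H H)).curry a = BHom.flip Q.γl.curry a := by ext; simp
    have h2 : BHom.flip (Q.ρr.comp (flip H H)).curry c = Q.ρr.curry c := by ext; simp
    rw [h1, h2]
    simpa using Q.γl_ρr_comm a b c

/-- `η` is a left invariant functional. -/
def IsLeftInvariant (η : BHom H ℂ) : Prop := ∀ g f, idTensor H η (Q.ρl (tmul g f)) = η f • g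

/-- The properties of a counit `ε` and an invertible antipode `S` on which everything else is
based. -/
structure IsHopf (ε : BHom H ℂ) (S T : BHom H H) : Prop where
  counit_ρl : ∀ x, idTensor H ε (Q.ρl x) = lift (mulHom H) x
  counit_γr : ∀ x, tensorId H ε (Q.γr x) = lift (mulHom H) x
  counit_mul : ∀ f g, ε (f * g) = ε f * ε g
  antipode_ρl : ∀ x, lift (mulHom H) (map (BHom.id H) S (Q.ρl x)) = idTensor H ε x
  antipode_γr : ∀ x, lift (mulHom H) (map S (BHom.id H) (Q.γr x)) = tensorId H ε x
  antipode_mul : ∀ f g, S (f * g) = S g * S f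
  slice : ∀ η, Q.IsLeftInvariant η → ∀ u, S (idTensor H η (Q.γr u)) = idTensor H η (Q.ρr u)
  left_inv : ∀ x, T (S x) = x
  right_inv : ∀ x, S (T x) = x

theorem isLeftInvariant_φ : Q.IsLeftInvariant Q.φ := fun g f => (Q.leftInvariant f g).2

/-- The antipodes `S` of `H` and `T` of its opposite satisfy `S((id ⊗ φ)γ_r u) = (id ⊗ φ)ρ_r u` and
the reversed formula. Slices of either kind exhaust `H`, because the Galois maps are onto and `φ f₀
= 1`; hence `S` and `T` are mutually inverse. -/
theorem exists_isHopf : ∃ ε S T, Q.IsHopf ε S T := by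
  have := Q.nontrivial
  obtain ⟨f₀, hf₀⟩ := Q.exists_φ_eq_one
  have h := Q.galoisSystem
  have h' := Q.galoisSystem_op
  have hφ' : ∀ g f, idTensor H Q.φ ((Q.γl.comp (flip H H)) (tmul g f)) = Q.φ f • g := fun g f => by
    simpa using (Q.leftInvariant f g).1
  obtain ⟨ε, hL, hR⟩ := h.exists_counit hf₀
  obtain ⟨S, hS⟩ := h.exists_antipode hR hf₀ Q.isLeftInvariant_φ
  obtain ⟨ε', hL', hR'⟩ := h'.exists_counit hf₀
  obtain ⟨T, hT⟩ := h'.exists_antipode hR' hf₀ hφ'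
  have h1 := fun u => h.antipode_slice hR hS Q.isLeftInvariant_φ u
  have h2 := fun u => h'.antipode_slice hR' hT hφ' u
  have h2' : ∀ u, T (idTensor H Q.φ (Q.ρr u)) = idTensor H Q.φ (Q.γr u) := fun u => by
    simpa using h2 (flip H H u)
  refine ⟨ε, S, T, hL, hR, h.counit_mul hL, h.antipode_L hS, h.antipode_R hL hR hS,
    h.antipode_mul hL hS, fun η hη u => h.antipode_slice hR hS hη u, fun x => ?_, fun x => ?_⟩
  · have h3 : x = idTensor H Q.φ (Q.γr (Q.γr.inverse Q.γr_iso (tmul x f₀))) := by simp [hf₀]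
    rw [h3, h1, h2']
  · have h3 : x = idTensor H Q.φ (Q.ρr (Q.ρr.inverse Q.ρr_iso (tmul x f₀))) := by simp [hf₀]
    rw [h3, h2', h1]

/-! ### The antipode and the comultiplication -/

namespace IsHopf

variable {Q} {ε : BHom H ℂ} {S T : BHom H H} (hQ : Q.IsHopf ε S T)

include hQ

theorem antiTensor_surjective : Function.Surjective (antiTensor S) := fun x =>
  ⟨antiTensor T x, eq_of_tmul ((antiTensor S).comp (antiTensor T)) (BHom.id _)
    (fun a b => by simp [hQ.right_inv]) x⟩

theorem antiTensor_mul (x y : CTensor H H) :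
    antiTensor S (x * y) = antiTensor S y * antiTensor S x :=
  bilin_ext (f := BHom.postcomp (antiTensor S) (mulHom _))
    (g := BHom.flip (BHom.precomp (mulHom _) (antiTensor S) (antiTensor S)))
    (fun v w v' w' => by simp [hQ.antipode_mul]) x y

/-- This is `Δ ∘ S = (S ⊗ S)τΔ` multiplied by `1 ⊗ S(b)`. Writing `h` as a slice `(id ⊗ φ)γ_r(x ⊗
c)` makes `S(h)` the slice `(id ⊗ φ)ρ_r(x ⊗ c)`, whose comultiplication is accessible through
`ρl_slice`. -/
theorem γr_antipode (h b : H) : Q.γr (tmul (S h) (S b)) = antiTensor S (Q.ρl (tmul b h)) := by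
  obtain ⟨f₀, hf₀⟩ := Q.exists_φ_eq_one
  have h3 : h = idTensor H Q.φ (Q.γr (Q.γr.inverse Q.γr_iso (tmul h f₀))) := by simp [hf₀]
  rw [h3]
  refine eq_of_tmul (((Q.γr.curry.flip (S b)).comp S).comp ((idTensor H Q.φ).comp Q.γr))
    ((antiTensor S).comp ((Q.ρl.curry b).comp ((idTensor H Q.φ).comp Q.γr))) (fun x c => ?_) _
  refine Q.map_mul_left_injective Q.hasSeparatingDual fun p => ?_
  simp only [BHom.comp_apply, BHom.flip_apply, BHom.curry_apply]
  rw [Q.ρl_mul_right, hQ.slice _ Q.isLeftInvariant_φ, Q.ρl_slice, CTensor.map_map]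
  have h1 := Q.galoisSystem.L_slice Q.φ c (tmul b x)
  simp only [map_tmul, BHom.id_apply, BHom.comp_apply, BHom.flip_apply, BHom.curry_apply] at h1
  rw [h1, antiTensor, BHom.comp_apply, flip_map, CTensor.map_map, CTensor.map_map]
  -- both sides depend linearly on `Q.ρl (p ⊗ c)`
  let N : BHom (CTensor H H) (BHom H H) := BHom.flip ((BHom.compHom _ _ _ (idTensor H Q.φ)).comp
    ((mapHom H H H H (BHom.id H)).comp (mulHom H)))
  -- By strong invariance and `(p ⊗ 1)ρ_r(y ⊗ c) = (1 ⊗ y)ρ_l(p ⊗ c)`, the map `y ↦ p S((id ⊗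
  -- φ)γ_r(y ⊗ c))` involves `p` and `c` only through `ρ_l(p ⊗ c)`.
  have hN : ((mulHom H p).comp S).comp ((idTensor H Q.φ).comp (BHom.flip Q.γr.curry c)) =
      N (Q.ρl (tmul p c)) := by
    ext y
    simp only [BHom.comp_apply, BHom.flip_apply, BHom.curry_apply]
    rw [hQ.slice _ Q.isLeftInvariant_φ]
    have h2 := idTensor_map Q.φ (mulHom H p) (BHom.id H) (Q.ρr (tmul y c))
    rw [BHom.comp_id] at h2
    rw [← h2, Q.ρl_mul_ρr]
    rfl
  simp only [BHom.comp_id, BHom.id_comp]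
  rw [hN]
  refine eq_of_tmul (map (BHom.id H) ((BHom.flip (mulHom H) (S b)).comp
    ((idTensor H Q.φ).comp (Q.ρr.curry x))))
    ((BHom.eval (flip H H (Q.ρl (tmul b x)))).comp
      ((BHom.flip (mapHom H H H H) S).comp N)) (fun p' c' => ?_) _
  have h4 : N (tmul p' c') = (BHom.flip (BHom.smulHom H) p').comp
      (Q.φ.comp (BHom.flip (mulHom H) c')) := by
    ext y
    simp only [N, BHom.flip_apply, BHom.comp_apply, BHom.compHom_apply, mapHom_apply, map_tmul,
      BHom.id_apply, idTensor_tmul, mulHom_apply]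
    rfl
  have h5 : ∀ w : CTensor H H, map ((BHom.flip (BHom.smulHom H) p').comp
      (Q.φ.comp (BHom.flip (mulHom H) c'))) S (flip H H w) =
      tmul p' (S (idTensor H (Q.φ.comp (BHom.flip (mulHom H) c')) w)) := fun w => by
    refine eq_of_tmul ((map ((BHom.flip (BHom.smulHom H) p').comp
      (Q.φ.comp (BHom.flip (mulHom H) c'))) S).comp (flip H H))
      ((tmulHom H H p').comp (S.comp (idTensor H (Q.φ.comp (BHom.flip (mulHom H) c')))))
      (fun s t => ?_) w
    simp only [BHom.comp_apply, flip_tmul, map_tmul, idTensor_tmul, tmulHom_apply, map_smul]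
    exact smul_tmul _ _ _
  -- With `p' ⊗ c'` in place of `ρ_l(p ⊗ c)`, what remains is `S` applied to `(id ⊗ φ)(ρ_l(b ⊗ x)(1
  -- ⊗ c')) = b (id ⊗ φ)γ_r(x ⊗ c')`; antimultiplicativity of `S` moves `S(b)` to the right.
  have h6 := idTensor_map Q.φ (BHom.id H) (BHom.flip (mulHom H) c') (Q.ρl (tmul b x))
  rw [← Q.ρl_mul_right, idTensor_map, BHom.id_apply] at h6
  simp only [BHom.comp_apply, BHom.flip_apply, BHom.eval_apply, mapHom_apply, map_tmul,
    BHom.id_apply, BHom.curry_apply, mulHom_apply]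
  rw [h4, h5, ← h6, BHom.comp_id, mulHom_apply, hQ.antipode_mul,
    hQ.slice _ Q.isLeftInvariant_φ]

theorem Δ_antipode_left (h : H) (x : CTensor H H) :
    (Q.Δ (S h)).left (antiTensor S x) = antiTensor S ((Q.Δ h).right x) := by
  refine eq_of_tmul ((Q.Δ (S h)).left.comp (antiTensor S)) ((antiTensor S).comp (Q.Δ h).right)
    (fun a b => ?_) x
  simp only [BHom.comp_apply, antiTensor_tmul]
  rw [Q.Δ_left_tmul', Q.Δ_right_tmul, hQ.γr_antipode]
  exact eq_of_tmul ((map (BHom.flip (mulHom H) (S b)) (BHom.id H)).comp (antiTensor S))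
    ((antiTensor S).comp (map (BHom.id H) (mulHom H b)))
    (fun s t => by simp [hQ.antipode_mul]) _

theorem eq_of_mul_antiTensor {x y : CTensor H H}
    (h : ∀ u, x * antiTensor S u = y * antiTensor S u) : x = y :=
  sub_eq_zero.1 (Q.tensor_eq_zero_of_mul fun z => by
    obtain ⟨u, rfl⟩ := hQ.antiTensor_surjective z
    rw [sub_mul, h, sub_self])

theorem eq_of_antiTensor_mul {x y : CTensor H H}
    (h : ∀ u, antiTensor S u * x = antiTensor S u * y) : x = y :=
  sub_eq_zero.1 (Q.tensor_eq_zero_of_mul' fun z => by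
    obtain ⟨u, rfl⟩ := hQ.antiTensor_surjective z
    rw [mul_sub, h, sub_self])

/-- Compatibility of the left and right actions of a multiplier deduces this from `Δ_antipode_left`,
after multiplication by elements `antiTensor S v`, which exhaust `H ⊗̂ H`. -/
theorem Δ_antipode_right (h : H) (x : CTensor H H) :
    (Q.Δ (S h)).right (antiTensor S x) = antiTensor S ((Q.Δ h).left x) := by
  refine hQ.eq_of_mul_antiTensor fun v => ?_
  rw [← Multiplier.compat, hQ.Δ_antipode_left, ← hQ.antiTensor_mul, ← hQ.antiTensor_mul,
    ← Multiplier.compat]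

theorem ρl_antipode (h b : H) : Q.ρl (tmul (S b) (S h)) = antiTensor S (Q.γr (tmul h b)) := by
  refine hQ.eq_of_antiTensor_mul fun u => ?_
  rw [Q.mul_ρl, ← hQ.antiTensor_mul, Q.γr_mul, ← hQ.Δ_antipode_right]
  congr 1
  exact eq_of_tmul ((map (BHom.flip (mulHom H) (S b)) (BHom.id H)).comp (antiTensor S))
    ((antiTensor S).comp (map (BHom.id H) (mulHom H b)))
    (fun s t => by simp [hQ.antipode_mul]) _

theorem γl_antipode (h b : H) : Q.γl (tmul (S h) (S b)) = antiTensor S (Q.ρr (tmul b h)) := by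
  refine hQ.eq_of_mul_antiTensor fun u => ?_
  rw [Q.γl_mul, ← hQ.antiTensor_mul, Q.mul_ρr, ← hQ.Δ_antipode_left]
  congr 1
  exact eq_of_tmul ((map (mulHom H (S b)) (BHom.id H)).comp (antiTensor S))
    ((antiTensor S).comp (map (BHom.id H) (BHom.flip (mulHom H) b)))
    (fun s t => by simp [hQ.antipode_mul]) _

theorem ρr_antipode (h b : H) : Q.ρr (tmul (S b) (S h)) = antiTensor S (Q.γl (tmul h b)) := by
  refine hQ.eq_of_antiTensor_mul fun u => ?_
  rw [Q.mul_ρr, ← hQ.antiTensor_mul, Q.γl_mul, ← hQ.Δ_antipode_right]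
  congr 1
  exact eq_of_tmul ((map (BHom.id H) (BHom.flip (mulHom H) (S b))).comp (antiTensor S))
    ((antiTensor S).comp (map (mulHom H b) (BHom.id H)))
    (fun s t => by simp [hQ.antipode_mul]) _

/-! ### The counit -/

theorem counit_γl (f g : H) : idTensor H ε (Q.γl (tmul f g)) = f * g := by
  refine Q.eq_of_mul_left fun c => ?_
  have h1 := idTensor_map ε (mulHom H c) (BHom.id H) (Q.γl (tmul f g))
  rw [Q.ρl_mul_right', idTensor_map, BHom.comp_id, hQ.counit_ρl] at h1
  simpa [mul_assoc] using h1.symm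

theorem counit_ρr (f g : H) : tensorId H ε (Q.ρr (tmul g f)) = g * f := by
  refine Q.eq_of_mul_right fun c => ?_
  have h1 := tensorId_map ε (BHom.id H) (BHom.flip (mulHom H) c) (Q.ρr (tmul g f))
  rw [← Q.ρr_mul_right', tensorId_map, BHom.comp_id, hQ.counit_γr] at h1
  simpa [mul_assoc] using h1.symm

/-- Since `ε` is multiplicative, `id ⊗ ε` of `(c ⊗ 1)γ_r(x ⊗ y) = ρ_l(c ⊗ x)(1 ⊗ y)` is `ε(y) cx`;
then `c` is cancelled. -/
theorem idTensor_counit_γr (u : CTensor H H) : idTensor H ε (Q.γr u) = idTensor H ε u := by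
  refine eq_of_tmul ((idTensor H ε).comp Q.γr) (idTensor H ε)
    (fun x y => Q.eq_of_mul_left fun c => ?_) u
  have h1 := idTensor_map ε (mulHom H c) (BHom.id H) (Q.γr (tmul x y))
  have h2 : ε.comp (BHom.flip (mulHom H) y) = ε y • ε := by
    ext z
    simp [hQ.counit_mul, mul_comm]
  have h3 : ∀ w, idTensor H (ε y • ε) w = ε y • idTensor H ε w := fun w =>
    eq_of_tmul (idTensor H (ε y • ε)) (ε y • idTensor H ε) (fun a b => by simp [smul_smul]) w
  rw [Q.ρl_mul_right, idTensor_map, h2, h3, BHom.id_apply, hQ.counit_ρl] at h1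
  simpa [mul_smul_comm] using h1.symm

theorem tensorId_counit_ρl (u : CTensor H H) : tensorId H ε (Q.ρl u) = tensorId H ε u := by
  refine eq_of_tmul ((tensorId H ε).comp Q.ρl) (tensorId H ε)
    (fun x y => Q.eq_of_mul_right fun c => ?_) u
  have h1 := tensorId_map ε (BHom.id H) (BHom.flip (mulHom H) c) (Q.ρl (tmul x y))
  have h2 : ε.comp (mulHom H x) = ε x • ε := by
    ext z
    simp [hQ.counit_mul]
  have h3 : ∀ w, tensorId H (ε x • ε) w = ε x • tensorId H ε w := fun w =>
    eq_of_tmul (tensorId H (ε x • ε)) (ε x • tensorId H ε) (fun a b => by simp [smul_smul]) w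
  rw [← Q.ρl_mul_right, tensorId_map, h2, h3, BHom.id_apply, hQ.counit_γr] at h1
  simpa [smul_mul_assoc] using h1.symm

theorem exists_counit_eq_one : ∃ e, ε e = 1 := by
  obtain ⟨x, hx⟩ := @exists_ne H Q.nontrivial 0
  have : ∃ g, ε g ≠ 0 := by
    by_contra! h
    refine hx (Q.eq_zero_of_mul_left fun b => ?_)
    have h1 := hQ.counit_ρl (tmul b x)
    rw [lift_tmul] at h1
    refine h1.symm.trans ?_
    exact eq_of_tmul (idTensor H ε) 0 (fun v w => by simp [h]) _
  obtain ⟨g, hg⟩ := this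
  exact ⟨(ε g)⁻¹ • g, by rw [map_smul, smul_eq_mul, inv_mul_cancel₀ hg]⟩

theorem counit_essential :
    InducesIso (A := H) (V := H) (W := ℂ) (X := ℂ) (· * ·)
      (fun h z => ε h * z) (fun h z => ε h * z) ∧
    InducesIso (A := H) (V := ℂ) (W := H) (X := ℂ)
      (fun z h => z * ε h) (· * ·) (fun z h => z * ε h) := by
  obtain ⟨e, he⟩ := hQ.exists_counit_eq_one
  constructor
  · have h1 := InducesIso.of_inverse (A := H) (r := (· * ·)) (l := fun h (z : ℂ) => ε h * z)
      (tensorId ℂ ε) (fun v a w => by simp [hQ.counit_mul, mul_assoc]) (tmulHom H ℂ e)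
      (fun x => by simp [he]) (fun b z => ?_)
    · simpa using h1
    set mk := BalancedTensor.mk (fun v h : H => v * h) (fun (h : H) (z : ℂ) => ε h * z)
    -- In the balanced tensor product `va ⊗ z = v ⊗ ε(a)z`. Hence `μ` and `id ⊗ ε` become equal in
    -- the first leg.
    have h2 : ∀ u : CTensor H H, mk (tmul (lift (mulHom H) u) z) =
        mk (tmul (idTensor H ε u) z) := fun u => by
      refine eq_of_tmul ((mk.comp ((tmulHom H ℂ).flip z)).comp (lift (mulHom H)))
        ((mk.comp ((tmulHom H ℂ).flip z)).comp (idTensor H ε)) (fun v a => ?_) u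
      have h3 := BalancedTensor.mk_eq (fun v h : H => v * h) (fun (h : H) (z : ℂ) => ε h * z) v a z
      simp only [BHom.comp_apply, lift_tmul, mulHom_apply, BHom.flip_apply, tmulHom_apply,
        idTensor_tmul, smul_tmul]
      rw [h3, ← smul_eq_mul, tmul_smul]
    -- For `u = γ_r⁻¹(e ⊗ b)` one has `μ(u) = (ε ⊗ id)(e ⊗ b) = b` and `(id ⊗ ε)(u) = ε(b) e`, so `b
    -- ⊗ z` and `e ⊗ ε(b)z` have the same class.
    have h4 := h2 (Q.γr.inverse Q.γr_iso (tmul e b))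
    rw [← hQ.counit_γr, ← hQ.idTensor_counit_γr, BHom.apply_inverse, tensorId_tmul,
      idTensor_tmul, he, one_smul, smul_tmul] at h4
    rw [tensorId_tmul, tmulHom_apply, tmul_smul]
    exact h4.symm
  · have h1 := InducesIso.of_inverse (A := H) (r := fun (z : ℂ) h => z * ε h) (l := (· * ·))
      (idTensor ℂ ε) (fun v a w => by simp [hQ.counit_mul]; ring)
      ((tmulHom ℂ H).flip e) (fun x => by simp [he]) (fun z b => ?_)
    · simpa [mul_comm] using h1
    set mk := BalancedTensor.mk (fun (z : ℂ) (h : H) => z * ε h) (fun v h : H => v * h)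
    have h2 : ∀ u : CTensor H H, mk (tmul z (lift (mulHom H) u)) =
        mk (tmul z (tensorId H ε u)) := fun u => by
      refine eq_of_tmul ((mk.comp (tmulHom ℂ H z)).comp (lift (mulHom H)))
        ((mk.comp (tmulHom ℂ H z)).comp (tensorId H ε)) (fun v a => ?_) u
      have h3 := BalancedTensor.mk_eq (fun (z : ℂ) (h : H) => z * ε h) (fun v h : H => v * h) z v a
      simp only [BHom.comp_apply, lift_tmul, mulHom_apply, tmulHom_apply,
        tensorId_tmul, tmul_smul]
      rw [← h3, mul_comm, ← smul_eq_mul, smul_tmul]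
    -- The mirror choice `u = ρ_l⁻¹(b ⊗ e)` has `μ(u) = b` and `(ε ⊗ id)(u) = ε(b) e`.
    have h4 := h2 (Q.ρl.inverse Q.ρl_iso (tmul b e))
    rw [← hQ.counit_ρl, ← hQ.tensorId_counit_ρl, BHom.apply_inverse, tensorId_tmul,
      idTensor_tmul, he, one_smul, tmul_smul] at h4
    rw [idTensor_tmul, BHom.flip_apply, tmulHom_apply, smul_tmul]
    exact h4.symm

theorem isCounitAntipode : IsCounitAntipode Q ε S where
  counit_mul := hQ.counit_mul
  counit_essential := hQ.counit_essential
  counit_left f g := ⟨by simpa using hQ.counit_γr (tmul f g), hQ.counit_ρr f g⟩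
  counit_right f g := ⟨hQ.counit_γl f g, by simpa using hQ.counit_ρl (tmul g f)⟩
  antipode_iso := isBornIso_of_inverse S T hQ.left_inv hQ.right_inv
  antipode_mul := hQ.antipode_mul
  antipode_comul h x := ⟨hQ.Δ_antipode_left h x, hQ.Δ_antipode_right h x⟩
  antipode_left := hQ.antipode_γr
  antipode_right := hQ.antipode_ρl

/-- Surjectivity of `ρ_l` makes `(id ⊗ ε)ρ_l = μ` determine the counit; surjectivity of `γ_r` makes
`μ(S ⊗ id)γ_r = ε ⊗ id` determine every `S(y) b`, hence `S`. -/
theorem eq_of_isCounitAntipode {ε' : BHom H ℂ} {S' : BHom H H} (h : IsCounitAntipode Q ε' S') :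
    ε' = ε ∧ S' = S := by
  obtain ⟨x, hx⟩ := @exists_ne H Q.nontrivial 0
  have h1 : ε' = ε := by
    ext y
    have h2 : idTensor H ε' (tmul x y) = idTensor H ε (tmul x y) :=
      eq_of_surjective Q.ρl_iso.1.2 (idTensor H ε') (idTensor H ε) (fun g f => by
        rw [(h.counit_right f g).2, hQ.counit_ρl]; simp) _
    rw [idTensor_tmul, idTensor_tmul] at h2
    exact smul_left_injective ℂ hx h2
  subst h1
  refine ⟨rfl, BHom.ext fun y => Q.eq_of_mul_right fun b => ?_⟩
  obtain ⟨u, hu⟩ := Q.γr_iso.1.2 (tmul y b)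
  have h3 := (h.antipode_left u).trans (hQ.antipode_γr u).symm
  rw [hu] at h3
  simpa using h3

end IsHopf

end BornologicalQuantumGroup

/-! ### Slices under the antipode and uses of faithfulness -/

section

variable {V W : Type*}
  [AddCommGroup V] [Module ℂ V] [Bornology V] [CompleteBornology V]
  [AddCommGroup W] [Module ℂ W] [Bornology W] [CompleteBornology W]

theorem idTensor_antiTensor (S : BHom V W) (η : BHom W ℂ) (u : CTensor V V) :
    idTensor W η (antiTensor S u) = S (tensorId V (η.comp S) u) := by
  rw [antiTensor, BHom.comp_apply, idTensor_map, idTensor_flip]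

theorem tensorId_antiTensor (S : BHom V W) (η : BHom W ℂ) (u : CTensor V V) :
    tensorId W η (antiTensor S u) = S (idTensor V (η.comp S) u) := by
  rw [antiTensor, BHom.comp_apply, tensorId_map, tensorId_flip]

end

namespace BornologicalQuantumGroup

variable {H : Type*}
  [NonUnitalRing H] [Module ℂ H] [IsScalarTower ℂ H H] [SMulCommClass ℂ H H]
  [Bornology H] [CompleteBornology H] [BornologicalAlgebra H] (Q : BornologicalQuantumGroup H)

include Q

theorem eq_of_φ_mul_left {x y : H} (h : ∀ z, Q.φ (z * x) = Q.φ (z * y)) : x = y :=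
  sub_eq_zero.1 (Q.faithful.2 _ fun z => by rw [mul_sub, map_sub, h, sub_self])

theorem eq_of_φ_mul_right {x y : H} (h : ∀ z, Q.φ (x * z) = Q.φ (y * z)) : x = y :=
  sub_eq_zero.1 (Q.faithful.1 _ fun z => by rw [sub_mul, map_sub, h, sub_self])

theorem ρr_mul_tmul (z x c : H) :
    Q.ρr (tmul (z * x) c) = map (BHom.id H) (mulHom H z) (Q.ρr (tmul x c)) := by
  refine Q.map_mul_left_injective Q.hasSeparatingDual fun p => ?_
  have h1 := congrArg (map (BHom.id H) (mulHom H z)) (Q.ρl_mul_ρr p x c)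
  rw [CTensor.map_map, CTensor.map_map] at h1
  have h2 : (mulHom H z).comp (mulHom H x) = mulHom H (z * x) :=
    BHom.ext fun y => (mul_assoc z x y).symm
  rw [Q.ρl_mul_ρr, CTensor.map_map, ← h2]
  exact h1.symm

/-! ### Haar functionals -/

namespace IsHopf

variable {Q} {ε : BHom H ℂ} {S T : BHom H H} (hQ : Q.IsHopf ε S T)

include hQ

theorem injective : Function.Injective S := Function.LeftInverse.injective hQ.left_inv

/-- The antipode exchanges the legs, so it turns the left invariance of `φ` into right invariance of
`ψ = φ ∘ S`. Repeating this makes `φ ∘ S²` left invariant. -/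
theorem γr_rightInvariant (h b : H) :
    tensorId H (Q.φ.comp S) (Q.γr (tmul h b)) = Q.φ (S h) • b := by
  apply hQ.injective
  rw [← idTensor_antiTensor, ← hQ.ρl_antipode, Q.isLeftInvariant_φ, map_smul]

theorem ρr_rightInvariant (b h : H) :
    tensorId H (Q.φ.comp S) (Q.ρr (tmul b h)) = Q.φ (S h) • b := by
  apply hQ.injective
  rw [← idTensor_antiTensor, ← hQ.γl_antipode, (Q.leftInvariant _ _).1, map_smul]

theorem isLeftInvariant_antipode_sq : Q.IsLeftInvariant ((Q.φ.comp S).comp S) := fun g f => by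
  apply hQ.injective
  rw [← tensorId_antiTensor, ← hQ.γr_antipode, hQ.γr_rightInvariant, map_smul]
  rfl

/-- Left invariant functionals are unique up to scalars. -/
theorem isLeftInvariant_unique {η : BHom H ℂ} (hη : Q.IsLeftInvariant η) :
    ∃ ν : ℂ, ∀ c, η c = ν * Q.φ c := by
  obtain ⟨f₀, hf₀⟩ := Q.exists_φ_eq_one
  -- The number `(φ ⊗ η)((1 ⊗ x)Δ(c))` is evaluated by strong invariance for `η`, followed by right
  -- invariance of `φ ∘ S`.
  have h1 : ∀ η, Q.IsLeftInvariant η → ∀ x c,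
      η (tensorId H Q.φ (Q.ρr (tmul x c))) = Q.φ (S x) * η c := fun η hη x c => by
    rw [← apply_idTensor, ← hQ.slice η hη]
    have := apply_idTensor (Q.φ.comp S) η (Q.γr (tmul x c))
    rw [hQ.γr_rightInvariant, map_smul, smul_eq_mul] at this
    exact this
  -- Choosing `x = T f₀` makes the factor `φ(S x)` equal to `1`. If `φ c = 0`, the case `η = φ`
  -- shows that `(φ ⊗ id)ρ_r(x ⊗ c)` is annihilated by all `φ(z ·)`, hence is zero; so `η c = 0`,
  -- and the kernel of `φ` lies in that of `η`.
  have h2 : ∀ c, Q.φ c = 0 → η c = 0 := fun c hc => by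
    have h3 := h1 η hη (T f₀) c
    rw [hQ.right_inv, hf₀, one_mul] at h3
    rw [← h3, Q.faithful.2 (tensorId H Q.φ (Q.ρr (tmul (T f₀) c))) fun z => ?_, map_zero]
    have h4 := tensorId_map Q.φ (BHom.id H) (mulHom H z) (Q.ρr (tmul (T f₀) c))
    rw [← Q.ρr_mul_tmul] at h4
    have h5 := h1 Q.φ Q.isLeftInvariant_φ (z * T f₀) c
    rw [h4, hc, mul_zero] at h5
    exact h5
  refine ⟨η f₀, fun c => ?_⟩
  have h6 := h2 (c - Q.φ c • f₀) (by simp [hf₀])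
  rw [map_sub, map_smul, sub_eq_zero, smul_eq_mul, mul_comm] at h6
  exact h6

/-! ### The modular automorphism -/

/-- Strong right invariance of `ψ = φ ∘ S`: one more application of `S` exchanges the legs and
reduces it to strong left invariance of `φ`. -/
theorem antipode_slice_ρl (b h : H) : S (tensorId H (Q.φ.comp S) (Q.ρl (tmul b h))) =
    tensorId H (Q.φ.comp S) (Q.γl (tmul b h)) := by
  apply hQ.injective
  rw [← idTensor_antiTensor, ← idTensor_antiTensor, ← hQ.γr_antipode, ← hQ.ρr_antipode,
    hQ.slice _ Q.isLeftInvariant_φ]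

/-- For `y = a ⊗ c` both sides equal `ψ(a (id ⊗ φ)γ_r(x ⊗ c))`, where `ψ = φ ∘ S`. The purpose is to
rewrite `φ(· d)` as `ψ(d' ·)`; all `d` and all `d'` occur as `y` varies. -/
theorem φ_mul_slice (x : H) (y : CTensor H H) :
    Q.φ (x * tensorId H Q.φ (Q.γl (map (BHom.id H) S (flip H H y)))) =
      Q.φ (S (idTensor H (Q.φ.comp T) (Q.ρr (map S (BHom.id H) (flip H H y))) * x)) := by
  refine eq_of_tmul
    ((Q.φ.comp (mulHom H x)).comp ((tensorId H Q.φ).comp (Q.γl.comp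
      ((map (BHom.id H) S).comp (flip H H)))))
    ((Q.φ.comp (S.comp (BHom.flip (mulHom H) x))).comp ((idTensor H (Q.φ.comp T)).comp (Q.ρr.comp
      ((map S (BHom.id H)).comp (flip H H))))) (fun a c => ?_) y
  simp only [BHom.comp_apply, flip_tmul, map_tmul, BHom.id_apply, mulHom_apply, BHom.flip_apply]
  -- Strong left invariance gives `(φ ⊗ φ)` of `ρ_r(x ⊗ c)(S(a) ⊗ 1) = (1 ⊗ x)γ_l(c ⊗ S(a))`.
  have h1 : Q.φ (S (a * idTensor H Q.φ (Q.γr (tmul x c)))) =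
      Q.φ (x * tensorId H Q.φ (Q.γl (tmul c (S a)))) := by
    have h2 := idTensor_map Q.φ (BHom.flip (mulHom H) (S a)) (BHom.id H) (Q.ρr (tmul x c))
    have h3 := tensorId_map Q.φ (BHom.id H) (mulHom H x) (Q.γl (tmul c (S a)))
    rw [← Q.ρr_mul_right] at h2
    rw [hQ.antipode_mul, hQ.slice _ Q.isLeftInvariant_φ]
    refine (congrArg Q.φ h2).symm.trans ?_
    rw [apply_idTensor, h3]
    rfl
  -- Here `ψ ⊗ φ` is applied to `(a ⊗ 1)γ_r(x ⊗ c) = ρ_l(a ⊗ x)(1 ⊗ c)`.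
  have h4 : Q.φ (S (a * idTensor H Q.φ (Q.γr (tmul x c)))) =
      Q.φ (tensorId H (Q.φ.comp S) (Q.ρl (tmul a x)) * c) := by
    have h2 := idTensor_map Q.φ (mulHom H a) (BHom.id H) (Q.γr (tmul x c))
    have h3 := tensorId_map (Q.φ.comp S) (BHom.id H) (BHom.flip (mulHom H) c) (Q.ρl (tmul a x))
    rw [Q.ρl_mul_right] at h2
    refine (congrArg (Q.φ.comp S) h2).symm.trans ?_
    rw [apply_idTensor, h3]
    rfl
  -- Inserting `T ∘ S = id` allows strong right invariance to be used; then `(1 ⊗ S(c))γ_l(a ⊗ x) =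
  -- ρ_r(S(c) ⊗ a)(x ⊗ 1)`.
  have h5 : Q.φ (tensorId H (Q.φ.comp S) (Q.ρl (tmul a x)) * c) =
      Q.φ (S (idTensor H (Q.φ.comp T) (Q.ρr (tmul (S c) a)) * x)) := by
    have h2 := tensorId_map (Q.φ.comp S) (BHom.id H) (mulHom H (S c)) (Q.γl (tmul a x))
    have h3 := idTensor_map (Q.φ.comp T) (BHom.flip (mulHom H) x) (BHom.id H)
      (Q.ρr (tmul (S c) a))
    rw [Q.ρr_mul_right] at h2
    rw [← hQ.left_inv (tensorId H (Q.φ.comp S) (Q.ρl (tmul a x)) * c), hQ.antipode_mul,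
      hQ.antipode_slice_ρl]
    refine (congrArg (Q.φ.comp T) h2).symm.trans ?_
    rw [← apply_idTensor, h3]
    rfl
  rw [← h1, h4, h5]

/-- Both sides are `(ψ ⊗ φ)(y Δ(x))` with `ψ = φ ∘ S`: for `y = ρ_r(a ⊗ b)` right invariance of `ψ`
gives `φ(a)ψ(bx)`, and for `y = ρ_l(a ⊗ b)` left invariance of `φ` gives `ψ(a)φ(bx)`. -/
theorem φ_inverse_mul (y : CTensor H H) (x : H) :
    Q.φ (S (tensorId H Q.φ (Q.ρr.inverse Q.ρr_iso y) * x)) =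
      Q.φ (tensorId H (Q.φ.comp S) (Q.ρl.inverse Q.ρl_iso y) * x) := by
  have h1 := eq_of_surjective Q.ρr_iso.1.2
    (Q.φ.comp ((S.comp (BHom.flip (mulHom H) x)).comp
      ((tensorId H Q.φ).comp (Q.ρr.inverse Q.ρr_iso))))
    (Q.φ.comp ((tensorId H (Q.φ.comp S)).comp (Q.Δ x).right)) (fun a b => by
      simp only [BHom.comp_apply]
      rw [← Q.ρr_tmul_mul, hQ.ρr_rightInvariant, BHom.inverse_apply]
      simp [mul_comm]) y
  have h2 := eq_of_surjective Q.ρl_iso.1.2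
    (Q.φ.comp ((BHom.flip (mulHom H) x).comp
      ((tensorId H (Q.φ.comp S)).comp (Q.ρl.inverse Q.ρl_iso))))
    (Q.φ.comp ((tensorId H (Q.φ.comp S)).comp (Q.Δ x).right)) (fun a b => by
      simp only [BHom.comp_apply]
      rw [← Q.ρl_tmul_mul, ← apply_idTensor, Q.isLeftInvariant_φ, BHom.inverse_apply]
      simp [mul_comm]) y
  exact h1.trans h2.symm

/-- Every functional `φ (f ·)` is of the form `φ (· h)`, and conversely. -/
theorem exists_modular : ∃ σ τ : BHom H H, (∀ f g, Q.φ (f * g) = Q.φ (g * σ f)) ∧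
    ∀ f g, Q.φ (g * f) = Q.φ (τ f * g) := by
  obtain ⟨f₀, hf₀⟩ := Q.exists_φ_eq_one
  let A := (tensorId H Q.φ).comp (Q.γl.comp ((map (BHom.id H) S).comp (flip H H)))
  let B := (idTensor H (Q.φ.comp T)).comp (Q.ρr.comp ((map S (BHom.id H)).comp (flip H H)))
  have hAB : ∀ x y, Q.φ (x * A y) = Q.φ (S (B y * x)) := hQ.φ_mul_slice
  let C := (tensorId H Q.φ).comp (Q.ρr.inverse Q.ρr_iso)
  let D := (tensorId H (Q.φ.comp S)).comp (Q.ρl.inverse Q.ρl_iso)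
  have hCD : ∀ y x, Q.φ (S (C y * x)) = Q.φ (D y * x) := hQ.φ_inverse_mul
  have hTS : S.comp T = BHom.id H := BHom.ext hQ.right_inv
  -- Bounded right inverses of the slice maps: the leg to be sliced is filled with `f₀`, `S f₀` or
  -- `T f₀`, according to whether `φ`, `φ ∘ T` or `φ ∘ S` is applied, so that the value is `1`.
  let sA := (flip H H).comp ((map (BHom.id H) T).comp
    ((Q.γl.inverse Q.γl_iso).comp (tmulHom H H f₀)))
  have hA : ∀ d, A (sA d) = d := fun d => by simp [A, sA, CTensor.map_map, hTS, hf₀]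
  let sB := (flip H H).comp ((map T (BHom.id H)).comp
    ((Q.ρr.inverse Q.ρr_iso).comp ((tmulHom H H).flip (S f₀))))
  have hB : ∀ d, B (sB d) = d := fun d => by
    simp [B, sB, CTensor.map_map, hTS, hf₀, hQ.left_inv]
  let sC := Q.ρr.comp (tmulHom H H f₀)
  have hC : ∀ d, C (sC d) = d := fun d => by simp [C, sC, hf₀]
  let sD := Q.ρl.comp (tmulHom H H (T f₀))
  have hD : ∀ d, D (sD d) = d := fun d => by simp [D, sD, hf₀, hQ.right_inv]
  -- The chain for `σ` is `φ(f ·) = ψ(C(sD f) ·) = φ(· A(sB(C(sD f))))`; the map `τ` runs through it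
  -- backwards.
  refine ⟨(A.comp sB).comp (C.comp sD), (D.comp sC).comp (B.comp sA), fun f g => ?_,
    fun f g => ?_⟩
  · simp only [BHom.comp_apply]
    rw [hAB, hB, hCD, hD]
  · simp only [BHom.comp_apply]
    rw [← hCD, hC, ← hAB, hA]

theorem exists_modularAutomorphism : ∃ σ : H →ₙₐ[ℂ] H, IsBornIso σ ∧ (∀ f g : H, Q.φ (f * g) = Q.φ (g * σ f)) ∧
    (∀ σ' : H →ₙₐ[ℂ] H, (∀ f g : H, Q.φ (f * g) = Q.φ (g * σ' f)) → σ' = σ) ∧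
    (∀ f : H, Q.φ (σ f) = Q.φ f) ∧ ∀ f : H, S (S (σ f)) = σ (S (S f)) := by
  obtain ⟨σ₀, τ, hσ, hτ⟩ := hQ.exists_modular
  let σ : H →ₙₐ[ℂ] H :=
    { toFun := σ₀
      map_smul' := fun c x => map_smul σ₀ c x
      map_zero' := map_zero σ₀
      map_add' := fun x y => map_add σ₀ x y
      -- Moving `x` and `y` around one at a time gives `φ(xyz) = φ(yzσ(x)) = φ(zσ(x)σ(y))`.
      map_mul' := fun x y => Q.eq_of_φ_mul_left fun z => by
        rw [← hσ, mul_assoc, hσ, mul_assoc, hσ, mul_assoc] }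
  have hσ' : ∀ f g, Q.φ (f * g) = Q.φ (g * σ f) := hσ
  refine ⟨σ, isBornIso_of_inverse σ₀ τ (fun x => Q.eq_of_φ_mul_right fun z => ?_)
    (fun x => Q.eq_of_φ_mul_left fun z => ?_), hσ', fun σ' h => ?_, fun f => ?_, fun f => ?_⟩
  · rw [← hτ, ← hσ]
  · rw [← hσ, ← hτ]
  · ext f
    exact Q.eq_of_φ_mul_left fun z => by rw [← h, ← hσ']
  -- On products, `φ(fg) = φ(gσ(f)) = φ(σ(f)σ(g))`; as `H` is essential, `μ` maps `H ⊗̂ H` onto `H`.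
  · obtain ⟨u, rfl⟩ := Q.mul_surjective f
    refine eq_of_tmul ((Q.φ.comp σ₀).comp (lift (mulHom H))) (Q.φ.comp (lift (mulHom H)))
      (fun f g => ?_) u
    simp only [BHom.comp_apply, lift_tmul, mulHom_apply]
    rw [hσ' f g, hσ' g (σ f), ← map_mul]
    rfl
  · obtain ⟨ν, hν⟩ := hQ.isLeftInvariant_unique hQ.isLeftInvariant_antipode_sq
    have hmul : ∀ x y, S (S (x * y)) = S (S x) * S (S y) := fun x y => by
      rw [hQ.antipode_mul, hQ.antipode_mul]
    refine Q.eq_of_φ_mul_left fun z => ?_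
    obtain ⟨g, rfl⟩ : ∃ g, S (S g) = z := ⟨T (T z), by rw [hQ.right_inv, hQ.right_inv]⟩
    rw [← hσ', ← hmul, ← hmul]
    -- The scalar `ν` appears on both sides: `φ(S²(fg)) = νφ(fg) = νφ(gσ(f)) = φ(S²(gσ(f)))`. Its
    -- value is irrelevant.
    exact (hν _).trans ((congrArg (ν * ·) (hσ' f g).symm).trans (hν _).symm)

end IsHopf

end BornologicalQuantumGroup

end BornQG

end

theorem mainTheorem8 {H : Type*} [NonUnitalRing H] [Module ℂ H] [IsScalarTower ℂ H H]
    [SMulCommClass ℂ H H] [Bornology H] [BornQG.CompleteBornology H] [BornQG.BornologicalAlgebra H]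
    (Q : BornQG.BornologicalQuantumGroup H) :
    ∃ σ : H →ₙₐ[ℂ] H, BornQG.IsBornIso σ ∧ (∀ f g : H, Q.φ (f * g) = Q.φ (g * σ f)) ∧
      (∀ σ' : H →ₙₐ[ℂ] H, (∀ f g : H, Q.φ (f * g) = Q.φ (g * σ' f)) → σ' = σ) ∧
      (∀ f : H, Q.φ (σ f) = Q.φ f) ∧
      ∃ (ε : BornQG.BHom H ℂ) (S : BornQG.BHom H H), BornQG.IsCounitAntipode Q ε S ∧
        (∀ (ε' : BornQG.BHom H ℂ) (S' : BornQG.BHom H H),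
          BornQG.IsCounitAntipode Q ε' S' → ε' = ε ∧ S' = S) ∧
        ∀ f : H, S (S (σ f)) = σ (S (S f)) := by
  obtain ⟨ε, S, T, hQ⟩ := Q.exists_isHopf
  obtain ⟨σ, h1, h2, h3, h4, h5⟩ := hQ.exists_modularAutomorphism
  exact ⟨σ, h1, h2, h3, h4, ε, S, hQ.isCounitAntipode, fun _ _ h => hQ.eq_of_isCounitAntipode h, h5⟩
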